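/- **Setting.** A Frame shape is a formal product $\pi=\prod_a a^{m(a)}$ with $m(a)\in\mathbb Z$. Its order is $N=\operatorname{lcm}\{a\}$, and $\mathrm{Tr}(g^k)=\sum_{a\mid k}a\,m(a)$. Let $(\pi,\lambda)$ be one of the 42 pairs (Frame shape of a symmetry $g$ of a K3 non-linear sigma model, order of its multiplier). Here $\lambda=1$ for $1^{24}$, $1^82^8$, $1^{-8}2^{16}$, $1^63^6$, $1^{-3}3^9$, $1^42^24^4$, $1^82^{-8}4^8$, $1^{-4}2^64^4$, $2^{-4}4^8$, $1^45^4$, $1^{-1}5^5$, $1^22^23^26^2$, $1^4 2\, 3^{-4}6^5$, $1^52^{-4}3\,6^4$, $1^{-2}2^43^{-2}6^4$, $1^{-1}2^{-1}3^36^3$, $1^{-4}2^53^46$, $1^37^3$, $1^2 2\,4\,8^2$, $1^42^{-2}4^{-2}8^4$, $1^{-2}2^3 4\,8^2$, $1^33^{-2}9^3$, $1^2 2\,5^{-2}10^3$, $1^32^{-2}5\,10^2$, $1^{-2}2^35^210$, $1^211^2$, $1^22^{-2}3^24^26^{-2}12^2$, $1\,2^2 3\,4^{-2}12^2$, $1^23^{-2}4\,6^212$,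 $1^{-2}2^23^24\,12$, $1\,2\,7\,14$, $1\,3\,5\,15$; $\lambda=2$ for $2^{12}$, $2^44^4$, $2^36^3$, $2^44^{-4}8^4$, $2^210^2$, $2\,4\,6\,12$; $\lambda=3$ for $3^8$; $\lambda=4$ for $4^6$, $4^28^2$; $\lambda=6$ for $6^4$. Put $M=N\lambda$. A *system of twisted-twining genera* for $g$ consists of an integer $\mathcal E'$ coprime to $\lambda$ and holomorphic functions $\phi_{g^i,g^j}(\tau,z)$ on $\mathbb H\times\mathbb C$, $i,j\in\mathbb Z/M$, such that: * $\phi_{g^i,g^j}\big(\tfrac{a\tau+b}{c\tau+d},\tfrac{z}{c\tau+d}\big)=e^{2\pi i\frac{cz^2}{c\tau+d}}\,\phi_{g^{ai+cj},g^{bi+dj}}(\tau,z)$ for $\begin{pmatrix}a&b\\c&d\end{pmatrix}\in SL_2(\mathbb Z)$, and $\phi_{g^i,g^j}(\tau,z+\ell\tau+\ell')=e^{-2\pi i(\ell^2\tau+2\ell z)}\phi_{g^i,g^j}(\tau,z)$ for $\ell,\ell'\in\mathbb Z$; * for $r,s\in\mathbb Z$ the Fourier transforms $\hat\phi_{r,s}=\frac1M\sum_{k=1}^{M}e^{-2\pi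 i sk/M}\phi_{g^r,g^k}$ have absolutely convergent expansions $\hat\phi_{r,s}=\sum_{n\in\mathbb Q,\,l\in\mathbb Z}\hat c^g_{r,s}(n,l)\,q^ny^l$ (with $q=e^{2\pi i\tau}$, $y=e^{2\pi iz}$), where $\hat c^g_{r,s}(n,l)\in\mathbb Z$ is non-zero only if $n\ge0$ and $n\equiv\frac{rs}{M}\bmod\mathbb Z$; * $\phi_{e,g^k}\to2y+2y^{-1}+\mathrm{Tr}(g^k)-4$ as $\mathrm{Im}\,\tau\to\infty$; * $\hat\phi_{r,s}=0$ unless $s\equiv r\mathcal E'\bmod\lambda$, and $\hat\phi_{r+N,\,s-\mathcal E'N}=\hat\phi_{r,s}$. With $\Omega=\begin{pmatrix}\sigma&z\\z&\tau\end{pmatrix}$ and $p=e^{2\pi i\sigma}$, put $$\Phi_{g,e}(\Omega)=p\,q^{\frac1{24}\sum_a m(a)/a}\,y\prod_{(m,n,l)>0}\big(1-p^mq^{n/M}y^l\big)^{\hat c^g_{m,n}(mn/M,\,l)},$$ where $(m,n,l)>0$ means $m,n\in\mathbb Z_{\ge0}$, and $l\in\mathbb Z_{<0}$ if $m=n=0$,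 $l\in\mathbb Z$ otherwise. $\Omega$ lies on a *physical wall* of marginal stability if $(\mathrm{Im}\,\Omega,\alpha)=0$ for some $\alpha=\begin{pmatrix}2bd&-(ad+bc)\\-(ad+bc)&2ac\end{pmatrix}$ with $a,b,c\in\mathbb Z$, $d\in\frac1\lambda\mathbb Z$, $ad-bc=1$, $ac\in N\mathbb Z$, $\frac{ac\,\mathcal E'}{N\lambda}+bd\in\mathbb Z$. Here $(X,Y)=-X_{11}Y_{22}-X_{22}Y_{11}+2X_{12}Y_{12}$. The *standard contour assumption* is that all poles of $1/\Phi_{g,e}$ meeting the cusp at infinity lie on physical walls: for some $C>0$, every pole $\Omega$ of $1/\Phi_{g,e}$ (point near which it is unbounded) such that $\mathrm{Im}\,\Omega-C\cdot1$ is positive semidefinite lies on a physical wall. **Claim.** Under the standard contour assumption, the functions $\hat\phi_{j,k}$ with $j\not\equiv0\bmod N$ have no positive polar Fourier coefficients labelling divisors of $\Phi_{g,e}$: one has $\hat c^g_{j,k}(n,l)\le0$ for all $j,k,l\in\mathbb Z$, $n\in\mathbb Q$ with $j\not\equiv0\bmod N$ and $4n-l^2<0$ for which there are $m,n',l'\in\mathbb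 Z$ with $m\equiv j$, $n'\equiv k\bmod M$, $l'\equiv l\bmod2$ and $4\frac{mn'}{M}-l'^2=4n-l^2$. **Corollary.** If moreover $N>1$ (that is, $g\neq e$), then the twisted genus $\phi_{g,e}=\sum_{n\in\mathbb Q,\,l\in\mathbb Z}c_{g,e}(n,l)q^ny^l$ (absolutely convergent, $c_{g,e}(n,l)\in\mathbb Z$) satisfies $c_{g,e}(n,\pm1)\le0$ for all $n<\frac14$. -/

import Mathlib

open scoped UpperHalfPlane Topology

/-- A Frame shape `∏ a ^ m(a)`, given as the list of pairs `(a, m(a))`. It encodes the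
characteristic polynomial `∏ (x ^ a - 1) ^ m(a)` of an automorphism of a 24-dimensional lattice. -/
abbrev FrameShape : Type := List (ℕ × ℤ)

namespace FrameShape

/-- The order `N` of an element with the given Frame shape. -/
def order (π : FrameShape) : ℕ := (π.map Prod.fst).foldr Nat.lcm 1

/-- The trace of `g ^ k` in the 24-dimensional representation: `∑_{a ∣ k} a m(a)`. -/
def trace (π : FrameShape) (k : ℤ) : ℤ :=
  (π.map fun p => if (p.1 : ℤ) ∣ k then (p.1 : ℤ) * p.2 else 0).sum

/-- The number `(1/24) ∑ m(a) / a`. -/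
def groundLevel (π : FrameShape) : ℚ :=
  (π.map fun p => (p.2 : ℚ) / (p.1 : ℚ)).sum / 24

end FrameShape

/-- The 42 pairs `(π_g, λ)` of a Frame shape and a multiplier order which are realised by
symmetries of K3 sigma models. -/
def k3FrameShapes : List (FrameShape × ℕ) :=
  [([(1, 24)], 1),
   ([(1, 8), (2, 8)], 1),
   ([(1, -8), (2, 16)], 1),
   ([(2, 12)], 2),
   ([(1, 6), (3, 6)], 1),
   ([(1, -3), (3, 9)], 1),
   ([(3, 8)], 3),
   ([(1, 4), (2, 2), (4, 4)], 1),
   ([(1, 8), (2, -8), (4, 8)], 1),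
   ([(1, -4), (2, 6), (4, 4)], 1),
   ([(2, -4), (4, 8)], 1),
   ([(2, 4), (4, 4)], 2),
   ([(4, 6)], 4),
   ([(1, 4), (5, 4)], 1),
   ([(1, -1), (5, 5)], 1),
   ([(1, 2), (2, 2), (3, 2), (6, 2)], 1),
   ([(1, 4), (2, 1), (3, -4), (6, 5)], 1),
   ([(1, 5), (2, -4), (3, 1), (6, 4)], 1),
   ([(1, -2), (2, 4), (3, -2), (6, 4)], 1),
   ([(1, -1), (2, -1), (3, 3), (6, 3)], 1),
   ([(1, -4), (2, 5), (3, 4), (6, 1)], 1),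
   ([(2, 3), (6, 3)], 2),
   ([(6, 4)], 6),
   ([(1, 3), (7, 3)], 1),
   ([(1, 2), (2, 1), (4, 1), (8, 2)], 1),
   ([(1, 4), (2, -2), (4, -2), (8, 4)], 1),
   ([(1, -2), (2, 3), (4, 1), (8, 2)], 1),
   ([(2, 4), (4, -4), (8, 4)], 2),
   ([(4, 2), (8, 2)], 4),
   ([(1, 3), (3, -2), (9, 3)], 1),
   ([(1, 2), (2, 1), (5, -2), (10, 3)], 1),
   ([(1, 3), (2, -2), (5, 1), (10, 2)], 1),
   ([(1, -2), (2, 3), (5, 2), (10, 1)], 1),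
   ([(2, 2), (10, 2)], 2),
   ([(1, 2), (11, 2)], 1),
   ([(1, 2), (2, -2), (3, 2), (4, 2), (6, -2), (12, 2)], 1),
   ([(1, 1), (2, 2), (3, 1), (4, -2), (12, 2)], 1),
   ([(1, 2), (3, -2), (4, 1), (6, 2), (12, 1)], 1),
   ([(1, -2), (2, 2), (3, 2), (4, 1), (12, 1)], 1),
   ([(2, 1), (4, 1), (6, 1), (12, 1)], 2),
   ([(1, 1), (2, 1), (7, 1), (14, 1)], 1),
   ([(1, 1), (3, 1), (5, 1), (15, 1)], 1)]

noncomputable section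

/-- `f(τ, z) = ∑_{n ∈ ℚ, l ∈ ℤ} c(n, l) q ^ n y ^ l`, with absolute convergence, where
`q ^ n = exp(2 π i n τ)` and `y = exp(2 π i z)`. -/
def HasFourierExpansion (f : ℍ → ℂ → ℂ) (c : ℚ → ℤ → ℂ) : Prop :=
  ∀ (τ : ℍ) (z : ℂ),
    HasSum (fun x : ℚ × ℤ =>
      c x.1 x.2 * Complex.exp (2 * Real.pi * Complex.I * ((x.1 : ℂ) * (τ : ℂ) + (x.2 : ℂ) * z)))
      (f τ z)

/-- The discrete Fourier transform
`(1/M) ∑_{k mod M} exp(-2 π i s k / M) φ_{r, k}` in the second index. -/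
def discreteFourier (M : ℕ) (φ : ℤ → ℤ → ℍ → ℂ → ℂ) (r s : ℤ) (τ : ℍ) (z : ℂ) : ℂ :=
  (1 / (M : ℂ)) * ∑ k ∈ Finset.range M,
    Complex.exp (-(2 * Real.pi * Complex.I * (s : ℂ) * (k : ℂ) / (M : ℂ))) * φ r (k : ℤ) τ z

/-- The twisted-twining genera `φ i j = φ_{g ^ i, g ^ j}` of a symmetry `g` with Frame shape `π`
and multiplier order `lam`; the indices are taken modulo `N * lam`, with `N` the order of `g`. -/
structure TwistedTwiningGenera (π : FrameShape) (lam : ℕ) where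
  /-- The integer (modulo `lam`) which specifies the multiplier. -/
  E : ℤ
  φ : ℤ → ℤ → ℍ → ℂ → ℂ
  /-- `chat r s n l` is the coefficient of `q ^ n y ^ l` in the transformed genus with
  indices `r` and `s`. -/
  chat : ℤ → ℤ → ℚ → ℤ → ℤ
  coprime : IsCoprime E (lam : ℤ)
  periodic_left : ∀ i j : ℤ, φ (i + (π.order * lam : ℕ)) j = φ i j
  periodic_right : ∀ i j : ℤ, φ i (j + (π.order * lam : ℕ)) = φ i j
  holomorphic : ∀ i j : ℤ,
    DifferentiableOn ℂ (fun p : ℂ × ℂ => φ i j (UpperHalfPlane.ofComplex p.1) p.2)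
      {p : ℂ × ℂ | 0 < p.1.im}
  /-- Weight 0 and index 1. -/
  modular : ∀ (γ : Matrix.SpecialLinearGroup (Fin 2) ℤ) (i j : ℤ) (τ : ℍ) (z : ℂ),
    φ i j (γ • τ) (z / ((γ 1 0 : ℂ) * (τ : ℂ) + (γ 1 1 : ℂ))) =
      Complex.exp (2 * Real.pi * Complex.I *
        ((γ 1 0 : ℂ) * z ^ 2 / ((γ 1 0 : ℂ) * (τ : ℂ) + (γ 1 1 : ℂ)))) *
      φ (γ 0 0 * i + γ 1 0 * j) (γ 0 1 * i + γ 1 1 * j) τ z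
  elliptic : ∀ (i j a b : ℤ) (τ : ℍ) (z : ℂ),
    φ i j τ (z + (a : ℂ) * (τ : ℂ) + (b : ℂ)) =
      Complex.exp (-(2 * Real.pi * Complex.I *
        ((a : ℂ) ^ 2 * (τ : ℂ) + 2 * (a : ℂ) * z))) * φ i j τ z
  expansion : ∀ r s : ℤ,
    HasFourierExpansion (discreteFourier (π.order * lam) φ r s) (fun n l => (chat r s n l : ℂ))
  /-- Weak Jacobi form, with exponents of `q` in `r s / (N lam) + ℤ`. -/
  support : ∀ (r s : ℤ) (n : ℚ) (l : ℤ), chat r s n l ≠ 0 →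
    0 ≤ n ∧ ∃ w : ℤ, n = (r * s : ℚ) / ((π.order * lam : ℕ) : ℚ) + (w : ℚ)
  /-- `φ_{e, g ^ k} = 2 y + 2 y⁻¹ + Tr(g ^ k) - 4 + O(q)`. -/
  leading : ∀ (k : ℤ) (z : ℂ),
    Filter.Tendsto (fun τ : ℍ => φ 0 k τ z) UpperHalfPlane.atImInfty
      (𝓝 (2 * Complex.exp (2 * Real.pi * Complex.I * z)
        + 2 * Complex.exp (-(2 * Real.pi * Complex.I * z)) + ((π.trace k : ℤ) : ℂ) - 4))
  /-- The transformed genus vanishes unless `s ≡ r E mod lam`. -/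
  vanishing : ∀ r s : ℤ, ¬ (s ≡ r * E [ZMOD (lam : ℤ)]) →
    discreteFourier (π.order * lam) φ r s = 0
  /-- The sector twisted by `g ^ N` is the untwisted one, with the `g`-charge shifted. -/
  shift : ∀ r s : ℤ,
    discreteFourier (π.order * lam) φ (r + π.order) (s - E * π.order) =
      discreteFourier (π.order * lam) φ r s

/-- The imaginary part of `Ω = !![σ, z; z, τ]`, where `Ω` is given as `(σ, τ, z)`. -/
def imMatrix (Ω : ℂ × ℂ × ℂ) : Matrix (Fin 2) (Fin 2) ℝ :=
  !![Ω.1.im, Ω.2.2.im; Ω.2.2.im, Ω.2.1.im]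

/-- The quadratic form of signature `(2, 1)` on symmetric matrices, polarised:
`(X, X) = -2 det X`. -/
def pairing (X Y : Matrix (Fin 2) (Fin 2) ℝ) : ℝ :=
  -(X 0 0 * Y 1 1) - X 1 1 * Y 0 0 + 2 * (X 0 1 * Y 0 1)

/-- The positivity condition on `(m, n, l)` in the product: `m, n ≥ 0`, and `l < 0` if `m = n = 0`. -/
def PositiveIndex (v : ℕ × ℕ × ℤ) : Prop :=
  v.1 = 0 ∧ v.2.1 = 0 → v.2.2 < 0

/-- `f` has a pole at `Ω`: it is not bounded near `Ω`. (Used for meromorphic `f`.) -/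
def HasPoleAt (f : ℂ × ℂ × ℂ → ℂ) (Ω : ℂ × ℂ × ℂ) : Prop :=
  ¬ f =O[𝓝 Ω] (fun _ => (1 : ℂ))

namespace TwistedTwiningGenera

variable {π : FrameShape} {lam : ℕ}

/-- The modulus `M = N lam` of the indices. -/
def modulus (_T : TwistedTwiningGenera π lam) : ℕ := π.order * lam

/-- The multiplicative lift `Φ_{g, e}(σ, τ, z)`: with `p = exp(2 π i σ)`, `q = exp(2 π i τ)`,
`y = exp(2 π i z)` and `A / (24 M) = (1/24) ∑ m(a) / a`,
`p q ^ (A / (24 M)) y ∏ (1 - p ^ m q ^ (n / M) y ^ l) ^ ĉ_{m, n}(m n / M, l)`. -/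
def Phi (T : TwistedTwiningGenera π lam) (Ω : ℂ × ℂ × ℂ) : ℂ :=
  Complex.exp (2 * Real.pi * Complex.I * (Ω.1 + (π.groundLevel : ℂ) * Ω.2.1 + Ω.2.2)) *
    ∏' v : {v : ℕ × ℕ × ℤ // PositiveIndex v},
      (1 - Complex.exp (2 * Real.pi * Complex.I *
        ((v.1.1 : ℂ) * Ω.1 + (v.1.2.1 : ℂ) / (T.modulus : ℂ) * Ω.2.1 + (v.1.2.2 : ℂ) * Ω.2.2))) ^
        T.chat v.1.1 v.1.2.1 ((v.1.1 * v.1.2.1 : ℚ) / (T.modulus : ℚ)) v.1.2.2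

/-- `Ω` lies on a physical wall of marginal stability: its imaginary part is orthogonal to
`α = !![2 b d, -(a d + b c); -(a d + b c), 2 a c]`, where `a, b, c ∈ ℤ`, `d ∈ (1/lam) ℤ`,
`a d - b c = 1`, `a c ∈ N ℤ` and `a c E / (N lam) + b d ∈ ℤ`. -/
def OnPhysicalWall (T : TwistedTwiningGenera π lam) (Ω : ℂ × ℂ × ℂ) : Prop :=
  ∃ (a b c : ℤ) (d : ℚ),
    (∃ d₀ : ℤ, d = (d₀ : ℚ) / (lam : ℚ)) ∧
    (a : ℚ) * d - (b : ℚ) * (c : ℚ) = 1 ∧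
    (π.order : ℤ) ∣ a * c ∧
    (∃ w : ℤ, (a * c * T.E : ℚ) / (T.modulus : ℚ) + (b : ℚ) * d = (w : ℚ)) ∧
    pairing (imMatrix Ω)
      !![2 * (b : ℝ) * (d : ℝ), -((a : ℝ) * (d : ℝ) + (b : ℝ) * (c : ℝ));
        -((a : ℝ) * (d : ℝ) + (b : ℝ) * (c : ℝ)), 2 * (a : ℝ) * (c : ℝ)] = 0

/-- The standard contour assumption: all poles of `1 / Φ_{g, e}` that meet the cusp at infinity
(the region where `Im Ω` has large eigenvalues) lie on physical walls of marginal stability. -/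
def StandardContourAssumption (T : TwistedTwiningGenera π lam) : Prop :=
  ∃ C : ℝ, 0 < C ∧ ∀ Ω : ℂ × ℂ × ℂ,
    (imMatrix Ω - C • (1 : Matrix (Fin 2) (Fin 2) ℝ)).PosSemidef →
    HasPoleAt (fun Ω' => (T.Phi Ω')⁻¹) Ω → T.OnPhysicalWall Ω

/-- The Fourier coefficient of `q ^ n y ^ l` in the transformed genus with indices `j, k` is one of
those which label the divisors of `Φ_{g, e}`. Since this coefficient depends only on `j, k mod M`,
on `4 n - l ^ 2` and on `l mod 2`, this means that it coincides, through these symmetries, with a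
coefficient `ĉ_{m, n'}(m n' / M, l')`. -/
def OccursInLift (T : TwistedTwiningGenera π lam) (j k : ℤ) (n : ℚ) (l : ℤ) : Prop :=
  ∃ m n' l' : ℤ, m ≡ j [ZMOD (T.modulus : ℤ)] ∧ n' ≡ k [ZMOD (T.modulus : ℤ)] ∧
    l' ≡ l [ZMOD 2] ∧
    4 * ((m * n' : ℚ) / (T.modulus : ℚ)) - (l' : ℚ) ^ 2 = 4 * n - (l : ℚ) ^ 2

end TwistedTwiningGenera

end

/-!
Suppose that a vector `v = (m, n, l)` of negative discriminant `4 m n / M - l ^ 2`, with `N ∤ m`, has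
a positive exponent in the product `Φ`. The plane orthogonal to `v` meets the cone of positive
definite forms, and on it there is a point `Im Ω` deep in the cone with an irrational coordinate. At
a suitable `Ω` over it, the only factors of the product which vanish belong to multiples of `v`. If no
proper multiple of `v` contributes, `1 / Φ` is unbounded near `Ω`, and by the contour assumption the
plane is a physical wall (`exists_wall_of_liftExp_pos`). Absolute convergence of the product at `Ω`
is needed for this; it follows from the subexponential growth of the coefficients of weak Jacobi
forms (`exists_abs_chat_le`), which is proved with the modular transformations.

A wall vector has discriminant `-1` and integral entries. For the 42 Frame shapes, elementary
divisibility then shows that the plane is a physical wall only if `N ∣ m`, and that proper multiples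
of `v` never contribute (`liftExp_nonpos`). The symmetries of the coefficients reduce every
coefficient labelling a divisor to an exponent of the product (`exists_liftExp_eq`).

This argument fails in one case: for the shape `1^3 3^-2 9^3` of order nine and discriminant `-1/9`,
the plane of `v` can be a wall. Here the sign is found by modularity. The second Taylor coefficients
in `z` of the genera, corrected by multiples of `E₂`, are permuted by the modular group in weight
two (`weightTwo_slash`). As there are no forms of level one and weight two, their constant terms
satisfy linear relations (`sum_chat_eq_sum_trace`); with the signs already known for discriminant
`-1`, these leave a single unknown `x = ĉ_{3,6}(0, 1) ≤ 0` (`chat_nine_values`). The forms are then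
determined by their values at the cusps: they agree with an Eisenstein series of level nine, by the
valence formula (`weightTwo_eq_levelNineForm_slash`). Comparison of the coefficients of
`q ^ (2 / 9)` shows that those of discriminant `-1/9` equal `3 x` (`chat_nine_eq_three_mul`).

The coefficients of `φ_{g, e}` are sums over `s` of `ĉ_{1, s}`, and for `N > 1` each of these is
covered by the result on divisors.
-/

open scoped Manifold MatrixGroups ModularForm
open UpperHalfPlane (atImInfty)

/-! ### The exponential `exp(2 π i w)` -/

/-- `e(w) = exp(2 π i w)`. -/
noncomputable def expTwoPiI (w : ℂ) : ℂ := Complex.exp (2 * Real.pi * Complex.I * w)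

theorem expTwoPiI_def (w : ℂ) : expTwoPiI w = Complex.exp (2 * Real.pi * Complex.I * w) := rfl

theorem expTwoPiI_add (a b : ℂ) : expTwoPiI (a + b) = expTwoPiI a * expTwoPiI b := by
  simp [expTwoPiI, mul_add, Complex.exp_add]

theorem expTwoPiI_neg (a : ℂ) : expTwoPiI (-a) = (expTwoPiI a)⁻¹ := by
  simp [expTwoPiI, Complex.exp_neg]

@[simp] theorem expTwoPiI_zero : expTwoPiI 0 = 1 := by simp [expTwoPiI]

@[simp] theorem expTwoPiI_int (k : ℤ) : expTwoPiI k = 1 := by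
  rw [expTwoPiI, Complex.exp_eq_one_iff]
  exact ⟨k, by ring⟩

theorem expTwoPiI_ne_zero (a : ℂ) : expTwoPiI a ≠ 0 := Complex.exp_ne_zero _

theorem norm_expTwoPiI (w : ℂ) : ‖expTwoPiI w‖ = Real.exp (-(2 * Real.pi * w.im)) := by
  rw [expTwoPiI, Complex.norm_exp]
  congr 1
  simp [Complex.mul_re, Complex.mul_im]

theorem expTwoPiI_eq_one_iff (w : ℂ) : expTwoPiI w = 1 ↔ ∃ k : ℤ, w = k := by
  rw [expTwoPiI, Complex.exp_eq_one_iff]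
  have h : (2 * Real.pi * Complex.I : ℂ) ≠ 0 := by
    simp [Real.pi_ne_zero]
  refine exists_congr fun k => ⟨fun hk => ?_, fun hk => by rw [hk]; ring⟩
  have : (2 * Real.pi * Complex.I : ℂ) * w = (2 * Real.pi * Complex.I) * k := by rw [hk]; ring
  exact mul_left_cancel₀ h this

theorem expTwoPiI_nsmul (k : ℕ) (w : ℂ) : expTwoPiI (k * w) = expTwoPiI w ^ k := by
  rw [expTwoPiI, expTwoPiI, ← Complex.exp_nat_mul]; congr 1; ring

theorem continuous_expTwoPiI : Continuous expTwoPiI := by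
  unfold expTwoPiI; fun_prop

theorem differentiable_expTwoPiI : Differentiable ℂ expTwoPiI := by
  unfold expTwoPiI; fun_prop

theorem HasSum.congr_terms {ι : Type*} {f g : ι → ℂ} {a : ℂ} (h : HasSum f a)
    (e : ∀ i, g i = f i) : HasSum g a := by
  rwa [show g = f from funext e]

/-! ### Fourier coefficients of absolutely convergent expansions -/

theorem integral_expTwoPiI_int (k : ℤ) :
    ∫ x in (0 : ℝ)..1, expTwoPiI ((k : ℂ) * x) = if k = 0 then 1 else 0 := by
  split_ifs with h
  · simp [h]
  · have hc : (2 * Real.pi * Complex.I * k : ℂ) ≠ 0 := by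
      simp [Real.pi_ne_zero, h]
    have := integral_exp_mul_complex (a := 0) (b := 1) hc
    simp only [expTwoPiI, ← mul_assoc]
    rw [this]
    have h1 := expTwoPiI_int k
    rw [expTwoPiI] at h1
    simp [h1]

/-- The `k`-th Fourier coefficient of an absolutely convergent exponential series. -/
theorem hasSum_fourier_integral {ι : Type*} [Countable ι] (θ : ι → ℤ) (a : ι → ℂ) (f : ℝ → ℂ)
    (hf : ∀ x : ℝ, HasSum (fun i => a i * expTwoPiI ((θ i : ℂ) * x)) (f x)) (k : ℤ) :
    HasSum (fun i => if θ i = k then a i else 0)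
      (∫ x in (0 : ℝ)..1, f x * expTwoPiI (-((k : ℂ) * x))) := by
  have hsum : Summable fun i => ‖a i‖ := by
    have := (hf 0).summable.norm
    simpa using this
  have key := intervalIntegral.hasSum_integral_of_dominated_convergence (μ := MeasureTheory.volume) (a := 0)
    (b := 1) (F := fun i (x : ℝ) => a i * expTwoPiI ((θ i : ℂ) * x) * expTwoPiI (-((k : ℂ) * x)))
    (f := fun x => f x * expTwoPiI (-((k : ℂ) * x))) (fun i _ => ‖a i‖) ?_ ?_ ?_ ?_ ?_
  · have e : ∀ i, ∫ x in (0 : ℝ)..1, a i * expTwoPiI ((θ i : ℂ) * x) *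
        expTwoPiI (-((k : ℂ) * x)) = if θ i = k then a i else 0 := by
      intro i
      have : ∀ x : ℝ, a i * expTwoPiI ((θ i : ℂ) * x) * expTwoPiI (-((k : ℂ) * x)) =
          a i * expTwoPiI (((θ i - k : ℤ) : ℂ) * x) := by
        intro x
        rw [mul_assoc, ← expTwoPiI_add]; congr 2; push_cast; ring
      simp_rw [this]
      rw [intervalIntegral.integral_const_mul, integral_expTwoPiI_int]
      simp [sub_eq_zero]
    simpa only [e] using key
  · intro i
    refine Continuous.aestronglyMeasurable ?_
    have := continuous_expTwoPiI
    fun_prop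
  · intro i
    refine Filter.Eventually.of_forall fun x _ => ?_
    simp [norm_expTwoPiI]
  · exact Filter.Eventually.of_forall fun x _ => hsum
  · exact intervalIntegrable_const
  · exact Filter.Eventually.of_forall fun x _ => (hf x).mul_right _

theorem norm_fourier_integral_le (g : ℝ → ℂ) (B : ℝ) (hB : ∀ x, ‖g x‖ ≤ B) (k : ℤ) :
    ‖∫ x in (0 : ℝ)..1, g x * expTwoPiI (-((k : ℂ) * x))‖ ≤ B := by
  have := intervalIntegral.norm_integral_le_of_norm_le_const (a := 0) (b := 1) (C := B)
    (f := fun x : ℝ => g x * expTwoPiI (-((k : ℂ) * x))) (by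
      intro x _
      simpa [norm_expTwoPiI] using hB x)
  simpa using this

theorem HasFourierExpansion.hasSum {f : ℍ → ℂ → ℂ} {c : ℚ → ℤ → ℂ} (hf : HasFourierExpansion f c)
    (τ : ℍ) (z : ℂ) :
    HasSum (fun x : ℚ × ℤ => c x.1 x.2 * expTwoPiI ((x.1 : ℂ) * τ + (x.2 : ℂ) * z)) (f τ z) :=
  hf τ z

/-- The iterated Fourier integral which extracts the coefficient of `q ^ n y ^ l` on the line
`Im τ = v`, when all exponents of `q` lie in `(1 / M) ℤ` and `n = k / M`. -/
theorem HasFourierExpansion.coeff_eq_integral {f : ℍ → ℂ → ℂ} {c : ℚ → ℤ → ℂ}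
    (hf : HasFourierExpansion f c) {M : ℕ} (hM : 0 < M)
    (hs : ∀ n l, c n l ≠ 0 → ∃ k : ℤ, n * M = k) (v : ℝ) (hv : 0 < v) (n : ℚ) (l : ℤ) (k : ℤ)
    (hk : n * M = k) :
    c n l * expTwoPiI ((n : ℂ) * (v * Complex.I)) =
      ∫ x in (0 : ℝ)..1, (∫ z in (0 : ℝ)..1,
        f ⟨(M * x : ℝ) + v * Complex.I, by simpa using hv⟩ (z : ℂ) * expTwoPiI (-((l : ℂ) * z))) *
          expTwoPiI (-((k : ℂ) * x)) := by
  have h1 : ∀ x : ℝ, HasSum (fun i : ℚ × ℤ => if i.2 = l then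
      c i.1 i.2 * expTwoPiI ((i.1 : ℂ) * ((M * x : ℝ) + v * Complex.I)) else 0)
      (∫ z in (0 : ℝ)..1,
        f ⟨(M * x : ℝ) + v * Complex.I, by simpa using hv⟩ (z : ℂ) *
          expTwoPiI (-((l : ℂ) * z))) := by
    intro x
    refine hasSum_fourier_integral (fun i : ℚ × ℤ => i.2)
      (fun i : ℚ × ℤ => c i.1 i.2 * expTwoPiI ((i.1 : ℂ) * ((M * x : ℝ) + v * Complex.I)))
      (fun z => f ⟨(M * x : ℝ) + v * Complex.I, by simpa using hv⟩ (z : ℂ)) (fun z => ?_) l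
    have := hf.hasSum ⟨(M * x : ℝ) + v * Complex.I, by simpa using hv⟩ (z : ℂ)
    simp_rw [expTwoPiI_add, ← mul_assoc] at this
    exact this
  have h2 := hasSum_fourier_integral (fun i : ℚ × ℤ => ⌊i.1 * M⌋)
    (fun i : ℚ × ℤ => if i.2 = l then c i.1 i.2 * expTwoPiI ((i.1 : ℂ) * (v * Complex.I)) else 0)
    (fun x : ℝ => ∫ z in (0 : ℝ)..1,
        f ⟨(M * x : ℝ) + v * Complex.I, by simpa using hv⟩ (z : ℂ) *
          expTwoPiI (-((l : ℂ) * z))) (fun x => ?_) k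
  · refine HasSum.unique ?_ h2
    have := hasSum_ite_eq ((n, l) : ℚ × ℤ) (c n l * expTwoPiI ((n : ℂ) * (v * Complex.I)))
    convert this using 2 with i
    obtain ⟨n', l'⟩ := i
    by_cases hl : l' = l
    · subst hl
      by_cases hn : n' = n
      · subst hn
        simp [hk]
      · by_cases hc : c n' l' = 0
        · simp [hc, hn]
        · obtain ⟨k', hk'⟩ := hs _ _ hc
          have : ⌊n' * M⌋ ≠ k := by
            rw [hk', Int.floor_intCast]
            rintro rfl
            apply hn
            have hM' : (M : ℚ) ≠ 0 := by positivity
            exact mul_right_cancel₀ hM' (hk'.trans hk.symm)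
          simp [this, hn]
    · simp [hl]
  · convert h1 x using 2 with i
    by_cases hl : i.2 = l
    · simp only [hl, if_true]
      by_cases hc : c i.1 i.2 = 0
      · rw [← hl, hc]; simp
      · obtain ⟨k', hk'⟩ := hs _ _ hc
        rw [mul_assoc, ← expTwoPiI_add]
        congr 2
        rw [hk', Int.floor_intCast]
        have : (i.1 : ℂ) * M = k' := by exact_mod_cast hk'
        push_cast
        rw [← this]; ring
    · simp [hl]

/-- A Fourier coefficient is bounded by the supremum of the function over real translates. -/
theorem HasFourierExpansion.norm_coeff_le {f : ℍ → ℂ → ℂ} {c : ℚ → ℤ → ℂ}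
    (hf : HasFourierExpansion f c) {M : ℕ} (hM : 0 < M)
    (hs : ∀ n l, c n l ≠ 0 → ∃ k : ℤ, n * M = k) (v : ℝ) (hv : 0 < v) (B : ℝ)
    (hB : ∀ (τ : ℍ) (z : ℝ), τ.im = v → ‖f τ z‖ ≤ B) (n : ℚ) (l : ℤ) :
    ‖c n l‖ ≤ B * Real.exp (2 * Real.pi * n * v) := by
  have hB0 : 0 ≤ B := (norm_nonneg _).trans (hB ⟨v * Complex.I, by simpa using hv⟩ 0
    (by simp [UpperHalfPlane.im]))
  by_cases hc : c n l = 0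
  · rw [hc, norm_zero]; positivity
  obtain ⟨k, hk⟩ := hs _ _ hc
  have h := hf.coeff_eq_integral hM hs v hv n l k hk
  have h2 : ‖c n l * expTwoPiI ((n : ℂ) * (v * Complex.I))‖ ≤ B := by
    rw [h]
    refine norm_fourier_integral_le _ B (fun x => ?_) k
    refine norm_fourier_integral_le (fun z : ℝ =>
      f ⟨(M * x : ℝ) + v * Complex.I, by simpa using hv⟩ (z : ℂ)) B (fun z => ?_) l
    exact hB _ z (by simp [UpperHalfPlane.im])
  rw [norm_mul, norm_expTwoPiI] at h2
  have h3 : ((n : ℂ) * (v * Complex.I)).im = n * v := by simp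
  rw [h3, Real.exp_neg, ← div_eq_mul_inv, div_le_iff₀ (Real.exp_pos _)] at h2
  simpa [mul_assoc] using h2

theorem HasFourierExpansion.coeff_unique {f : ℍ → ℂ → ℂ} {c c' : ℚ → ℤ → ℂ}
    (hf : HasFourierExpansion f c) (hf' : HasFourierExpansion f c') {M : ℕ} (hM : 0 < M)
    (hs : ∀ n l, c n l ≠ 0 → ∃ k : ℤ, n * M = k)
    (hs' : ∀ n l, c' n l ≠ 0 → ∃ k : ℤ, n * M = k) (n : ℚ) (l : ℤ) : c n l = c' n l := by
  by_cases hk : ∃ k : ℤ, n * M = k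
  · obtain ⟨k, hk⟩ := hk
    have h := hf.coeff_eq_integral hM hs 1 one_pos n l k hk
    have h' := hf'.coeff_eq_integral hM hs' 1 one_pos n l k hk
    exact mul_right_cancel₀ (expTwoPiI_ne_zero _) (h.trans h'.symm)
  · have h1 : c n l = 0 := by
      by_contra h; exact hk (hs _ _ h)
    have h2 : c' n l = 0 := by
      by_contra h; exact hk (hs' _ _ h)
    rw [h1, h2]

namespace TwistedTwiningGenera

variable {π : FrameShape} {lam : ℕ}

/-! ### Symmetries of the Fourier coefficients -/

/-- The discrete Fourier transform of the genera in the second index. -/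
noncomputable def hat (T : TwistedTwiningGenera π lam) : ℤ → ℤ → ℍ → ℂ → ℂ :=
  discreteFourier T.modulus T.φ

theorem hat_eq (T : TwistedTwiningGenera π lam) (r s : ℤ) (τ : ℍ) (z : ℂ) :
    T.hat r s τ z = (1 / (T.modulus : ℂ)) * ∑ k ∈ Finset.range T.modulus,
      expTwoPiI (-((s : ℂ) * (k : ℂ) / T.modulus)) * T.φ r (k : ℤ) τ z := by
  simp only [hat, discreteFourier, expTwoPiI]
  congr 1
  refine Finset.sum_congr rfl fun k _ => ?_
  congr 2
  ring

theorem hat_expansion (T : TwistedTwiningGenera π lam) (r s : ℤ) :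
    HasFourierExpansion (T.hat r s) (fun n l => (T.chat r s n l : ℂ)) :=
  T.expansion r s

theorem hat_hasSum (T : TwistedTwiningGenera π lam) (r s : ℤ) (τ : ℍ) (z : ℂ) :
    HasSum (fun x : ℚ × ℤ => (T.chat r s x.1 x.2 : ℂ) *
      expTwoPiI ((x.1 : ℂ) * τ + (x.2 : ℂ) * z)) (T.hat r s τ z) :=
  (T.hat_expansion r s).hasSum τ z

theorem chat_support (T : TwistedTwiningGenera π lam) {r s : ℤ} {n : ℚ} {l : ℤ}
    (h : T.chat r s n l ≠ 0) :
    0 ≤ n ∧ ∃ w : ℤ, n = (r * s : ℚ) / (T.modulus : ℚ) + (w : ℚ) :=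
  T.support r s n l h

theorem exists_int_of_chat_ne_zero (T : TwistedTwiningGenera π lam) (hM : 0 < T.modulus) (r s : ℤ)
    (n : ℚ) (l : ℤ) (h : (T.chat r s n l : ℂ) ≠ 0) : ∃ k : ℤ, n * T.modulus = k := by
  obtain ⟨-, w, hw⟩ := T.chat_support (by exact_mod_cast h)
  have hM' : (T.modulus : ℚ) ≠ 0 := by positivity
  refine ⟨r * s + w * T.modulus, ?_⟩
  rw [hw]
  push_cast
  field_simp

theorem chat_eq_of_hat_eq (T : TwistedTwiningGenera π lam) (hM : 0 < T.modulus) {r s r' s' : ℤ}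
    (h : T.hat r s = T.hat r' s') (n : ℚ) (l : ℤ) : T.chat r s n l = T.chat r' s' n l := by
  have h1 := T.hat_expansion r s
  rw [h] at h1
  have := h1.coeff_unique (T.hat_expansion r' s') hM
    (T.exists_int_of_chat_ne_zero hM r s) (T.exists_int_of_chat_ne_zero hM r' s') n l
  exact_mod_cast this

theorem φ_periodic_left (T : TwistedTwiningGenera π lam) (i j k : ℤ) :
    T.φ (i + k * T.modulus) j = T.φ i j := by
  have h := T.periodic_left
  induction k using Int.induction_on with
  | zero => simp
  | succ m ih => rw [← ih, ← h (i + m * _)]; congr 1; simp only [modulus]; push_cast; ring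
  | pred m ih =>
    rw [← ih, ← h (i + (-(m : ℤ) - 1) * _)]; congr 1; simp only [modulus]; push_cast; ring

theorem φ_periodic_right (T : TwistedTwiningGenera π lam) (i j k : ℤ) :
    T.φ i (j + k * T.modulus) = T.φ i j := by
  have h := T.periodic_right
  induction k using Int.induction_on with
  | zero => simp
  | succ m ih => rw [← ih, ← h i (j + m * _)]; congr 1; simp only [modulus]; push_cast; ring
  | pred m ih =>
    rw [← ih, ← h i (j + (-(m : ℤ) - 1) * _)]; congr 1; simp only [modulus]; push_cast; ring

theorem φ_congr (T : TwistedTwiningGenera π lam) {i j i' j' : ℤ}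
    (hi : i ≡ i' [ZMOD T.modulus]) (hj : j ≡ j' [ZMOD T.modulus]) : T.φ i j = T.φ i' j' := by
  obtain ⟨a, ha⟩ := hi.dvd
  obtain ⟨b, hb⟩ := hj.dvd
  have hi' : i' = i + a * T.modulus := by linarith
  have hj' : j' = j + b * T.modulus := by linarith
  rw [hi', hj', T.φ_periodic_left, T.φ_periodic_right]

theorem chat_congr (T : TwistedTwiningGenera π lam) (hM : 0 < T.modulus) {r s r' s' : ℤ}
    (hr : r ≡ r' [ZMOD T.modulus]) (hs : s ≡ s' [ZMOD T.modulus]) (n : ℚ) (l : ℤ) :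
    T.chat r s n l = T.chat r' s' n l := by
  refine T.chat_eq_of_hat_eq hM ?_ n l
  ext τ z
  rw [hat_eq, hat_eq]
  congr 1
  refine Finset.sum_congr rfl fun k _ => ?_
  rw [T.φ_congr hr (Int.ModEq.refl _)]
  congr 1
  obtain ⟨b, hb⟩ := hs.dvd
  have hs' : (s' : ℂ) = s + b * T.modulus := by
    have : s' = s + b * T.modulus := by linarith
    exact_mod_cast this
  have hM' : (T.modulus : ℂ) ≠ 0 := by exact_mod_cast hM.ne'
  have : -((s : ℂ) * k / T.modulus) = -((s' : ℂ) * k / T.modulus) + ((b * k : ℤ) : ℂ) := by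
    rw [hs']; push_cast; field_simp; ring
  rw [this, expTwoPiI_add, expTwoPiI_int, mul_one]

theorem hat_elliptic (T : TwistedTwiningGenera π lam) (r s a b : ℤ) (τ : ℍ) (z : ℂ) :
    T.hat r s τ (z + a * τ + b) =
      expTwoPiI (-((a : ℂ) ^ 2 * τ + 2 * a * z)) * T.hat r s τ z := by
  rw [hat_eq, hat_eq, Finset.mul_sum, Finset.mul_sum, Finset.mul_sum]
  refine Finset.sum_congr rfl fun k _ => ?_
  rw [T.elliptic]
  have : Complex.exp (-(2 * Real.pi * Complex.I * ((a : ℂ) ^ 2 * (τ : ℂ) + 2 * (a : ℂ) * z))) =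
      expTwoPiI (-((a : ℂ) ^ 2 * τ + 2 * a * z)) := by
    rw [expTwoPiI]; congr 1; ring
  rw [this]; ring

/-- Spectral flow: the elliptic transformation by `a τ` in terms of coefficients. -/
theorem chat_elliptic (T : TwistedTwiningGenera π lam) (hM : 0 < T.modulus) (r s : ℤ) (a : ℤ)
    (n : ℚ) (l : ℤ) : T.chat r s n l = T.chat r s (n + l * a + a ^ 2) (l + 2 * a) := by
  have h1 : HasFourierExpansion (T.hat r s)
      (fun n l => (T.chat r s (n + l * a + a ^ 2) (l + 2 * a) : ℂ)) := by
    intro τ z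
    have h := T.hat_hasSum r s τ (z + (-a : ℤ) * τ + (0 : ℤ))
    rw [T.hat_elliptic] at h
    have h2 := h.mul_left (expTwoPiI (((-a : ℤ) : ℂ) ^ 2 * τ + 2 * (-a : ℤ) * z))
    rw [← mul_assoc, ← expTwoPiI_add, add_neg_cancel, expTwoPiI_zero, one_mul] at h2
    let e : ℚ × ℤ ≃ ℚ × ℤ :=
      { toFun := fun x => (x.1 + x.2 * a + a ^ 2, x.2 + 2 * a)
        invFun := fun x => (x.1 - x.2 * a + a ^ 2, x.2 - 2 * a)
        left_inv := fun x => by ext <;> simp; ring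
        right_inv := fun x => by ext <;> simp; ring }
    have h3 := (e.hasSum_iff).mpr h2
    refine h3.congr_terms fun x => ?_
    simp only [Function.comp_apply, e, Equiv.coe_fn_mk]
    rw [← expTwoPiI_def, mul_left_comm (expTwoPiI _), ← expTwoPiI_add]
    congr 2
    push_cast
    ring
  have := (T.hat_expansion r s).coeff_unique h1 hM (T.exists_int_of_chat_ne_zero hM r s) ?_ n l
  · exact_mod_cast this
  · intro n l hc
    obtain ⟨k, hk⟩ := T.exists_int_of_chat_ne_zero hM r s _ _ hc
    refine ⟨k - (l * a + a ^ 2) * T.modulus, ?_⟩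
    push_cast
    rw [← hk]; ring

theorem φ_neg (T : TwistedTwiningGenera π lam) (i j : ℤ) (τ : ℍ) (z : ℂ) :
    T.φ (-i) (-j) τ z = T.φ i j τ (-z) := by
  have h := T.modular (-1) i j τ z
  simp [div_neg] at h
  rw [h]

theorem sum_range_neg_of_periodic {M : ℕ} (hM : 0 < M) (f : ℤ → ℂ)
    (hf : ∀ k, f (k + M) = f k) :
    ∑ k ∈ Finset.range M, f (-(k : ℤ)) = ∑ k ∈ Finset.range M, f k := by
  obtain ⟨m, rfl⟩ : ∃ m, M = m + 1 := ⟨M - 1, by omega⟩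
  rw [← Finset.sum_range_reflect, Finset.sum_range_succ, Finset.sum_range_succ' (fun k : ℕ => f k)]
  simp only [Nat.add_sub_cancel]
  congr 1
  · refine Finset.sum_congr rfl fun k hk => ?_
    rw [← hf]
    congr 1
    have : k < m := Finset.mem_range.mp hk
    push_cast [Nat.cast_sub this.le]
    ring
  · simp

theorem hat_neg (T : TwistedTwiningGenera π lam) (hM : 0 < T.modulus) (r s : ℤ) (τ : ℍ) (z : ℂ) :
    T.hat (-r) (-s) τ z = T.hat r s τ (-z) := by
  rw [hat_eq, hat_eq]
  congr 1
  have hM' : (T.modulus : ℂ) ≠ 0 := by exact_mod_cast hM.ne'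
  refine Eq.trans ?_ (sum_range_neg_of_periodic hM (fun k : ℤ =>
    expTwoPiI (-((s : ℂ) * (k : ℂ) / T.modulus)) * T.φ r k τ (-z)) ?_)
  · refine Finset.sum_congr rfl fun k _ => ?_
    rw [← T.φ_neg, neg_neg]
    congr 2
    push_cast
    ring
  · intro k
    have h1 : -((s : ℂ) * ((k + T.modulus : ℤ) : ℂ) / T.modulus) =
        -((s : ℂ) * k / T.modulus) + ((-s : ℤ) : ℂ) := by
      push_cast; field_simp; ring
    have h2 := T.φ_periodic_right r k 1
    rw [one_mul] at h2
    rw [h1, expTwoPiI_add, expTwoPiI_int, mul_one, h2]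

theorem chat_neg (T : TwistedTwiningGenera π lam) (hM : 0 < T.modulus) (r s : ℤ) (n : ℚ) (l : ℤ) :
    T.chat (-r) (-s) n l = T.chat r s n (-l) := by
  have h1 : HasFourierExpansion (T.hat (-r) (-s)) (fun n l => (T.chat r s n (-l) : ℂ)) := by
    intro τ z
    have h := T.hat_hasSum r s τ (-z)
    rw [← T.hat_neg hM] at h
    let e : ℚ × ℤ ≃ ℚ × ℤ := (Equiv.refl ℚ).prodCongr (Equiv.neg ℤ)
    have h3 := (e.hasSum_iff).mpr h
    refine h3.congr_terms fun x => ?_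
    simp only [Function.comp_apply, e, Equiv.prodCongr_apply, Prod.map, Equiv.refl_apply,
      Equiv.neg_apply, expTwoPiI]
    congr 3
    push_cast
    ring
  have := (T.hat_expansion (-r) (-s)).coeff_unique h1 hM (T.exists_int_of_chat_ne_zero hM _ _)
    (fun n l hc => T.exists_int_of_chat_ne_zero hM _ _ _ _ hc) n l
  exact_mod_cast this

/-- A coefficient depends on `(n, l)` only through the discriminant `4 n - l ^ 2` and the parity
of `l`. -/
theorem chat_eq_of_discr_eq (T : TwistedTwiningGenera π lam) (hM : 0 < T.modulus) (r s : ℤ)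
    {n n' : ℚ} {l l' : ℤ} (hl : l ≡ l' [ZMOD 2]) (hD : 4 * n - (l : ℚ) ^ 2 = 4 * n' - (l' : ℚ) ^ 2) :
    T.chat r s n l = T.chat r s n' l' := by
  obtain ⟨a, ha⟩ := hl.dvd
  have hl' : l' = l + 2 * a := by linarith
  rw [T.chat_elliptic hM r s a n l, hl']
  congr 1
  rw [hl'] at hD
  push_cast at hD
  linarith

/-- The discriminant of a non-zero coefficient is at least `-1`: spectral flow makes `l` equal to `0`
or `1`, where `n ≥ 0`. -/
theorem neg_one_le_discr (T : TwistedTwiningGenera π lam) (hM : 0 < T.modulus) {r s : ℤ}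
    {n : ℚ} {l : ℤ} (h : T.chat r s n l ≠ 0) : -1 ≤ 4 * n - (l : ℚ) ^ 2 := by
  rcases Int.even_or_odd' l with ⟨a, rfl | rfl⟩
  · rw [T.chat_eq_of_discr_eq hM r s (n' := n - a ^ 2) (l' := 0) (by simp [Int.modEq_iff_dvd])
      (by push_cast; ring)] at h
    have := (T.chat_support h).1
    push_cast
    linarith
  · rw [T.chat_eq_of_discr_eq hM r s (n' := n - a ^ 2 - a) (l' := 1)
      (by simp [Int.modEq_iff_dvd]) (by push_cast; ring)] at h
    have := (T.chat_support h).1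
    push_cast
    linarith

/-- For even `l` spectral flow leads to `l = 0`, where the discriminant is `4 n ≥ 0`. -/
theorem odd_of_discr_neg (T : TwistedTwiningGenera π lam) (hM : 0 < T.modulus) {r s : ℤ}
    {n : ℚ} {l : ℤ} (h : T.chat r s n l ≠ 0) (hD : 4 * n - (l : ℚ) ^ 2 < 0) : Odd l := by
  by_contra hl
  obtain ⟨a, rfl⟩ := (Int.not_odd_iff_even.mp hl).two_dvd
  rw [T.chat_eq_of_discr_eq hM r s (n' := n - a ^ 2) (l' := 0) (by simp [Int.modEq_iff_dvd])
      (by push_cast; ring)] at h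
  have := (T.chat_support h).1
  push_cast at hD
  linarith

/-- The genera are recovered from their discrete Fourier transforms. -/
theorem φ_eq_sum_hat (T : TwistedTwiningGenera π lam) (hM : 0 < T.modulus) (i j : ℤ) (τ : ℍ)
    (z : ℂ) : T.φ i j τ z = ∑ s ∈ Finset.range T.modulus,
      expTwoPiI ((s : ℂ) * j / T.modulus) * T.hat i s τ z := by
  have hM' : (T.modulus : ℂ) ≠ 0 := by exact_mod_cast hM.ne'
  have hj : T.φ i j = T.φ i ((j % T.modulus).toNat : ℤ) := by
    apply T.φ_congr (Int.ModEq.refl _)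
    rw [Int.toNat_of_nonneg (Int.emod_nonneg _ (by omega))]
    exact (Int.mod_modEq _ _).symm
  set j₀ := (j % T.modulus).toNat with hj₀
  have hj₀M : j₀ < T.modulus := by
    rw [hj₀]
    have := Int.emod_lt_of_pos j (b := T.modulus) (by omega)
    omega
  simp_rw [hat_eq, Finset.mul_sum]
  rw [Finset.sum_comm, Finset.sum_eq_single j₀]
  · have : ∀ s ∈ Finset.range T.modulus, expTwoPiI ((s : ℂ) * j / T.modulus) *
        (1 / (T.modulus : ℂ) * (expTwoPiI (-((((s : ℕ) : ℤ) : ℂ) * (j₀ : ℂ) / T.modulus)) *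
          T.φ i (j₀ : ℤ) τ z)) = 1 / (T.modulus : ℂ) * T.φ i j τ z := by
      intro s _
      have e : expTwoPiI ((s : ℂ) * j / T.modulus) *
          expTwoPiI (-((((s : ℕ) : ℤ) : ℂ) * (j₀ : ℂ) / T.modulus)) = 1 := by
        rw [← expTwoPiI_add, expTwoPiI_eq_one_iff]
        refine ⟨s * (j / T.modulus), ?_⟩
        have h1 : (j : ℂ) = j₀ + T.modulus * (j / T.modulus : ℤ) := by
          have : j = j₀ + T.modulus * (j / T.modulus) := by
            rw [hj₀, Int.toNat_of_nonneg (Int.emod_nonneg _ (by omega)), Int.emod_add_mul_ediv]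
          exact_mod_cast this
        rw [h1]; push_cast; field_simp; ring
      rw [hj]
      linear_combination (1 / (T.modulus : ℂ) * T.φ i (j₀ : ℤ) τ z) * e
    rw [Finset.sum_congr rfl this]
    simp [hM']
  · intro k hk hne
    have hkM : k < T.modulus := Finset.mem_range.mp hk
    have e : ∀ s ∈ Finset.range T.modulus, expTwoPiI ((s : ℂ) * j / T.modulus) *
        (1 / (T.modulus : ℂ) * (expTwoPiI (-((((s : ℕ) : ℤ) : ℂ) * (k : ℂ) / T.modulus)) *
          T.φ i (k : ℤ) τ z)) = 1 / (T.modulus : ℂ) * T.φ i (k : ℤ) τ z *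
          expTwoPiI (((j - k : ℤ) : ℂ) / T.modulus) ^ s := by
      intro s _
      have : expTwoPiI (((j - k : ℤ) : ℂ) / T.modulus) ^ s = expTwoPiI ((s : ℂ) * j / T.modulus) *
          expTwoPiI (-((((s : ℕ) : ℤ) : ℂ) * (k : ℂ) / T.modulus)) := by
        rw [← expTwoPiI_nsmul, ← expTwoPiI_add]; congr 1; push_cast; ring
      rw [this]; ring
    rw [Finset.sum_congr rfl e, ← Finset.mul_sum]
    have hne1 : expTwoPiI (((j - k : ℤ) : ℂ) / T.modulus) ≠ 1 := by
      rw [Ne, expTwoPiI_eq_one_iff]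
      rintro ⟨w, hw⟩
      rw [div_eq_iff hM'] at hw
      have hw' : j - k = w * T.modulus := by exact_mod_cast hw
      apply hne
      have : j % T.modulus = k := by
        have h1 : j = k + w * T.modulus := by linarith
        rw [h1, Int.add_mul_emod_self_right]
        exact Int.emod_eq_of_lt (by omega) (by omega)
      omega
    rw [geom_sum_eq hne1, ← expTwoPiI_nsmul]
    have : (T.modulus : ℂ) * (((j - k : ℤ) : ℂ) / T.modulus) = ((j - k : ℤ) : ℂ) := by
      field_simp
    rw [this, expTwoPiI_int]
    simp
  · intro h
    exact absurd (Finset.mem_range.mpr hj₀M) h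

/-! ### Growth of the Fourier coefficients -/

theorem hat_summable_norm (T : TwistedTwiningGenera π lam) (r s : ℤ) {v : ℝ} (hv : 0 < v) (y : ℝ) :
    Summable fun x : ℚ × ℤ => ‖(T.chat r s x.1 x.2 : ℂ)‖ *
      Real.exp (-(2 * Real.pi * (x.1 * v + x.2 * y))) := by
  have h := (T.hat_hasSum r s ⟨v * Complex.I, by simpa using hv⟩ (y * Complex.I)).summable.norm
  refine h.congr fun x => ?_
  rw [norm_mul, norm_expTwoPiI]
  simp

/-- A bound for the transformed genera for `|Im w| ≤ Im τ`. It rests on `n + l a + a ^ 2 ≥ -1 / 4`,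
which is the bound `-1` for the discriminant, and on convergence at `τ = i / 2`, `z = ± i / 2`. -/
theorem exists_norm_hat_le_of_cell (T : TwistedTwiningGenera π lam) (hM : 0 < T.modulus)
    (r s : ℤ) : ∃ K : ℝ, 0 ≤ K ∧ ∀ (τ : ℍ) (w : ℂ) (a : ℝ), 1 / 2 ≤ τ.im → |a| ≤ 1 →
      w.im = a * τ.im →
      ‖T.hat r s τ w‖ * Real.exp (-(2 * Real.pi * (a ^ 2 * τ.im))) ≤
        K * Real.exp (Real.pi / 2 * τ.im) := by
  have hS := (T.hat_summable_norm r s (v := 1 / 2) (by norm_num) (1 / 2)).add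
    (T.hat_summable_norm r s (v := 1 / 2) (by norm_num) (-(1 / 2)))
  refine ⟨∑' x : ℚ × ℤ, (‖(T.chat r s x.1 x.2 : ℂ)‖ *
      Real.exp (-(2 * Real.pi * (x.1 * (1 / 2) + x.2 * (1 / 2)))) +
    ‖(T.chat r s x.1 x.2 : ℂ)‖ *
      Real.exp (-(2 * Real.pi * (x.1 * (1 / 2) + x.2 * -(1 / 2))))),
    tsum_nonneg fun x => by positivity, fun τ w a hτ ha hw => ?_⟩
  · rw [← (T.hat_hasSum r s τ w).tsum_eq, ← tsum_mul_right]
    refine (mul_le_mul_of_nonneg_right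
      (norm_tsum_le_tsum_norm (T.hat_hasSum r s τ w).summable.norm) (Real.exp_pos _).le).trans ?_
    rw [← tsum_mul_right]
    refine Summable.tsum_le_tsum (fun x => ?_)
      ((T.hat_hasSum r s τ w).summable.norm.mul_right _) (hS.mul_right _)
    rw [norm_mul, norm_expTwoPiI, ← mul_add, mul_assoc ‖_‖ (Real.exp _), mul_assoc ‖_‖ (_ + _)]
    by_cases hc : T.chat r s x.1 x.2 = 0
    · simp [hc]
    refine mul_le_mul_of_nonneg_left ?_ (norm_nonneg (T.chat r s x.1 x.2 : ℂ))
    have hE := T.neg_one_le_discr hM hc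
    have hE' : (-1 : ℝ) ≤ 4 * (x.1 : ℝ) - (x.2 : ℝ) ^ 2 := by exact_mod_cast hE
    have him : ((x.1 : ℂ) * τ + (x.2 : ℂ) * w).im = x.1 * τ.im + x.2 * (a * τ.im) := by
      rw [← hw]; simp
    rw [him, ← Real.exp_add]
    generalize (x.1 : ℝ) = n at *
    generalize (x.2 : ℝ) = l at *
    set v := τ.im
    have hEa : -(1 / 4) ≤ n + l * a + a ^ 2 := by nlinarith [sq_nonneg (a + l / 2)]
    have h1 : -(2 * Real.pi * (n * v + l * (a * v))) + -(2 * Real.pi * (a ^ 2 * v)) ≤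
        (-(Real.pi * n) + Real.pi * |l|) + Real.pi / 2 * v := by
      have h2 : 0 ≤ (v - 1 / 2) * (n + l * a + a ^ 2 + 1 / 4) :=
        mul_nonneg (by linarith) (by linarith)
      have h3 : -(l * a) ≤ |l| := by
        calc -(l * a) ≤ |l * a| := neg_le_abs _
          _ = |l| * |a| := abs_mul _ _
          _ ≤ |l| * 1 := mul_le_mul_of_nonneg_left ha (abs_nonneg _)
          _ = |l| := mul_one _
      have h4 : -(n * v + l * (a * v)) * 2 - 2 * (a ^ 2 * v) ≤ -n + |l| + v / 2 := by
        nlinarith [sq_nonneg a]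
      nlinarith [Real.pi_pos]
    calc _ ≤ Real.exp ((-(Real.pi * n) + Real.pi * |l|) + Real.pi / 2 * v) := Real.exp_le_exp.mpr h1
      _ = Real.exp (-(Real.pi * n) + Real.pi * |l|) * Real.exp (Real.pi / 2 * v) := Real.exp_add _ _
      _ ≤ _ := by
        refine mul_le_mul_of_nonneg_right ?_ (Real.exp_pos _).le
        rcases abs_cases l with ⟨hl, -⟩ | ⟨hl, -⟩ <;> rw [hl]
        · refine le_add_of_nonneg_of_le (Real.exp_pos _).le (Real.exp_le_exp.mpr (le_of_eq ?_))
          ring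
        · refine le_add_of_le_of_nonneg (Real.exp_le_exp.mpr (le_of_eq ?_)) (Real.exp_pos _).le
          ring

/-- The bound of `exists_norm_hat_le_of_cell` extends to all elliptic variables, as
`‖φ(τ, w)‖ exp(-2 π (Im w) ^ 2 / Im τ)` is invariant under the elliptic transformations. -/
theorem exists_norm_hat_le (T : TwistedTwiningGenera π lam) (hM : 0 < T.modulus)
    (r s : ℤ) : ∃ K : ℝ, 0 ≤ K ∧ ∀ (τ : ℍ) (w : ℂ), 1 / 2 ≤ τ.im →
      ‖T.hat r s τ w‖ * Real.exp (-(2 * Real.pi * (w.im ^ 2 / τ.im))) ≤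
        K * Real.exp (Real.pi / 2 * τ.im) := by
  obtain ⟨K, hK, h⟩ := T.exists_norm_hat_le_of_cell hM r s
  refine ⟨K, hK, fun τ w hτ => ?_⟩
  have hv := τ.im_pos
  set b : ℤ := ⌊w.im / τ.im⌋ with hb
  have h1 := h τ (w - b * τ) (w.im / τ.im - b) hτ (by
    rw [abs_le]
    have := Int.floor_le (w.im / τ.im)
    have := Int.lt_floor_add_one (w.im / τ.im)
    constructor <;> linarith) (by
    have : (w - b * (τ : ℂ)).im = w.im - b * τ.im := by simp
    rw [this]; field_simp)
  have h2 := T.hat_elliptic r s b 0 τ (w - b * τ)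
  simp only [Int.cast_zero, add_zero, sub_add_cancel] at h2
  rw [h2, norm_mul, norm_expTwoPiI]
  refine le_trans (le_of_eq ?_) h1
  rw [mul_comm (Real.exp _), mul_assoc, ← Real.exp_add]
  congr 2
  have : (-((b : ℂ) ^ 2 * τ + 2 * b * (w - b * τ))).im =
      -(b ^ 2 * τ.im + 2 * b * (w.im - b * τ.im)) := by
    have e : -((b : ℂ) ^ 2 * τ + 2 * b * (w - b * τ)) =
        (((b ^ 2 : ℤ) : ℂ) * τ - ((2 * b : ℤ) : ℂ) * w) := by
      push_cast; ring
    rw [e]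
    simp only [Complex.sub_im, Complex.mul_im, Complex.intCast_re, Complex.intCast_im]
    push_cast
    simp
    ring
  rw [this]
  field_simp
  ring

theorem exists_norm_φ_le (T : TwistedTwiningGenera π lam) (hM : 0 < T.modulus) :
    ∃ K : ℝ, 0 ≤ K ∧ ∀ (i j : ℤ) (τ : ℍ) (w : ℂ), 1 / 2 ≤ τ.im →
      ‖T.φ i j τ w‖ * Real.exp (-(2 * Real.pi * (w.im ^ 2 / τ.im))) ≤
        K * Real.exp (Real.pi / 2 * τ.im) := by
  choose K hK h using T.exists_norm_hat_le hM
  refine ⟨∑ i ∈ Finset.range T.modulus, ∑ s ∈ Finset.range T.modulus, K i s,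
    Finset.sum_nonneg fun _ _ => Finset.sum_nonneg fun _ _ => hK _ _, fun i j τ w hτ => ?_⟩
  have hi : T.φ i j = T.φ ((i % T.modulus).toNat : ℤ) j := by
    refine T.φ_congr ?_ (Int.ModEq.refl _)
    rw [Int.toNat_of_nonneg (Int.emod_nonneg _ (by omega))]
    exact (Int.mod_modEq _ _).symm
  have hmem : (i % T.modulus).toNat ∈ Finset.range T.modulus := by
    have := Int.emod_lt_of_pos i (b := T.modulus) (by omega)
    have := Int.emod_nonneg i (b := T.modulus) (by omega)
    rw [Finset.mem_range]; omega
  set i₀ := (i % T.modulus).toNat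
  rw [hi, T.φ_eq_sum_hat hM]
  calc _ ≤ (∑ s ∈ Finset.range T.modulus, ‖T.hat i₀ s τ w‖) *
        Real.exp (-(2 * Real.pi * (w.im ^ 2 / τ.im))) := by
        refine mul_le_mul_of_nonneg_right ?_ (Real.exp_pos _).le
        refine (norm_sum_le _ _).trans (Finset.sum_le_sum fun s _ => ?_)
        rw [norm_mul, norm_expTwoPiI]
        have : ((s : ℂ) * j / T.modulus).im = 0 := by
          have : ((s : ℂ) * j / T.modulus) = ((s * j / T.modulus : ℝ) : ℂ) := by push_cast; rfl
          rw [this, Complex.ofReal_im]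
        simp [this]
    _ ≤ (∑ s ∈ Finset.range T.modulus, K i₀ s) * Real.exp (Real.pi / 2 * τ.im) := by
        rw [Finset.sum_mul, Finset.sum_mul]
        exact Finset.sum_le_sum fun s _ => h _ _ τ w hτ
    _ ≤ _ := by
        refine mul_le_mul_of_nonneg_right ?_ (Real.exp_pos _).le
        exact Finset.single_le_sum (f := fun i : ℕ => ∑ s ∈ Finset.range T.modulus, K i s)
          (fun _ _ => Finset.sum_nonneg fun _ _ => hK _ _) hmem

theorem im_ofReal_div (a : ℝ) (w : ℂ) :
    ((a : ℂ) / w).im = -(a * w.im / Complex.normSq w) := by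
  rw [Complex.div_im, Complex.ofReal_im, Complex.ofReal_re]
  ring

theorem denom_eq (γ : Matrix.SpecialLinearGroup (Fin 2) ℤ) (τ : ℍ) :
    UpperHalfPlane.denom (Matrix.SpecialLinearGroup.toGL
      ((Matrix.SpecialLinearGroup.map (Int.castRingHom ℝ)) γ)) τ =
      (γ 1 0 : ℂ) * τ + γ 1 1 := by
  simp [UpperHalfPlane.denom]

/-- The modular transformation with the indices on the right-hand side prescribed. -/
theorem φ_eq_modular (T : TwistedTwiningGenera π lam)
    (γ : Matrix.SpecialLinearGroup (Fin 2) ℤ) (i j : ℤ) (τ : ℍ) (z : ℂ) :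
    T.φ (γ 1 1 * i - γ 1 0 * j) (-γ 0 1 * i + γ 0 0 * j) (γ • τ)
      (z / ((γ 1 0 : ℂ) * τ + γ 1 1)) =
      expTwoPiI ((γ 1 0 : ℂ) * z ^ 2 / ((γ 1 0 : ℂ) * τ + γ 1 1)) * T.φ i j τ z := by
  rw [T.modular, expTwoPiI]
  have hdet := γ.det_coe
  rw [Matrix.det_fin_two] at hdet
  congr 2
  · linear_combination i * hdet
  · linear_combination j * hdet

/-- A bound for real elliptic variable, with the growth as `Im τ → 0` made explicit: a modular
transformation moves `τ` into the region `Im τ ≥ 1 / 2`. -/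
theorem exists_norm_φ_real_le (T : TwistedTwiningGenera π lam) (hM : 0 < T.modulus) :
    ∃ K : ℝ, 0 ≤ K ∧ ∀ (i j : ℤ) (τ : ℍ) (z : ℝ),
      ‖T.φ i j τ z‖ ≤ K * Real.exp (Real.pi / 2 * (τ.im + 1 / τ.im)) := by
  obtain ⟨K, hK, h⟩ := T.exists_norm_φ_le hM
  refine ⟨K, hK, fun i j τ z => ?_⟩
  obtain ⟨γ, hγ, -⟩ := ModularGroup.exists_one_half_le_im_smul_and_norm_denom_le τ
  have hv := τ.im_pos
  have hm := T.φ_eq_modular γ i j τ z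
  set c : ℤ := γ 1 0 with hc
  set d : ℤ := γ 1 1 with hd
  have him := ModularGroup.im_smul_eq_div_normSq γ τ
  rw [denom_eq] at him
  set D : ℝ := Complex.normSq ((c : ℂ) * τ + d) with hD
  have hDval : D = (c * τ.re + d) ^ 2 + (c * τ.im) ^ 2 := by
    rw [hD, Complex.normSq_apply]
    simp
    ring
  have hDpos : 0 < D := by
    rw [hDval]
    by_cases hc0 : c = 0
    · have hdet := γ.det_coe
      rw [Matrix.det_fin_two] at hdet
      have hd0 : d ≠ 0 := by
        intro hd0
        rw [← hc, ← hd, hc0, hd0] at hdet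
        simp at hdet
      have : (d : ℝ) ≠ 0 := by exact_mod_cast hd0
      rw [hc0]; simp; positivity
    · have : (c : ℝ) ≠ 0 := by exact_mod_cast hc0
      have : 0 < (c * τ.im) ^ 2 := by positivity
      positivity
  have hle : (γ • τ).im ≤ τ.im + 1 / τ.im := by
    rw [him]
    by_cases hc0 : c = 0
    · have hdet := γ.det_coe
      rw [Matrix.det_fin_two, ← hc, ← hd, hc0] at hdet
      have hd2 : d ^ 2 = 1 := by
        have : IsUnit d := IsUnit.of_mul_eq_one (γ 0 0) (by linarith)
        rcases Int.isUnit_iff.mp this with h | h <;> rw [h] <;> norm_num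
      have : D = 1 := by
        rw [hDval, hc0]
        have : (d : ℝ) ^ 2 = 1 := by exact_mod_cast hd2
        simp [this]
      rw [this, div_one]
      have : 0 < 1 / τ.im := by positivity
      linarith
    · have hc1 : (1 : ℝ) ≤ (c : ℝ) ^ 2 := by
        have : 1 ≤ c ^ 2 := by have := Int.one_le_abs hc0; nlinarith [sq_abs c]
        exact_mod_cast this
      have : τ.im / D ≤ 1 / τ.im := by
        rw [div_le_div_iff₀ hDpos hv, hDval]
        nlinarith [sq_nonneg (c * τ.re + d), sq_nonneg τ.im]
      linarith
  have hw := h (d * i - c * j) (-γ 0 1 * i + γ 0 0 * j) (γ • τ) (z / ((c : ℂ) * τ + d)) hγ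
  rw [hm, norm_mul, norm_expTwoPiI] at hw
  have e1 : (z / ((c : ℂ) * τ + d)).im = -(z * c * τ.im / D) := by
    rw [im_ofReal_div, ← hD]
    simp
    ring
  have e2 : ((c : ℂ) * z ^ 2 / ((c : ℂ) * τ + d)).im = -(c ^ 2 * z ^ 2 * τ.im / D) := by
    have : ((c : ℂ) * z ^ 2) = ((c * z ^ 2 : ℝ) : ℂ) := by push_cast; rfl
    have hi : ((c : ℂ) * τ + d).im = c * τ.im := by simp
    rw [this, im_ofReal_div, ← hD, hi]
    ring
  -- The automorphy factor cancels the Gaussian factor in the bound.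
  have e3 : -(2 * Real.pi * -(c ^ 2 * z ^ 2 * τ.im / D)) +
      -(2 * Real.pi * ((-(z * c * τ.im / D)) ^ 2 / (τ.im / D))) = 0 := by
    field_simp
    ring
  rw [e1, e2, him, mul_comm (Real.exp _), mul_assoc, ← Real.exp_add, e3, Real.exp_zero,
    mul_one, ← him] at hw
  refine hw.trans (mul_le_mul_of_nonneg_left (Real.exp_le_exp.mpr ?_) hK)
  exact mul_le_mul_of_nonneg_left hle (by positivity)

/-- The growth of the coefficients, with a free parameter `v`: choosing `v` of size
`1 / sqrt n` gives subexponential growth. -/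
theorem exists_abs_chat_le (T : TwistedTwiningGenera π lam) (hM : 0 < T.modulus) :
    ∃ K : ℝ, 0 ≤ K ∧ ∀ (r s : ℤ) (n : ℚ) (l : ℤ) (v : ℝ), 0 < v →
      |(T.chat r s n l : ℝ)| ≤
        K * Real.exp (Real.pi / 2 * (v + 1 / v)) * Real.exp (2 * Real.pi * n * v) := by
  obtain ⟨K, hK, h⟩ := T.exists_norm_φ_real_le hM
  refine ⟨K, hK, fun r s n l v hv => ?_⟩
  have := (T.hat_expansion r s).norm_coeff_le hM (T.exists_int_of_chat_ne_zero hM r s) v hv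
    (K * Real.exp (Real.pi / 2 * (v + 1 / v))) (fun τ z hτ => ?_) n l
  · simpa using this
  · rw [hat_eq, norm_mul]
    have hM' : (0 : ℝ) < T.modulus := by exact_mod_cast hM
    have : ‖∑ k ∈ Finset.range T.modulus, expTwoPiI (-((s : ℂ) * (k : ℂ) / T.modulus)) *
        T.φ r (k : ℤ) τ z‖ ≤ T.modulus * (K * Real.exp (Real.pi / 2 * (v + 1 / v))) := by
      refine (norm_sum_le_of_le _ (f := fun k : ℕ => expTwoPiI (-((s : ℂ) * (k : ℂ) / T.modulus)) *
        T.φ r (k : ℤ) τ z) (n := fun _ => K * Real.exp (Real.pi / 2 * (v + 1 / v)))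
        fun k _ => ?_).trans (by simp)
      rw [norm_mul, norm_expTwoPiI]
      have e : (-((s : ℂ) * (k : ℂ) / T.modulus)).im = 0 := by
        have : (-((s : ℂ) * (k : ℂ) / T.modulus)) = ((-(s * k / T.modulus) : ℝ) : ℂ) := by
          push_cast; rfl
        rw [this, Complex.ofReal_im]
      have := h r k τ z
      rw [hτ] at this
      simpa [e] using this
    simp only [norm_div, norm_one, Complex.norm_natCast]
    rw [one_div, inv_mul_le_iff₀ hM']
    exact this

end TwistedTwiningGenera

/-! ### Infinite products of integer powers -/

theorem norm_pow_sub_one_le (w : ℂ) (k : ℕ) : ‖w ^ k - 1‖ ≤ (1 + ‖w - 1‖) ^ k - 1 := by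
  have hw : ‖w‖ ≤ 1 + ‖w - 1‖ := by
    calc ‖w‖ = ‖1 + (w - 1)‖ := by congr 1; ring
      _ ≤ _ := (norm_add_le _ _).trans (by simp)
  induction k with
  | zero => simp
  | succ k ih =>
    have : w ^ (k + 1) - 1 = w ^ k * (w - 1) + (w ^ k - 1) := by ring
    rw [this]
    have h1 : ‖w ^ k‖ ≤ (1 + ‖w - 1‖) ^ k := by
      rw [norm_pow]; exact pow_le_pow_left₀ (norm_nonneg _) hw k
    calc _ ≤ ‖w ^ k * (w - 1)‖ + ‖w ^ k - 1‖ := norm_add_le _ _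
      _ ≤ (1 + ‖w - 1‖) ^ k * ‖w - 1‖ + ((1 + ‖w - 1‖) ^ k - 1) := by
          rw [norm_mul]; gcongr
      _ = _ := by ring

theorem norm_one_sub_zpow_sub_one_le (x : ℂ) (hx : ‖x‖ ≤ 1 / 2) (c : ℤ) :
    ‖(1 - x) ^ c - 1‖ ≤ Real.exp (2 * (|(c : ℝ)| * ‖x‖)) - 1 := by
  have key : ∀ (w : ℂ) (k : ℕ), ‖w - 1‖ ≤ 2 * ‖x‖ →
      ‖w ^ k - 1‖ ≤ Real.exp (2 * (k * ‖x‖)) - 1 := by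
    intro w k hw
    refine (norm_pow_sub_one_le w k).trans (sub_le_sub_right ?_ 1)
    have h1 : 1 + ‖w - 1‖ ≤ Real.exp (2 * ‖x‖) := by
      linarith [Real.add_one_le_exp (2 * ‖x‖)]
    calc (1 + ‖w - 1‖) ^ k ≤ Real.exp (2 * ‖x‖) ^ k := pow_le_pow_left₀ (by positivity) h1 k
      _ = _ := by rw [← Real.exp_nat_mul]; congr 1; ring
  rcases c with k | k
  · have := key (1 - x) k (by
      have : (1 - x) - 1 = -x := by ring
      rw [this, norm_neg]; linarith [norm_nonneg x])
    simpa using this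
  · have hne : (1 / 2 : ℝ) ≤ ‖1 - x‖ := by
      have := norm_sub_norm_le (1 : ℂ) x
      rw [norm_one] at this
      linarith
    have h0 : (1 - x) ≠ 0 := by
      intro h; rw [h, norm_zero] at hne; norm_num at hne
    have := key (1 - x)⁻¹ (k + 1) (by
      have : (1 - x)⁻¹ - 1 = x * (1 - x)⁻¹ := by field_simp; ring
      rw [this, norm_mul, norm_inv, ← div_eq_mul_inv, div_le_iff₀ (by linarith)]
      nlinarith [norm_nonneg x])
    rw [zpow_negSucc, ← inv_pow]
    have e : |((Int.negSucc k : ℤ) : ℝ)| = ((k + 1 : ℕ) : ℝ) := by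
      rw [Int.cast_negSucc, abs_neg, Nat.abs_cast]
    rw [e]
    exact this

theorem norm_one_sub_zpow_sub_one_le' (x : ℂ) (c : ℤ) (h : |(c : ℝ)| * ‖x‖ ≤ 1 / 2) :
    ‖(1 - x) ^ c - 1‖ ≤ 4 * (|(c : ℝ)| * ‖x‖) ∧
      ‖(1 - x) ^ c‖ ≤ Real.exp (2 * (|(c : ℝ)| * ‖x‖)) ∧ (1 - x) ^ c ≠ 0 := by
  by_cases hc : c = 0
  · simp [hc]
  have hc1 : (1 : ℝ) ≤ |(c : ℝ)| := by exact_mod_cast Int.one_le_abs hc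
  have hx : ‖x‖ ≤ 1 / 2 := by nlinarith [norm_nonneg x]
  have h1 := norm_one_sub_zpow_sub_one_le x hx c
  refine ⟨h1.trans ?_, ?_, ?_⟩
  · set t := |(c : ℝ)| * ‖x‖
    have ht : 0 ≤ t := by positivity
    have := Real.abs_exp_sub_one_le (x := 2 * t) (by rw [abs_of_nonneg] <;> linarith)
    rw [abs_of_nonneg (by positivity : (0 : ℝ) ≤ 2 * t)] at this
    linarith [le_abs_self (Real.exp (2 * t) - 1)]
  · have := norm_add_le ((1 - x) ^ c - 1) 1
    rw [sub_add_cancel, norm_one] at this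
    linarith
  · apply zpow_ne_zero
    intro h0
    have : x = 1 := by linear_combination -h0
    rw [this] at hx
    norm_num at hx

/-- Consider `∏ (1 - x_i exp(2 π i μ_i ε)) ^ c_i` near `ε = 0`. If exactly one of the factors with
non-zero exponent vanishes at `ε = 0`, and its exponent is positive, then the product tends to
zero through non-zero values. -/
theorem tendsto_tprod_zero_of_unique_zero {ι : Type*} (x : ι → ℂ) (μ : ι → ℝ) (c : ι → ℤ)
    (hsum : Summable fun i => |(c i : ℝ)| * ‖x i‖) (i₀ : ι) (hc₀ : 0 < c i₀) (hx₀ : x i₀ = 1)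
    (hμ₀ : μ i₀ ≠ 0) (hne : ∀ i, i ≠ i₀ → c i ≠ 0 → x i ≠ 1) :
    Filter.Tendsto (fun ε : ℝ => ∏' i, (1 - x i * expTwoPiI (μ i * ε)) ^ c i) (𝓝[≠] 0) (𝓝 0) ∧
      ∀ᶠ ε : ℝ in 𝓝[≠] (0 : ℝ), ∏' i, (1 - x i * expTwoPiI (μ i * ε)) ^ c i ≠ 0 := by
  classical
  -- All but the finitely many factors in `F` are close to `1`, uniformly in `ε`.
  have hfin : {i | ¬ |(c i : ℝ)| * ‖x i‖ ≤ 1 / 2}.Finite := by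
    have := hsum.tendsto_cofinite_zero.eventually (ge_mem_nhds (by norm_num : (0 : ℝ) < 1 / 2))
    exact this
  set F : Finset ι := hfin.toFinset with hF
  have hmemF : ∀ i, i ∉ F → |(c i : ℝ)| * ‖x i‖ ≤ 1 / 2 := by
    intro i hi
    by_contra h
    exact hi (by simpa [hF] using h)
  have hcF : ∀ i ∈ F, c i ≠ 0 := by
    intro i hi h
    have : ¬ |(c i : ℝ)| * ‖x i‖ ≤ 1 / 2 := by simpa [hF] using hi
    rw [h] at this
    norm_num at this
  have hi₀F : i₀ ∈ F := by
    by_contra h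
    have := hmemF i₀ h
    rw [hx₀, norm_one, mul_one] at this
    have h1 : (1 : ℝ) ≤ |(c i₀ : ℝ)| := by exact_mod_cast Int.one_le_abs hc₀.ne'
    linarith
  have hnorm : ∀ i (ε : ℝ), ‖x i * expTwoPiI (μ i * ε)‖ = ‖x i‖ := by
    intro i ε
    rw [norm_mul, norm_expTwoPiI]
    have : ((μ i : ℂ) * ε).im = 0 := by
      rw [← Complex.ofReal_mul, Complex.ofReal_im]
    simp [this]
  set A : ι → ℝ → ℂ := fun i ε => if i ∈ F then (1 - x i * expTwoPiI (μ i * ε)) ^ c i else 1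
  set B : ι → ℝ → ℂ := fun i ε => if i ∈ F then 1 else (1 - x i * expTwoPiI (μ i * ε)) ^ c i
  have hB : ∀ i ε, ‖B i ε - 1‖ ≤ 4 * (|(c i : ℝ)| * ‖x i‖) ∧
      ‖B i ε‖ ≤ Real.exp (2 * (|(c i : ℝ)| * ‖x i‖)) ∧ B i ε ≠ 0 := by
    intro i ε
    simp only [B]
    split_ifs with hi
    · refine ⟨by simp; positivity, by simp; positivity, one_ne_zero⟩
    · have := norm_one_sub_zpow_sub_one_le' (x i * expTwoPiI (μ i * ε)) (c i)
        (by rw [hnorm]; exact hmemF i hi)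
      rwa [hnorm] at this
  have hBsum : ∀ ε, Summable fun i => ‖B i ε - 1‖ := fun ε =>
    Summable.of_nonneg_of_le (fun _ => norm_nonneg _) (fun i => (hB i ε).1) (hsum.mul_left 4)
  have hBmul : ∀ ε, Multipliable fun i => B i ε := fun ε => by
    simpa using multipliable_one_add_of_summable (hBsum ε)
  have hBne : ∀ ε, ∏' i, B i ε ≠ 0 := fun ε => by
    have := tprod_one_add_ne_zero_of_summable (f := fun i => B i ε - 1)
      (fun i => by simpa using (hB i ε).2.2) (hBsum ε)
    simpa using this
  have hBbd : ∀ ε, ‖∏' i, B i ε‖ ≤ Real.exp (∑' i, 2 * (|(c i : ℝ)| * ‖x i‖)) := fun ε => by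
    have h := (hBmul ε).hasProd.norm
    refine le_of_tendsto h (Filter.Eventually.of_forall fun s => ?_)
    calc ∏ i ∈ s, ‖B i ε‖ ≤ ∏ i ∈ s, Real.exp (2 * (|(c i : ℝ)| * ‖x i‖)) :=
          Finset.prod_le_prod (fun _ _ => norm_nonneg _) fun i _ => (hB i ε).2.1
      _ = Real.exp (∑ i ∈ s, 2 * (|(c i : ℝ)| * ‖x i‖)) := (Real.exp_sum _ _).symm
      _ ≤ _ := Real.exp_le_exp.mpr
          ((hsum.mul_left 2).sum_le_tsum _ fun i _ => by positivity)
  have hsplit : ∀ ε : ℝ, ∏' i, (1 - x i * expTwoPiI (μ i * ε)) ^ c i =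
      (∏ i ∈ F, (1 - x i * expTwoPiI (μ i * ε)) ^ c i) * ∏' i, B i ε := by
    intro ε
    have hA1 : ∀ i ∉ F, A i ε = 1 := fun i hi => by simp [A, hi]
    have hA : ∏' i, A i ε = ∏ i ∈ F, (1 - x i * expTwoPiI (μ i * ε)) ^ c i := by
      rw [tprod_eq_prod hA1]
      exact Finset.prod_congr rfl fun i hi => by simp [A, hi]
    rw [← hA, ← (multipliable_of_ne_finset_one hA1).tprod_mul (hBmul ε)]
    refine tprod_congr fun i => ?_
    by_cases hi : i ∈ F <;> simp [A, B, hi]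
  have hcont : ∀ i, Continuous fun ε : ℝ => 1 - x i * expTwoPiI (μ i * ε) := fun i => by
    have := continuous_expTwoPiI
    fun_prop
  have hlim : ∀ i, Filter.Tendsto (fun ε : ℝ => 1 - x i * expTwoPiI (μ i * ε)) (𝓝[≠] 0)
      (𝓝 (1 - x i)) := fun i => by
    have := ((hcont i).tendsto 0).mono_left (nhdsWithin_le_nhds (s := {0}ᶜ))
    simpa using this
  have hother : ∀ i ∈ F.erase i₀, Filter.Tendsto
      (fun ε : ℝ => (1 - x i * expTwoPiI (μ i * ε)) ^ c i) (𝓝[≠] 0) (𝓝 ((1 - x i) ^ c i)) := by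
    intro i hi
    refine (hlim i).zpow₀ _ (Or.inl ?_)
    rw [Finset.mem_erase] at hi
    exact sub_ne_zero.mpr (hne i hi.1 (hcF i hi.2)).symm
  have hother_ne : ∀ i ∈ F.erase i₀, (1 - x i) ^ c i ≠ 0 := by
    intro i hi
    rw [Finset.mem_erase] at hi
    exact zpow_ne_zero _ (sub_ne_zero.mpr (hne i hi.1 (hcF i hi.2)).symm)
  have hrest := tendsto_finsetProd (F.erase i₀) hother
  have hzero : Filter.Tendsto (fun ε : ℝ => (1 - x i₀ * expTwoPiI (μ i₀ * ε)) ^ c i₀) (𝓝[≠] 0)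
      (𝓝 0) := by
    have := (hlim i₀).zpow₀ (c i₀) (Or.inr hc₀.le)
    rwa [show (1 - x i₀) ^ c i₀ = 0 by rw [hx₀, sub_self, zero_zpow _ hc₀.ne']] at this
  have hprod : ∀ ε : ℝ, ∏ i ∈ F, (1 - x i * expTwoPiI (μ i * ε)) ^ c i =
      (1 - x i₀ * expTwoPiI (μ i₀ * ε)) ^ c i₀ *
        ∏ i ∈ F.erase i₀, (1 - x i * expTwoPiI (μ i * ε)) ^ c i :=
    fun ε => (Finset.mul_prod_erase F _ hi₀F).symm
  constructor
  · simp_rw [hsplit, hprod]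
    have h1 := hzero.mul hrest
    rw [zero_mul] at h1
    rw [tendsto_zero_iff_norm_tendsto_zero] at h1 ⊢
    refine squeeze_zero (fun _ => norm_nonneg _)
      (g := fun ε : ℝ => ‖(1 - x i₀ * expTwoPiI (μ i₀ * ε)) ^ c i₀ *
        ∏ i ∈ F.erase i₀, (1 - x i * expTwoPiI (μ i * ε)) ^ c i‖ *
          Real.exp (∑' i, 2 * (|(c i : ℝ)| * ‖x i‖))) (fun ε => ?_) ?_
    · rw [norm_mul]
      exact mul_le_mul_of_nonneg_left (hBbd ε) (norm_nonneg _)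
    · simpa using h1.mul_const (Real.exp (∑' i, 2 * (|(c i : ℝ)| * ‖x i‖)))
  · have h1 : ∀ᶠ ε : ℝ in 𝓝[≠] (0 : ℝ),
        ∏ i ∈ F.erase i₀, (1 - x i * expTwoPiI (μ i * ε)) ^ c i ≠ 0 :=
      hrest.eventually_ne (Finset.prod_ne_zero_iff.mpr hother_ne)
    have h2 : ∀ᶠ ε : ℝ in 𝓝[≠] (0 : ℝ), |μ i₀ * ε| < 1 := by
      have : Filter.Tendsto (fun ε : ℝ => |μ i₀ * ε|) (𝓝 0) (𝓝 0) := by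
        have h : Continuous fun ε : ℝ => |μ i₀ * ε| := by fun_prop
        simpa using h.tendsto 0
      exact (this.eventually (gt_mem_nhds one_pos)).filter_mono nhdsWithin_le_nhds
    filter_upwards [h1, h2, self_mem_nhdsWithin] with ε h1 h2 h3
    rw [hsplit, hprod]
    refine mul_ne_zero (mul_ne_zero (zpow_ne_zero _ ?_) h1) (hBne ε)
    rw [hx₀, one_mul, sub_ne_zero, ne_comm, Ne, expTwoPiI_eq_one_iff]
    rintro ⟨k, hk⟩
    have hk' : μ i₀ * ε = k := by exact_mod_cast hk
    rw [hk'] at h2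
    have hk0 : k = 0 := by
      have : |k| < 1 := by exact_mod_cast h2
      exact Int.abs_lt_one_iff.mp this
    rw [hk0, Int.cast_zero] at hk'
    exact (mul_ne_zero hμ₀ h3) hk'

/-! ### A generic point on a rational quadratic divisor -/

/-- If `t` is irrational, the only rational linear forms which vanish on `((l t - N) / m, 1, -t)`
are the multiples of `(m, N, l)`. -/
theorem eq_of_form_eq_zero {t : ℝ} (ht : Irrational t) {m N l q₀ q₁ q₂ : ℚ} (hm : m ≠ 0)
    (h : (q₀ : ℝ) * ((l * t - N) / m) + q₁ - q₂ * t = 0) :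
    q₁ = q₀ / m * N ∧ q₂ = q₀ / m * l := by
  have hm' : (m : ℝ) ≠ 0 := by exact_mod_cast hm
  have h1 : ((q₀ / m * l - q₂ : ℚ) : ℝ) * t = ((q₀ / m * N - q₁ : ℚ) : ℝ) := by
    push_cast
    field_simp at h ⊢
    linear_combination h
  have h2 : q₀ / m * l - q₂ = 0 := by
    by_contra hne
    apply ht
    refine ⟨(q₀ / m * N - q₁) / (q₀ / m * l - q₂), ?_⟩
    have hne' : ((q₀ / m * l - q₂ : ℚ) : ℝ) ≠ 0 := by exact_mod_cast hne
    rw [Rat.cast_div, ← h1, mul_div_cancel_left₀ _ hne']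
  rw [h2, Rat.cast_zero, zero_mul] at h1
  have h3 : q₀ / m * N - q₁ = 0 := by exact_mod_cast h1.symm
  exact ⟨by linarith, by linarith⟩

/-- The plane orthogonal to a vector `(m, N, l)` with `4 m N - l ^ 2 < 0` meets the cone of
positive definite forms in a point `(p, 1, -t)`, `p = (l t - N) / m`, with `t` irrational. -/
theorem exists_irrational_posDef {m N l : ℚ} (hm : 0 < m) (hD : 4 * (m * N) - l ^ 2 < 0) :
    ∃ t : ℝ, Irrational t ∧ t ^ 2 < (l * t - N) / m := by
  have hm' : (0 : ℝ) < m := by exact_mod_cast hm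
  have hD' : (4 * (m * N) - l ^ 2 : ℝ) < 0 := by exact_mod_cast hD
  set δ : ℝ := Real.sqrt (l ^ 2 - 4 * (m * N)) / (2 * m) with hδ
  have hδ0 : 0 < δ := div_pos (Real.sqrt_pos.mpr (by linarith)) (by linarith)
  obtain ⟨t, ht, h1, h2⟩ :=
    exists_irrational_btwn (show (l / (2 * m) : ℝ) < l / (2 * m) + δ by linarith)
  refine ⟨t, ht, ?_⟩
  have h3 : (t - l / (2 * m)) ^ 2 < δ ^ 2 := by
    apply pow_lt_pow_left₀ (by linarith) (by linarith) (by norm_num)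
  have h4 : δ ^ 2 = (l ^ 2 - 4 * (m * N)) / (4 * m ^ 2) := by
    rw [hδ, div_pow, Real.sq_sqrt (by linarith)]
    ring
  rw [h4, lt_div_iff₀ (by positivity)] at h3
  rw [lt_div_iff₀ hm']
  have h5 : (t - l / (2 * m)) ^ 2 * (4 * m ^ 2) = (2 * m * t - l) ^ 2 := by
    field_simp
    ring
  rw [h5] at h3
  nlinarith

theorem binary_form_lower_bound {p t : ℝ} (h : t ^ 2 < p) (a b : ℝ) :
    (p - t ^ 2) / (1 + p) * (a ^ 2 + b ^ 2) ≤ p * a ^ 2 + 2 * (-t) * (a * b) + b ^ 2 := by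
  have hp : 0 < 1 + p := by nlinarith [sq_nonneg t]
  rw [div_mul_eq_mul_div, div_le_iff₀ hp]
  have h1 : 0 < 1 + t ^ 2 := by positivity
  have key : 0 ≤ (1 + t ^ 2) * ((p * a ^ 2 + 2 * (-t) * (a * b) + b ^ 2) * (1 + p) -
      (p - t ^ 2) * (a ^ 2 + b ^ 2)) := by
    have : (1 + t ^ 2) * ((p * a ^ 2 + 2 * (-t) * (a * b) + b ^ 2) * (1 + p) -
      (p - t ^ 2) * (a ^ 2 + b ^ 2)) =
        ((1 + t ^ 2) * b - t * (1 + p) * a) ^ 2 + (p - t ^ 2) ^ 2 * a ^ 2 := by ring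
    rw [this]; positivity
  have := nonneg_of_mul_nonneg_right key h1
  linarith

namespace TwistedTwiningGenera

variable {π : FrameShape} {lam : ℕ}

/-! ### Convergence of the product near the cusp -/

/-- The monomial `p ^ m q ^ (n / M) y ^ l`. -/
noncomputable def liftChar (T : TwistedTwiningGenera π lam) (v : ℕ × ℕ × ℤ) (Ω : ℂ × ℂ × ℂ) : ℂ :=
  expTwoPiI ((v.1 : ℂ) * Ω.1 + (v.2.1 : ℂ) / (T.modulus : ℂ) * Ω.2.1 + (v.2.2 : ℂ) * Ω.2.2)

/-- The exponent `ĉ_{m, n}(m n / M, l)` in the product. -/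
def liftExp (T : TwistedTwiningGenera π lam) (v : ℕ × ℕ × ℤ) : ℤ :=
  T.chat v.1 v.2.1 ((v.1 * v.2.1 : ℚ) / (T.modulus : ℚ)) v.2.2

theorem Phi_eq (T : TwistedTwiningGenera π lam) (Ω : ℂ × ℂ × ℂ) :
    T.Phi Ω = expTwoPiI (Ω.1 + (π.groundLevel : ℂ) * Ω.2.1 + Ω.2.2) *
      ∏' v : {v : ℕ × ℕ × ℤ // PositiveIndex v}, (1 - T.liftChar v.1 Ω) ^ T.liftExp v.1 := rfl

theorem norm_liftChar (T : TwistedTwiningGenera π lam) (v : ℕ × ℕ × ℤ) (Ω : ℂ × ℂ × ℂ) :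
    ‖T.liftChar v Ω‖ = Real.exp (-(2 * Real.pi * ((v.1 : ℝ) * Ω.1.im +
      (v.2.1 : ℝ) / T.modulus * Ω.2.1.im + v.2.2 * Ω.2.2.im))) := by
  rw [liftChar, norm_expTwoPiI]
  have : ((v.1 : ℂ) * Ω.1 + (v.2.1 : ℂ) / (T.modulus : ℂ) * Ω.2.1 + (v.2.2 : ℂ) * Ω.2.2) =
    (((v.1 : ℝ) : ℂ) * Ω.1 + ((v.2.1 / T.modulus : ℝ) : ℂ) * Ω.2.1 +
      ((v.2.2 : ℝ) : ℂ) * Ω.2.2) := by push_cast; rfl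
  rw [this]
  simp only [Complex.add_im, Complex.im_ofReal_mul]

theorem summable_liftBound : Summable fun v : ℕ × ℕ × ℤ =>
    Real.exp (-(v.1 : ℝ)) * (Real.exp (-(v.2.1 : ℝ)) * Real.exp (-|(v.2.2 : ℝ)|)) := by
  have hn : Summable fun n : ℕ => Real.exp (-(n : ℝ)) := Real.summable_exp_neg_nat
  have hz : Summable fun n : ℤ => Real.exp (-|(n : ℝ)|) := by
    refine Summable.of_nat_of_neg ?_ ?_ <;> simpa using hn
  exact hn.mul_of_nonneg (hn.mul_of_nonneg hz (fun _ => (Real.exp_pos _).le)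
    (fun _ => (Real.exp_pos _).le)) (fun _ => (Real.exp_pos _).le)
    (fun _ => mul_nonneg (Real.exp_pos _).le (Real.exp_pos _).le)

/-- The product converges absolutely where `Im Ω ≥ 3 M`. -/
theorem summable_lift (T : TwistedTwiningGenera π lam) (hM : 0 < T.modulus) (Ω : ℂ × ℂ × ℂ)
    (hΩ : ∀ a b : ℝ, 3 * (T.modulus : ℝ) * (a ^ 2 + b ^ 2) ≤
      Ω.1.im * a ^ 2 + 2 * Ω.2.2.im * (a * b) + Ω.2.1.im * b ^ 2) :
    Summable fun v : ℕ × ℕ × ℤ => |(T.liftExp v : ℝ)| * ‖T.liftChar v Ω‖ := by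
  obtain ⟨K, hK, hbd⟩ := T.exists_abs_chat_le hM
  have hM1 : (1 : ℝ) ≤ T.modulus := by exact_mod_cast hM
  set H := Ω.2.2.im
  -- Coefficients vanish unless `l ^ 2 ≤ 4 m n / M + 1`, so `|l|` is controlled by `m + n`. The linear
  -- form in the exponent is bounded below by the quadratic form at `(√m, ± √(n / M))`.
  refine Summable.of_nonneg_of_le (fun _ => by positivity) (fun v => ?_)
    (summable_liftBound.mul_left (K * Real.exp (Real.pi + 2 * Real.pi * |H| + 1)))
  obtain ⟨m, n, l⟩ := v
  by_cases hc : T.liftExp (m, n, l) = 0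
  · rw [hc]; simp; positivity
  have hdisc := T.neg_one_le_discr hM hc
  dsimp only at hdisc
  have hdisc' : (-1 : ℝ) ≤ 4 * ((m : ℝ) * n / T.modulus) - (l : ℝ) ^ 2 := by
    have := (Rat.cast_le (K := ℝ)).mpr hdisc
    push_cast at this
    exact this
  set x : ℝ := (m : ℝ)
  set y : ℝ := n / (T.modulus : ℝ) with hy
  have hx0 : (0 : ℝ) ≤ m := Nat.cast_nonneg m
  have hn0 : (0 : ℝ) ≤ n := Nat.cast_nonneg n
  have hy0 : 0 ≤ y := by positivity
  have hyn : y ≤ n := div_le_self hn0 hM1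
  have hyM : y * T.modulus = n := by rw [hy]; field_simp
  set a := Real.sqrt x
  set b := Real.sqrt y
  have ha : a ^ 2 = x := Real.sq_sqrt hx0
  have hb : b ^ 2 = y := Real.sq_sqrt hy0
  have ha0 : 0 ≤ a := Real.sqrt_nonneg _
  have hb0 : 0 ≤ b := Real.sqrt_nonneg _
  have hxy : (m : ℝ) * n / T.modulus = x * y := by rw [hy]; ring
  have hl : |(l : ℝ)| ≤ 2 * (a * b) + 1 := by
    apply abs_le_of_sq_le_sq _ (by positivity)
    have : (a * b) ^ 2 = x * y := by rw [mul_pow, ha, hb]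
    rw [hxy] at hdisc'
    nlinarith [mul_nonneg ha0 hb0]
  have hab : 2 * (a * b) ≤ x + y := by nlinarith [sq_nonneg (a - b)]
  have hlmn : |(l : ℝ)| ≤ m + n + 1 := by linarith
  have hform : 3 * (T.modulus : ℝ) * (x + y) - |H| ≤ x * Ω.1.im + y * Ω.2.1.im + l * H := by
    have h1 : -(|(l : ℝ)| * |H|) ≤ l * H := by
      rw [← abs_mul]; exact neg_abs_le _
    have h2 : |(l : ℝ)| * |H| ≤ (2 * (a * b) + 1) * |H| :=
      mul_le_mul_of_nonneg_right hl (abs_nonneg _)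
    rcases abs_cases H with ⟨hH, -⟩ | ⟨hH, -⟩
    · have := hΩ a (-b)
      rw [neg_sq, ha, hb] at this
      rw [hH] at h1 h2 ⊢
      nlinarith
    · have := hΩ a b
      rw [ha, hb] at this
      rw [hH] at h1 h2 ⊢
      nlinarith
  -- The choice `v = 1 / (m + n + 1)` bounds the coefficient by an exponential of `m + n`.
  have hcoef := hbd m n ((m * n : ℚ) / (T.modulus : ℚ)) l (1 / (m + n + 1)) (by positivity)
  have hcoef' : |(T.liftExp (m, n, l) : ℝ)| ≤
      K * Real.exp (Real.pi + 5 / 2 * Real.pi * (m + n)) := by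
    refine hcoef.trans ?_
    rw [mul_assoc, ← Real.exp_add]
    refine mul_le_mul_of_nonneg_left (Real.exp_le_exp.mpr ?_) hK
    have e1 : (1 : ℝ) / (m + n + 1) ≤ 1 := by
      rw [div_le_one (by positivity)]; linarith
    have e2 : ((((m * n : ℚ) / (T.modulus : ℚ)) : ℚ) : ℝ) * (1 / (m + n + 1)) ≤ m + n := by
      push_cast
      rw [mul_one_div, div_le_iff₀ (by positivity), hxy]
      have : x * y ≤ m * n := mul_le_mul_of_nonneg_left hyn hx0
      nlinarith
    have e3 : 2 * Real.pi * ((((m * n : ℚ) / (T.modulus : ℚ)) : ℚ) : ℝ) * (1 / (m + n + 1)) ≤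
        2 * Real.pi * (m + n) := by
      rw [mul_assoc]; exact mul_le_mul_of_nonneg_left e2 (by positivity)
    have e4 : Real.pi / 2 * (1 / ((m : ℝ) + n + 1) + 1 / (1 / (m + n + 1))) ≤
        Real.pi / 2 * (1 + (m + n + 1)) := by
      rw [one_div_one_div]
      exact mul_le_mul_of_nonneg_left (by linarith) (by positivity)
    linarith
  have hchar : ‖T.liftChar (m, n, l) Ω‖ ≤
      Real.exp (-(6 * Real.pi * (m + n)) + 2 * Real.pi * |H|) := by
    rw [norm_liftChar]
    refine Real.exp_le_exp.mpr ?_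
    have h1 : (m : ℝ) + n ≤ T.modulus * (x + y) := by
      have : x ≤ T.modulus * x := le_mul_of_one_le_left hx0 hM1
      rw [mul_add, mul_comm _ y, hyM]; linarith
    have h2 : 3 * ((m : ℝ) + n) - |H| ≤ x * Ω.1.im + y * Ω.2.1.im + l * H := by linarith
    have := mul_le_mul_of_nonneg_left h2 (by positivity : (0 : ℝ) ≤ 2 * Real.pi)
    simp only
    linarith
  calc _ ≤ (K * Real.exp (Real.pi + 5 / 2 * Real.pi * (m + n))) *
        Real.exp (-(6 * Real.pi * (m + n)) + 2 * Real.pi * |H|) :=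
        mul_le_mul hcoef' hchar (norm_nonneg _) (by positivity)
    _ ≤ (K * Real.exp (Real.pi + 2 * Real.pi * |H| + 1)) *
        Real.exp (-(m : ℝ) + (-(n : ℝ) + -|(l : ℝ)|)) := by
        rw [mul_assoc K, mul_assoc K, ← Real.exp_add, ← Real.exp_add]
        refine mul_le_mul_of_nonneg_left (Real.exp_le_exp.mpr ?_) hK
        have : 2 * ((m : ℝ) + n) ≤ 7 / 2 * Real.pi * (m + n) :=
          mul_le_mul_of_nonneg_right (by linarith [Real.pi_gt_three]) (by positivity)
        linarith
    _ = _ := by rw [Real.exp_add (-(m : ℝ)), Real.exp_add (-(n : ℝ))]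

/-! ### Positive exponents give poles -/

/-- A vector `(m, n, l)` of negative discriminant with positive exponent, no proper multiple of
which has a non-zero exponent, gives a pole of `1 / Φ` near the cusp at a point where no other
rational linear form vanishes. By the contour assumption its orthogonal plane is a wall. -/
theorem exists_wall_of_liftExp_pos (T : TwistedTwiningGenera π lam) (hM : 0 < T.modulus)
    (hC : T.StandardContourAssumption) {m n : ℕ} {l : ℤ} (hm : 0 < m)
    (hD : 4 * ((m : ℚ) * n / T.modulus) - (l : ℚ) ^ 2 < 0) (hpos : 0 < T.liftExp (m, n, l))
    (hmul : ∀ k : ℕ, 2 ≤ k → T.liftExp (k * m, k * n, k * l) = 0) :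
    ∃ (a b c : ℤ) (d s : ℚ), (∃ d₀ : ℤ, d = (d₀ : ℚ) / (lam : ℚ)) ∧
      (a : ℚ) * d - (b : ℚ) * (c : ℚ) = 1 ∧ (π.order : ℤ) ∣ a * c ∧
      (∃ w : ℤ, (a * c * T.E : ℚ) / (T.modulus : ℚ) + (b : ℚ) * d = (w : ℚ)) ∧
      (a : ℚ) * c = s * m ∧ (b : ℚ) * d = s * (n / T.modulus) ∧
      (a : ℚ) * d + b * c = s * l := by
  obtain ⟨C, hC0, hC⟩ := hC
  have hM' : (0 : ℝ) < T.modulus := by exact_mod_cast hM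
  have hmQ : (0 : ℚ) < m := by exact_mod_cast hm
  have hmR : (0 : ℝ) < m := by exact_mod_cast hm
  set N : ℚ := n / T.modulus with hN
  obtain ⟨t, ht, htp⟩ := exists_irrational_posDef (m := m) (N := N) (l := l) hmQ (by
    rw [hN, ← mul_div_assoc]; exact hD)
  set p : ℝ := ((l : ℚ) * t - N) / (m : ℚ) with hp
  set δ : ℝ := (p - t ^ 2) / (1 + p) with hδ
  have hp0 : 0 < p := lt_of_le_of_lt (sq_nonneg t) htp
  have hδ0 : 0 < δ := div_pos (by linarith) (by linarith)
  set C' : ℝ := max C (3 * T.modulus) with hC'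
  set L : ℝ := C' / δ with hL
  have hC'0 : 0 < C' := lt_of_lt_of_le hC0 (le_max_left _ _)
  have hL0 : 0 < L := div_pos hC'0 hδ0
  -- The base point: `m σ + (n / M) τ + l z = 1` and `Im Ω = L (p, 1, -t)`.
  set Ω : ℂ × ℂ × ℂ := (⟨1 / m, L * p⟩, ⟨0, L⟩, ⟨0, L * (-t)⟩) with hΩ
  have hbelow : ∀ a b : ℝ, C' * (a ^ 2 + b ^ 2) ≤
      Ω.1.im * a ^ 2 + 2 * Ω.2.2.im * (a * b) + Ω.2.1.im * b ^ 2 := by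
    intro a b
    have h := mul_le_mul_of_nonneg_left (binary_form_lower_bound htp a b) hL0.le
    have e : L * ((p - t ^ 2) / (1 + p) * (a ^ 2 + b ^ 2)) = C' * (a ^ 2 + b ^ 2) := by
      rw [← hδ, ← mul_assoc, hL, div_mul_cancel₀ _ hδ0.ne']
    rw [e] at h
    simp only [hΩ]
    linarith
  -- The point lies in the region of the contour assumption.
  have hpsd : (imMatrix Ω - C • (1 : Matrix (Fin 2) (Fin 2) ℝ)).PosSemidef := by
    refine Matrix.PosSemidef.of_dotProduct_mulVec_nonneg ?_ fun x => ?_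
    · ext i j
      fin_cases i <;> fin_cases j <;> simp [imMatrix]
    · have h := hbelow (x 0) (x 1)
      have h2 : C * (x 0 ^ 2 + x 1 ^ 2) ≤ C' * (x 0 ^ 2 + x 1 ^ 2) :=
        mul_le_mul_of_nonneg_right (le_max_left _ _) (by positivity)
      simp [imMatrix, dotProduct, Matrix.mulVec, Fin.sum_univ_two, Matrix.smul_apply] at h ⊢
      nlinarith
  have hsum : Summable fun v : {v : ℕ × ℕ × ℤ // PositiveIndex v} =>
      |(T.liftExp v.1 : ℝ)| * ‖T.liftChar v.1 Ω‖ := by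
    refine (T.summable_lift hM Ω fun a b => le_trans ?_ (hbelow a b)).subtype _
    exact mul_le_mul_of_nonneg_right (le_max_right _ _) (by positivity)
  -- A linear form with rational coefficients which vanishes at `Im Ω` is a multiple of `v`.
  have hprop : ∀ q₀ q₁ q₂ : ℚ, (q₀ : ℝ) * (L * p) + q₁ * L + q₂ * (L * (-t)) = 0 →
      q₁ = q₀ / m * N ∧ q₂ = q₀ / m * l := by
    intro q₀ q₁ q₂ h
    refine eq_of_form_eq_zero ht hmQ.ne' ?_
    rw [← hp]
    have : L * ((q₀ : ℝ) * p + q₁ - q₂ * t) = 0 := by linarith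
    exact (mul_eq_zero.mp this).resolve_left hL0.ne'
  have hv0 : PositiveIndex (m, n, l) := fun h => absurd h.1 hm.ne'
  have hlin : (m : ℝ) * p + (N : ℝ) - l * t = 0 := by
    rw [hp]; push_cast; field_simp; ring
  have hchar0 : T.liftChar (m, n, l) Ω = 1 := by
    rw [liftChar, expTwoPiI_eq_one_iff]
    refine ⟨1, ?_⟩
    have e1 : ((n : ℂ) / (T.modulus : ℂ)) = ((N : ℝ) : ℂ) := by rw [hN]; push_cast; rfl
    simp only [hΩ]
    rw [e1]
    apply Complex.ext
    · simp [hmR.ne']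
    · simp
      linear_combination L * hlin
  -- By irrationality of `t`, only multiples of `(m, n, l)` give factors which vanish at `Ω`.
  have hunique : ∀ v : {v : ℕ × ℕ × ℤ // PositiveIndex v}, v ≠ ⟨(m, n, l), hv0⟩ →
      T.liftExp v.1 ≠ 0 → T.liftChar v.1 Ω ≠ 1 := by
    rintro ⟨⟨m', n', l'⟩, hv'⟩ hne hexp hone
    have hnorm := T.norm_liftChar (m', n', l') Ω
    rw [hone, norm_one, eq_comm, Real.exp_eq_one_iff, neg_eq_zero] at hnorm
    have h0 := (mul_eq_zero.mp hnorm).resolve_left (by positivity)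
    simp only [hΩ] at h0
    obtain ⟨h1, h2⟩ := hprop m' (n' / T.modulus) l' (by push_cast; linarith)
    rw [liftChar, expTwoPiI_eq_one_iff] at hone
    obtain ⟨k, hk⟩ := hone
    have hkre := congrArg Complex.re hk
    have e1 : ((n' : ℂ) / (T.modulus : ℂ)) = ((n' / T.modulus : ℝ) : ℂ) := by push_cast; rfl
    rw [e1] at hkre
    simp [hΩ] at hkre
    have hk' : (m' : ℚ) = k * m := by
      have : (m' : ℝ) = k * m := by rw [← hkre]; field_simp
      exact_mod_cast this
    have hkm : (m' : ℚ) / m = k := by rw [hk']; field_simp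
    rw [hkm] at h1 h2
    have hMQ : (T.modulus : ℚ) ≠ 0 := by exact_mod_cast hM.ne'
    have hn' : (n' : ℚ) = k * n := by
      rw [hN] at h1; field_simp at h1; exact_mod_cast h1
    have hkZ : (m' : ℤ) = k * m := by exact_mod_cast hk'
    have hnZ : (n' : ℤ) = k * n := by exact_mod_cast hn'
    have hlZ : l' = k * l := by exact_mod_cast h2
    have hk0 : 0 ≤ k := by
      by_contra hneg
      have : k * m < 0 := mul_neg_of_neg_of_pos (by omega) (by exact_mod_cast hm)
      omega
    obtain ⟨k, rfl⟩ := Int.eq_ofNat_of_zero_le hk0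
    have hm2 : m' = k * m := by exact_mod_cast hkZ
    have hn2 : n' = k * n := by exact_mod_cast hnZ
    subst hm2 hn2 hlZ
    rcases Nat.lt_or_ge k 2 with hk2 | hk2
    · interval_cases k
      · have := hv' ⟨by simp, by simp⟩
        simp at this
      · apply hne
        simp
    · exact hexp (hmul k hk2)
  obtain ⟨hlim, hnz⟩ := tendsto_tprod_zero_of_unique_zero
    (fun v : {v : ℕ × ℕ × ℤ // PositiveIndex v} => T.liftChar v.1 Ω) (fun v => (v.1.1 : ℝ))
    (fun v => T.liftExp v.1) hsum ⟨(m, n, l), hv0⟩ hpos hchar0 (by exact_mod_cast hm.ne') hunique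
  -- `Φ` tends to zero through non-zero values along the path `σ + ε`, so `1 / Φ` is unbounded.
  have hpath : ∀ ε : ℝ, T.Phi (Ω.1 + ε, Ω.2.1, Ω.2.2) =
      expTwoPiI (Ω.1 + ε + (π.groundLevel : ℂ) * Ω.2.1 + Ω.2.2) *
      ∏' v : {v : ℕ × ℕ × ℤ // PositiveIndex v},
        (1 - T.liftChar v.1 Ω * expTwoPiI (((v.1.1 : ℝ) : ℂ) * ε)) ^ T.liftExp v.1 := by
    intro ε
    rw [Phi_eq]
    congr 1
    refine tprod_congr fun v => ?_
    congr 2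
    rw [liftChar, liftChar, ← expTwoPiI_add]
    congr 1
    push_cast
    ring
  have hpole : HasPoleAt (fun Ω' => (T.Phi Ω')⁻¹) Ω := by
    intro hO
    obtain ⟨K, hK⟩ := hO.bound
    have hcont : Filter.Tendsto (fun ε : ℝ => ((Ω.1 + ε, Ω.2.1, Ω.2.2) : ℂ × ℂ × ℂ)) (𝓝[≠] 0)
        (𝓝 Ω) := by
      have h : Continuous fun ε : ℝ => ((Ω.1 + ε, Ω.2.1, Ω.2.2) : ℂ × ℂ × ℂ) := by fun_prop
      have := (h.tendsto 0).mono_left (nhdsWithin_le_nhds (s := {0}ᶜ))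
      simpa using this
    have hb := hcont.eventually hK
    have hpre : Continuous fun ε : ℝ =>
        expTwoPiI (Ω.1 + ε + (π.groundLevel : ℂ) * Ω.2.1 + Ω.2.2) := by
      have := continuous_expTwoPiI
      fun_prop
    have hz : Filter.Tendsto (fun ε : ℝ => T.Phi (Ω.1 + ε, Ω.2.1, Ω.2.2)) (𝓝[≠] 0) (𝓝[≠] 0) := by
      rw [tendsto_nhdsWithin_iff]
      constructor
      · simp_rw [hpath]
        have := ((hpre.tendsto 0).mono_left (nhdsWithin_le_nhds (s := {0}ᶜ))).mul hlim
        simpa using this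
      · filter_upwards [hnz] with ε hε
        rw [hpath]
        exact mul_ne_zero (expTwoPiI_ne_zero _) hε
    have hinf := (tendsto_norm_inv_nhdsNE_zero_atTop (α := ℂ)).comp hz
    obtain ⟨ε, h1, h2⟩ := (hb.and (hinf.eventually_gt_atTop K)).exists
    simp at h1 h2
    linarith
  obtain ⟨a, b, c, d, hd, hdet, hdvd, hw, hpair⟩ := hC Ω hpsd hpole
  -- The wall contains `Im Ω`, so by irrationality of `t` its vector is proportional to `(m, n, l)`.
  refine ⟨a, b, c, d, (a * c) / m, hd, hdet, hdvd, hw, by field_simp, ?_⟩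
  simp [pairing, imMatrix, hΩ] at hpair
  obtain ⟨h1, h2⟩ := hprop (a * c) (b * d) (a * d + b * c) (by push_cast; linarith)
  exact ⟨h1, h2⟩

/-! ### Vanishing, shift, and the leading coefficients -/

theorem chat_eq_zero_of_not_modEq (T : TwistedTwiningGenera π lam) (hM : 0 < T.modulus) {r s : ℤ}
    (h : ¬ s ≡ r * T.E [ZMOD (lam : ℤ)]) (n : ℚ) (l : ℤ) : T.chat r s n l = 0 := by
  have h0 : T.hat r s = 0 := T.vanishing r s h
  have h1 : HasFourierExpansion (T.hat r s) (fun _ _ => (0 : ℂ)) := by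
    intro τ z
    simp only [h0, zero_mul, Pi.zero_apply]
    exact hasSum_zero
  have := (T.hat_expansion r s).coeff_unique h1 hM (T.exists_int_of_chat_ne_zero hM r s)
    (by simp) n l
  exact_mod_cast this

/-- The sectors twisted by powers of `g ^ N` are untwisted. -/
theorem hat_shift (T : TwistedTwiningGenera π lam) (s k : ℤ) :
    T.hat (k * π.order) s = T.hat 0 (s + k * (T.E * π.order)) := by
  have h := T.shift
  change ∀ r s, T.hat (r + π.order) (s - T.E * π.order) = T.hat r s at h
  induction k using Int.induction_on generalizing s with
  | zero => simp
  | succ m ih =>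
    rw [add_mul, one_mul, show s = (s + T.E * π.order) - T.E * π.order by ring, h, ih]
    congr 1; ring
  | pred m ih =>
    rw [← h, show (-(m : ℤ) - 1) * (π.order : ℤ) + π.order = -(m : ℤ) * π.order by ring, ih]
    congr 1; ring

theorem chat_shift (T : TwistedTwiningGenera π lam) (hM : 0 < T.modulus) (s k : ℤ) (n : ℚ)
    (l : ℤ) : T.chat (k * π.order) s n l = T.chat 0 (s + k * (T.E * π.order)) n l :=
  T.chat_eq_of_hat_eq hM (T.hat_shift s k) n l

/-- At the cusp only the coefficients of `q ^ 0` survive; since a non-zero coefficient has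
discriminant at least `-1`, these are the ones of `y⁻¹`, `1` and `y`. -/
theorem tendsto_hat_atImInfty (T : TwistedTwiningGenera π lam) (hM : 0 < T.modulus) (r s : ℤ)
    (z : ℂ) : Filter.Tendsto (fun τ : ℍ => T.hat r s τ z) UpperHalfPlane.atImInfty
      (𝓝 (T.chat r s 0 (-1) * expTwoPiI (-z) + T.chat r s 0 0 + T.chat r s 0 1 * expTwoPiI z)) := by
  have hlim : Filter.Tendsto (fun τ : ℍ => ∑' x : ℚ × ℤ, (T.chat r s x.1 x.2 : ℂ) *
      expTwoPiI ((x.1 : ℂ) * τ + (x.2 : ℂ) * z)) UpperHalfPlane.atImInfty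
      (𝓝 (∑' x : ℚ × ℤ, if x.1 = 0 then (T.chat r s 0 x.2 : ℂ) * expTwoPiI ((x.2 : ℂ) * z)
        else 0)) := by
    refine tendsto_tsum_of_dominated_convergence
      (T.hat_summable_norm r s (v := 1) one_pos z.im) ?_ ?_
    · rintro ⟨n, l⟩
      by_cases hc : T.chat r s n l = 0
      · have : (if n = 0 then (T.chat r s 0 l : ℂ) * expTwoPiI ((l : ℂ) * z) else 0) = 0 := by
          split_ifs with hn
          · subst hn; simp [hc]
          · rfl
        simp [hc, this]
      have hn := (T.chat_support hc).1
      rcases hn.eq_or_lt with rfl | hn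
      · simp
      · simp only [hn.ne', if_false]
        rw [tendsto_zero_iff_norm_tendsto_zero]
        simp only [norm_mul, norm_expTwoPiI]
        rw [← mul_zero ‖(T.chat r s n l : ℂ)‖]
        refine Filter.Tendsto.const_mul _ (Real.tendsto_exp_neg_atTop_nhds_zero.comp ?_)
        have him : ∀ τ : ℍ, 2 * Real.pi * ((n : ℂ) * τ + (l : ℂ) * z).im =
            (2 * Real.pi * n) * τ.im + 2 * Real.pi * (l * z.im) := by
          intro τ; simp; ring
        simp only [him]
        refine Filter.tendsto_atTop_add_const_right _ _
          (Filter.Tendsto.const_mul_atTop ?_ Filter.tendsto_comap)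
        have : (0 : ℝ) < n := by exact_mod_cast hn
        positivity
    · filter_upwards [Filter.preimage_mem_comap (Filter.Ici_mem_atTop (1 : ℝ))] with τ hτ
      rintro ⟨n, l⟩
      by_cases hc : T.chat r s n l = 0
      · simp [hc]
      have hn : (0 : ℝ) ≤ n := by exact_mod_cast (T.chat_support hc).1
      have hτ : 1 ≤ τ.im := hτ
      rw [norm_mul, norm_expTwoPiI]
      refine mul_le_mul_of_nonneg_left (Real.exp_le_exp.mpr ?_) (norm_nonneg _)
      have him : ((n : ℂ) * τ + (l : ℂ) * z).im = n * τ.im + l * z.im := by simp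
      rw [him]
      have := mul_le_mul_of_nonneg_left hτ hn
      have := Real.pi_pos
      nlinarith
  have htsum : (∑' x : ℚ × ℤ, if x.1 = 0 then (T.chat r s 0 x.2 : ℂ) * expTwoPiI ((x.2 : ℂ) * z)
        else 0) =
      T.chat r s 0 (-1) * expTwoPiI (-z) + T.chat r s 0 0 + T.chat r s 0 1 * expTwoPiI z := by
    rw [tsum_eq_sum (s := ({(0, -1), (0, 0), (0, 1)} : Finset (ℚ × ℤ)))]
    · rw [Finset.sum_insert (by simp), Finset.sum_insert (by simp), Finset.sum_singleton]
      simp [add_assoc]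
    · rintro ⟨n, l⟩ hx
      by_contra hne
      simp only [ite_eq_right_iff, mul_eq_zero, Int.cast_eq_zero, Classical.not_imp,
        not_or] at hne
      obtain ⟨rfl, hc, -⟩ := hne
      have h1 := T.neg_one_le_discr hM hc
      have h2 : l ^ 2 ≤ 1 := by
        have : (l : ℚ) ^ 2 ≤ 1 := by linarith
        exact_mod_cast this
      have h3 : -1 ≤ l := by nlinarith
      have h4 : l ≤ 1 := by nlinarith
      interval_cases l <;> simp at hx
  rw [htsum] at hlim
  refine hlim.congr fun τ => (T.hat_hasSum r s τ z).tsum_eq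

theorem eq_of_forall_laurent {A B C D c : ℂ}
    (h : ∀ z : ℂ, A * expTwoPiI (-z) + B + C * expTwoPiI z =
      D * (expTwoPiI z + expTwoPiI (-z)) + c) : A = D ∧ B = c ∧ C = D := by
  have e2 : expTwoPiI (1 / 2) = -1 := by
    rw [expTwoPiI, show 2 * (Real.pi : ℂ) * Complex.I * (1 / 2) = Real.pi * Complex.I by ring,
      Complex.exp_pi_mul_I]
  have e4 : expTwoPiI (1 / 4) = Complex.I := by
    rw [expTwoPiI, show 2 * (Real.pi : ℂ) * Complex.I * (1 / 4) = Real.pi / 2 * Complex.I by ring,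
      Complex.exp_pi_div_two_mul_I]
  have h0 := h 0
  have h2 := h (1 / 2)
  have h4 := h (1 / 4)
  simp only [expTwoPiI_neg, e2, e4, neg_zero, expTwoPiI_zero, Complex.inv_I] at h0 h2 h4
  norm_num at h0 h2 h4
  have hB : B = c := by linear_combination (h0 + h2) / 2
  have hAC : A + C = 2 * D := by linear_combination (h0 - h2) / 2
  have hI : A - C = 0 := by
    have : Complex.I * (A - C) = 0 := by linear_combination - h4 + hB
    simpa using this
  exact ⟨by linear_combination (hAC + hI) / 2, hB, by linear_combination (hAC - hI) / 2⟩

theorem tendsto_φ_zero (T : TwistedTwiningGenera π lam) (k : ℤ) (z : ℂ) :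
    Filter.Tendsto (fun τ : ℍ => T.φ 0 k τ z) UpperHalfPlane.atImInfty
      (𝓝 (2 * (expTwoPiI z + expTwoPiI (-z)) + (((π.trace k : ℤ) : ℂ) - 4))) := by
  convert T.leading k z using 2
  simp only [expTwoPiI, mul_neg]
  ring

/-- The untwisted sector contains the two states of discriminant `-1` in the invariant
subspace only. -/
theorem chat_zero_eq_zero (T : TwistedTwiningGenera π lam) (hM : 0 < T.modulus) {s : ℤ}
    (hs : ¬ (T.modulus : ℤ) ∣ s) : T.chat 0 s 0 1 = 0 := by
  have hM' : (T.modulus : ℂ) ≠ 0 := by exact_mod_cast hM.ne'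
  have key : ∀ z : ℂ, (T.chat 0 s 0 (-1) : ℂ) * expTwoPiI (-z) + T.chat 0 s 0 0 +
      T.chat 0 s 0 1 * expTwoPiI z = 0 * (expTwoPiI z + expTwoPiI (-z)) +
      (1 / (T.modulus : ℂ)) * ∑ k ∈ Finset.range T.modulus,
        expTwoPiI (-((s : ℂ) * (k : ℂ) / T.modulus)) * (((π.trace k : ℤ) : ℂ) - 4) := by
    intro z
    refine tendsto_nhds_unique (T.tendsto_hat_atImInfty hM 0 s z) ?_
    have h1 : Filter.Tendsto (fun τ : ℍ => T.hat 0 s τ z) UpperHalfPlane.atImInfty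
      (𝓝 ((1 / (T.modulus : ℂ)) * ∑ k ∈ Finset.range T.modulus,
        expTwoPiI (-((s : ℂ) * (k : ℂ) / T.modulus)) *
          (2 * (expTwoPiI z + expTwoPiI (-z)) + (((π.trace k : ℤ) : ℂ) - 4)))) := by
      have e : (fun τ : ℍ => T.hat 0 s τ z) = fun τ : ℍ => (1 / (T.modulus : ℂ)) *
          ∑ k ∈ Finset.range T.modulus,
            expTwoPiI (-((s : ℂ) * (k : ℂ) / T.modulus)) * T.φ 0 (k : ℤ) τ z :=
        funext fun τ => T.hat_eq 0 s τ z
      rw [e]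
      refine Filter.Tendsto.const_mul _ (tendsto_finsetSum _ fun k _ => ?_)
      exact Filter.Tendsto.const_mul _ (T.tendsto_φ_zero k z)
    convert h1 using 2
    rw [zero_mul, zero_add]
    congr 1
    simp only [mul_add, Finset.sum_add_distrib, ← Finset.sum_mul]
    have : ∑ k ∈ Finset.range T.modulus, expTwoPiI (-((s : ℂ) * (k : ℂ) / T.modulus)) = 0 := by
      have hne1 : expTwoPiI (-(s / T.modulus)) ≠ 1 := by
        rw [Ne, expTwoPiI_eq_one_iff]
        rintro ⟨w, hw⟩
        apply hs
        refine ⟨-w, ?_⟩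
        field_simp at hw
        have : -s = (T.modulus : ℤ) * w := by exact_mod_cast hw
        linarith
      have e : ∀ k ∈ Finset.range T.modulus, expTwoPiI (-((s : ℂ) * (k : ℂ) / T.modulus)) =
          expTwoPiI (-(s / T.modulus)) ^ k := by
        intro k _
        rw [← expTwoPiI_nsmul]; congr 1; ring
      rw [Finset.sum_congr rfl e, geom_sum_eq hne1, ← expTwoPiI_nsmul]
      have : (T.modulus : ℂ) * (-(s / T.modulus)) = ((-s : ℤ) : ℂ) := by
        push_cast; field_simp
      rw [this, expTwoPiI_int]
      simp
    rw [this]; ring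
  have := (eq_of_forall_laurent key).2.2
  exact_mod_cast this

end TwistedTwiningGenera

/-! ### Arithmetic of the 42 cases -/

theorem mem_orders {π : FrameShape} {lam : ℕ} (hπ : (π, lam) ∈ k3FrameShapes) :
    (π.order, lam) ∈ [(1, 1), (2, 1), (3, 1), (4, 1), (5, 1), (6, 1), (7, 1), (8, 1), (9, 1),
      (10, 1), (11, 1), (12, 1), (14, 1), (15, 1), (2, 2), (4, 2), (6, 2), (8, 2), (10, 2),
      (12, 2), (3, 3), (4, 4), (8, 4), (6, 6)] := by
  have : ∀ p ∈ k3FrameShapes, (p.1.order, p.2) ∈ [(1, 1), (2, 1), (3, 1), (4, 1), (5, 1), (6, 1),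
      (7, 1), (8, 1), (9, 1), (10, 1), (11, 1), (12, 1), (14, 1), (15, 1), (2, 2), (4, 2), (6, 2),
      (8, 2), (10, 2), (12, 2), (3, 3), (4, 4), (8, 4), (6, 6)] := by
    decide +kernel
  exact this _ hπ

/-- The consequences of the classification used for the walls: which odd squares divide `M`, and in
which cases there is an integer `i` in `[2 M / 9, M / 4)`. -/
theorem modulus_facts {π : FrameShape} {lam : ℕ} (hπ : (π, lam) ∈ k3FrameShapes) :
    0 < π.order * lam ∧
    (∀ a : ℕ, Odd a → a ^ 2 ∣ π.order * lam → a = 1 ∨ a = 3 ∧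
      (π.order = 9 ∧ lam = 1 ∨ π.order = 3 ∧ lam = 3 ∨ π.order = 6 ∧ lam = 6)) ∧
    (∀ i : ℕ, 2 * (π.order * lam) ≤ 9 * i → 4 * i < π.order * lam →
      9 * i = 2 * (π.order * lam) ∧
      (π.order = 9 ∧ lam = 1 ∨ π.order = 3 ∧ lam = 3 ∨ π.order = 6 ∧ lam = 6)) := by
  have h := mem_orders hπ
  generalize π.order = N at h
  simp only [List.mem_cons, Prod.mk.injEq, List.not_mem_nil, or_false] at h
  have key : 0 < N * lam ∧ N * lam ≤ 36 ∧
    (∀ a ∈ Finset.range 7, a % 2 = 1 → a ^ 2 ∣ N * lam → a = 1 ∨ a = 3 ∧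
      (N = 9 ∧ lam = 1 ∨ N = 3 ∧ lam = 3 ∨ N = 6 ∧ lam = 6)) ∧
    (∀ i ∈ Finset.range 9, 2 * (N * lam) ≤ 9 * i → 4 * i < N * lam → 9 * i = 2 * (N * lam) ∧
      (N = 9 ∧ lam = 1 ∨ N = 3 ∧ lam = 3 ∨ N = 6 ∧ lam = 6)) := by
    rcases h with h | h | h | h | h | h | h | h | h | h | h | h | h | h | h | h | h | h | h | h |
      h | h | h | h <;> obtain ⟨rfl, rfl⟩ := h <;>
      exact ⟨by decide, by decide, by decide, by decide⟩
  obtain ⟨h1, h2, h3, h4⟩ := key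
  refine ⟨h1, fun a ha hd => h3 a (Finset.mem_range.mpr ?_) (Nat.odd_iff.mp ha) hd,
    fun i hi hi' => h4 i (Finset.mem_range.mpr (by omega)) hi hi'⟩
  have := Nat.le_of_dvd h1 hd
  nlinarith

namespace TwistedTwiningGenera

variable {π : FrameShape} {lam : ℕ}

/-! ### Poles off the physical walls -/

/-- For discriminant `-1/9` and `(N, λ)` equal to `(3, 3)` or `(6, 6)`, the multiplier condition
forbids `3 ∣ m E + n`. -/
theorem not_three_dvd_of_special (T : TwistedTwiningGenera π lam) {m n t i : ℤ}
    (hNl : π.order = 3 ∧ lam = 3 ∨ π.order = 6 ∧ lam = 6)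
    (hi : 9 * i = 2 * T.modulus) (hmn : m * n = i + T.modulus * (t * (t + 1)))
    (hE : n ≡ m * T.E [ZMOD (lam : ℤ)]) : ¬ (3 : ℤ) ∣ m * T.E + n := by
  intro h3
  have hl3 : (3 : ℤ) ∣ lam := by rcases hNl with ⟨-, h⟩ | ⟨-, h⟩ <;> rw [h] <;> norm_num
  have hE3 : (3 : ℤ) ∣ m * T.E - n := hl3.trans hE.dvd
  have hmE : (3 : ℤ) ∣ m * T.E := by omega
  have hn : (3 : ℤ) ∣ n := by omega
  have hcop : IsCoprime T.E 3 := T.coprime.of_isCoprime_of_dvd_right hl3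
  have hm : (3 : ℤ) ∣ m := hcop.symm.dvd_of_dvd_mul_right hmE
  have h9 : (9 : ℤ) ∣ m * n := by
    have := mul_dvd_mul hm hn
    norm_num at this
    exact this
  have hM : (T.modulus : ℤ) = 9 ∨ (T.modulus : ℤ) = 36 := by
    rcases hNl with ⟨h, h'⟩ | ⟨h, h'⟩ <;> simp [modulus, h, h']
  rcases hM with hM | hM <;> rw [hM] at hi hmn <;> omega

/-- If `v = (m, n, l)` has negative discriminant and satisfies the multiplier condition, then the
proper multiples of `v` do not contribute to the divisor of `v`. The discriminant of `k v` is at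
least `-1` only for `k = 3` and discriminant `-1/9` of `v`; the hypothesis `hsp` says that this
happens for `(N, λ)` equal to `(3, 3)` or `(6, 6)` only, and then `3 v` belongs to an untwisted
sector without states of discriminant `-1`. -/
theorem liftExp_mul_eq_zero (T : TwistedTwiningGenera π lam) (hM : 0 < T.modulus) {m n : ℕ}
    {t i : ℤ} (hi4 : 4 * i < T.modulus)
    (hmn : (m : ℤ) * n = i + T.modulus * (t * (t + 1)))
    (hsp : 2 * (T.modulus : ℤ) ≤ 9 * i →
      9 * i = 2 * (T.modulus : ℤ) ∧ (π.order = 3 ∧ lam = 3 ∨ π.order = 6 ∧ lam = 6))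
    (hE : (n : ℤ) ≡ m * T.E [ZMOD (lam : ℤ)]) {k : ℕ} (hk : 2 ≤ k) :
    T.liftExp (k * m, k * n, k * (2 * t + 1)) = 0 := by
  by_contra hne
  simp only [liftExp] at hne
  have hMQ : (0 : ℚ) < T.modulus := by exact_mod_cast hM
  have hmnQ : (m : ℚ) * n = i + T.modulus * (t * (t + 1)) := by exact_mod_cast hmn
  have hdisc : 4 * ((((k * m : ℕ) : ℚ) * ((k * n : ℕ) : ℚ)) / T.modulus) -
      (((k * (2 * t + 1) : ℤ)) : ℚ) ^ 2 = k ^ 2 * (4 * i - T.modulus) / T.modulus := by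
    push_cast
    rw [show (k * m : ℚ) * (k * n) = k ^ 2 * (m * n) by ring, hmnQ]
    field_simp
    ring
  have hi4Q : (4 * i - T.modulus : ℚ) < 0 := by
    have : (4 * i : ℚ) < T.modulus := by exact_mod_cast hi4
    linarith
  have hkQ : (0 : ℚ) < k := by exact_mod_cast (by omega : 0 < k)
  have hneg : (k : ℚ) ^ 2 * (4 * i - T.modulus) / T.modulus < 0 :=
    div_neg_of_neg_of_pos (mul_neg_of_pos_of_neg (by positivity) hi4Q) hMQ
  have hodd := T.odd_of_discr_neg hM hne (by rw [hdisc]; exact hneg)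
  have hkodd : Odd k := by
    have := (Int.odd_mul.mp hodd).1
    exact_mod_cast this
  have hk3 : 3 ≤ k := by
    rcases hkodd with ⟨j, rfl⟩; omega
  have h1 := T.neg_one_le_discr hM hne
  rw [hdisc, le_div_iff₀ hMQ] at h1
  have h1' : -(T.modulus : ℤ) ≤ k ^ 2 * (4 * i - T.modulus) := by
    have : -(T.modulus : ℚ) ≤ k ^ 2 * (4 * i - T.modulus) := by linarith
    exact_mod_cast this
  have hk9 : (9 : ℤ) ≤ (k : ℤ) ^ 2 := by
    have : (3 : ℤ) ≤ k := by exact_mod_cast hk3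
    nlinarith
  obtain ⟨hi, hNl⟩ := hsp (by nlinarith)
  have hk3' : k = 3 := by
    by_contra hk3'
    have : (4 : ℤ) ≤ k := by exact_mod_cast (by omega : 4 ≤ k)
    nlinarith
  subst hk3'
  have h3 := T.not_three_dvd_of_special hNl hi hmn hE
  have hN3 : ∃ k' : ℤ, 3 * (m : ℤ) = k' * π.order := by
    rcases hNl with ⟨h, h'⟩ | ⟨h, h'⟩
    · exact ⟨m, by rw [h]; push_cast; ring⟩
    · have hM36 : (T.modulus : ℤ) = 36 := by simp [modulus, h, h']
      have hm2 : (2 : ℤ) ∣ m := by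
        by_contra hm2
        have hme : Even ((m : ℤ) * n) := by
          rw [hmn, hM36]
          exact ⟨4 + 18 * (t * (t + 1)), by omega⟩
        have hmo : Odd (m : ℤ) := by
          rw [← Int.not_even_iff_odd, even_iff_two_dvd]; exact hm2
        have hne' : Even (n : ℤ) := by
          rcases Int.even_mul.mp hme with h | h
          · exact absurd h (Int.not_even_iff_odd.mpr hmo)
          · exact h
        have h6 : (6 : ℤ) ∣ m * T.E - n := by
          have h6' : (6 : ℤ) ∣ (lam : ℤ) := by rw [h']; norm_num
          exact h6'.trans hE.dvd
        have hEo : Odd T.E := by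
          have := T.coprime.of_isCoprime_of_dvd_right
            (show (2 : ℤ) ∣ (lam : ℤ) by rw [h']; norm_num)
          rw [← Int.not_even_iff_odd, even_iff_two_dvd]
          intro h2
          have := this.isUnit_of_dvd' h2 dvd_rfl
          norm_num [Int.isUnit_iff] at this
        have : Even ((m : ℤ) * T.E) := by
          have h2 : (2 : ℤ) ∣ m * T.E - n := (by norm_num : (2 : ℤ) ∣ 6).trans h6
          rw [even_iff_two_dvd] at hne' ⊢
          omega
        exact absurd this (Int.not_even_iff_odd.mpr (hmo.mul hEo))
      obtain ⟨j, hj⟩ := hm2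
      exact ⟨j, by rw [h, hj]; push_cast; ring⟩
  obtain ⟨k', hk'⟩ := hN3
  apply hne
  rw [T.chat_eq_of_discr_eq hM _ _ (n' := 0) (l' := 1)]
  · have e : ((3 * m : ℕ) : ℤ) = k' * π.order := by push_cast; exact hk'
    rw [e, T.chat_shift hM]
    apply T.chat_zero_eq_zero hM
    rw [show ((3 * n : ℕ) : ℤ) + k' * (T.E * π.order) = 3 * (m * T.E + n) by
      push_cast; linear_combination (-T.E) * hk']
    intro hd
    have hM : (T.modulus : ℤ) = 9 ∨ (T.modulus : ℤ) = 36 := by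
      rcases hNl with ⟨h, h'⟩ | ⟨h, h'⟩ <;> simp [modulus, h, h']
    rcases hM with hM | hM <;> rw [hM] at hd <;> omega
  · rw [Int.modEq_iff_dvd]
    push_cast
    exact ⟨-(3 * t + 1), by ring⟩
  · rw [hdisc]
    have hiQ : (9 * i : ℚ) = 2 * T.modulus := by exact_mod_cast hi
    field_simp
    push_cast
    linear_combination 4 * hiQ

/-- A coefficient of negative discriminant labelling a divisor of the lift is non-positive: a
positive one would produce a pole at a generic point of a wall which is not physical. The wall
determines a rational `s` with `s ^ 2` times the discriminant equal to `-1`. As the discriminant lies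
in `(1 / M) ℤ`, the numerator of `s` is `± 1`, which forces `N ∣ m`, or `± 3`, with discriminant
`-1/9`. Only for `N = 9` is the second case not excluded by divisibility. -/
theorem liftExp_nonpos (hπ : (π, lam) ∈ k3FrameShapes) (T : TwistedTwiningGenera π lam)
    (hC : T.StandardContourAssumption) {m n : ℕ} {l : ℤ} (hm : 0 < m)
    (hN : ¬ (π.order : ℤ) ∣ m) (hD : 4 * ((m : ℚ) * n / T.modulus) - (l : ℚ) ^ 2 < 0)
    (hgen : ¬ (π.order = 9 ∧ 4 * ((m : ℚ) * n / T.modulus) - (l : ℚ) ^ 2 = -1 / 9)) :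
    T.liftExp (m, n, l) ≤ 0 := by
  by_contra! hpos
  obtain ⟨hM, hsq, hspec⟩ := modulus_facts hπ
  change 0 < T.modulus at hM
  have hMeq : π.order * lam = T.modulus := rfl
  rw [hMeq] at hsq hspec
  have hMQ : (0 : ℚ) < T.modulus := by exact_mod_cast hM
  have hMZ : (0 : ℤ) < T.modulus := by exact_mod_cast hM
  have hne : T.chat m n ((m : ℚ) * n / T.modulus) l ≠ 0 := hpos.ne'
  obtain ⟨t, rfl⟩ := T.odd_of_discr_neg hM hne hD
  obtain ⟨i, hi⟩ : ∃ i : ℤ, (m : ℤ) * n = i + T.modulus * (t * (t + 1)) :=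
    ⟨m * n - T.modulus * (t * (t + 1)), by ring⟩
  have hiQ : (m : ℚ) * n = i + T.modulus * (t * (t + 1)) := by exact_mod_cast hi
  have hdisc : 4 * ((m : ℚ) * n / T.modulus) - ((2 * t + 1 : ℤ) : ℚ) ^ 2 =
      (4 * i - T.modulus) / T.modulus := by
    rw [hiQ]; push_cast; field_simp; ring
  have hi4 : 4 * i < T.modulus := by
    rw [hdisc, div_lt_iff₀ hMQ] at hD
    have : (4 * i : ℚ) < T.modulus := by linarith
    exact_mod_cast this
  have hi0 : 0 ≤ i := by
    have h := T.neg_one_le_discr hM hne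
    rw [hdisc, le_div_iff₀ hMQ] at h
    have : (0 : ℚ) ≤ i := by linarith
    exact_mod_cast this
  have hsp : 2 * (T.modulus : ℤ) ≤ 9 * i →
      9 * i = 2 * (T.modulus : ℤ) ∧ (π.order = 3 ∧ lam = 3 ∨ π.order = 6 ∧ lam = 6) := by
    intro h
    obtain ⟨i', rfl⟩ := Int.eq_ofNat_of_zero_le hi0
    obtain ⟨h1, h2⟩ := hspec i' (by exact_mod_cast h) (by exact_mod_cast hi4)
    have h1' : 9 * (i' : ℤ) = 2 * (T.modulus : ℤ) := by exact_mod_cast h1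
    refine ⟨h1', h2.resolve_left fun h9 => hgen ⟨h9.1, ?_⟩⟩
    rw [hdisc]
    have : (9 * i' : ℚ) = 2 * T.modulus := by exact_mod_cast h1
    field_simp
    push_cast
    linear_combination 4 * this
  have hE : (n : ℤ) ≡ m * T.E [ZMOD (lam : ℤ)] := by
    by_contra h
    exact hne (T.chat_eq_zero_of_not_modEq hM h _ _)
  obtain ⟨a, b, c, d, s, -, hdet, hdvd, ⟨w, hw⟩, hac, hbd, hl⟩ :=
    T.exists_wall_of_liftExp_pos hM hC hm hD hpos fun k hk =>
      T.liftExp_mul_eq_zero hM hi4 hi hsp hE hk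
  -- The wall vector has discriminant `-1`, and it is `s` times the vector `(m, n / M, l)`.
  have hs2 : s ^ 2 * (T.modulus - 4 * i) = T.modulus := by
    have h1 : s ^ 2 * (4 * ((m : ℚ) * n / T.modulus) - ((2 * t + 1 : ℤ) : ℚ) ^ 2) = -1 := by
      linear_combination (- 4 * s * (n / T.modulus)) * hac - 4 * a * c * hbd +
        (a * d + b * c + s * ((2 * t + 1 : ℤ) : ℚ)) * hl - (a * d - b * c + 1) * hdet
    rw [hdisc] at h1
    field_simp at h1
    linarith
  have hq0 : (s.den : ℚ) ≠ 0 := by exact_mod_cast s.den_nz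
  have hsnd : s * s.den = s.num := Rat.mul_den_eq_num s
  have hpq : s.num ^ 2 * (T.modulus - 4 * i) = T.modulus * (s.den : ℤ) ^ 2 := by
    have : (s.num : ℚ) ^ 2 * (T.modulus - 4 * i) = T.modulus * (s.den : ℚ) ^ 2 := by
      rw [← hsnd]; linear_combination (s.den : ℚ) ^ 2 * hs2
    exact_mod_cast this
  have hpl : s.num * (2 * t + 1) = (1 + 2 * (b * c)) * s.den := by
    have : (s.num : ℚ) * ((2 * t + 1 : ℤ) : ℚ) = (1 + 2 * (b * c)) * s.den := by
      rw [← hsnd]; linear_combination (-(s.den : ℚ)) * hl + s.den * hdet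
    exact_mod_cast this
  have hcop : IsCoprime s.num (s.den : ℤ) := by
    rw [Int.isCoprime_iff_gcd_eq_one]
    simpa [Int.gcd] using s.reduced
  have hdvdM : s.num ^ 2 ∣ (T.modulus : ℤ) :=
    (hcop.pow (m := 2) (n := 2)).dvd_of_dvd_mul_right ⟨_, hpq.symm⟩
  have hnotboth : ¬ (Even s.num ∧ Even (s.den : ℤ)) := by
    rintro ⟨h1, h2⟩
    have := hcop.isUnit_of_dvd' (even_iff_two_dvd.mp h1) (even_iff_two_dvd.mp h2)
    norm_num [Int.isUnit_iff] at this
  have hpodd : Odd s.num := by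
    rw [← Int.not_even_iff_odd]
    intro h
    have h2 : Even ((1 + 2 * (b * c)) * (s.den : ℤ)) := hpl ▸ h.mul_right _
    rcases Int.even_mul.mp h2 with h2 | h2
    · exact absurd h2 (Int.not_even_iff_odd.mpr ⟨b * c, by ring⟩)
    · exact hnotboth ⟨h, h2⟩
  have hqodd : Odd (s.den : ℤ) := by
    rw [← Int.not_even_iff_odd]
    intro h
    have h2 : Even (s.num * (2 * t + 1)) := hpl ▸ h.mul_left _
    rcases Int.even_mul.mp h2 with h2 | h2
    · exact hnotboth ⟨h2, h⟩
    · exact absurd h2 (Int.not_even_iff_odd.mpr ⟨t, rfl⟩)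
  have hqpos : (0 : ℤ) < s.den := by exact_mod_cast s.den_pos
  rcases hsq s.num.natAbs (Int.natAbs_odd.mpr hpodd)
    (by rw [← Int.natCast_dvd_natCast]; simpa using hdvdM) with h1 | ⟨h3, -⟩
  · have hp2 : s.num ^ 2 = 1 := by rw [← Int.natAbs_sq, h1]; rfl
    rw [hp2] at hpq
    have hq1 : (s.den : ℤ) = 1 := by
      by_contra hq1
      have h4 : (2 : ℤ) ^ 2 ≤ (s.den : ℤ) ^ 2 := pow_le_pow_left₀ (by norm_num) (by omega) 2
      nlinarith [mul_le_mul_of_nonneg_left h4 hMZ.le]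
    have hsint : s = s.num := by
      have : (s.den : ℚ) = 1 := by exact_mod_cast hq1
      rw [← hsnd, this, mul_one]
    have hacZ : a * c = s.num * m := by
      rw [hsint] at hac; exact_mod_cast hac
    apply hN
    have : (m : ℤ) = s.num * (a * c) := by rw [hacZ]; linear_combination (-(m : ℤ)) * hp2
    rw [this]
    exact hdvd.mul_left _
  · have hp2 : s.num ^ 2 = 9 := by rw [← Int.natAbs_sq, h3]; rfl
    rw [hp2] at hpq
    have hq3 : (s.den : ℤ) ≤ 3 := by
      by_contra hq1
      have h4 : (4 : ℤ) ^ 2 ≤ (s.den : ℤ) ^ 2 := pow_le_pow_left₀ (by norm_num) (by omega) 2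
      nlinarith [mul_le_mul_of_nonneg_left h4 hMZ.le]
    have hq1 : (s.den : ℤ) = 1 := by
      have hcases : (s.den : ℤ) = 1 ∨ (s.den : ℤ) = 3 := by
        obtain ⟨j, hj⟩ := hqodd; omega
      refine hcases.resolve_right fun hq => ?_
      rw [hq] at hcop
      have h3' : (3 : ℤ) ∣ s.num := by
        rw [← Int.dvd_natAbs, h3]; norm_num
      have := hcop.isUnit_of_dvd' h3' dvd_rfl
      norm_num [Int.isUnit_iff] at this
    rw [hq1] at hpq
    obtain ⟨hi9, hNl⟩ := hsp (by linarith)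
    apply T.not_three_dvd_of_special hNl hi9 hi hE
    have hsint : s = s.num := by
      have : (s.den : ℚ) = 1 := by exact_mod_cast hq1
      rw [← hsnd, this, mul_one]
    have hwZ : s.num * (m * T.E + n) = T.modulus * w := by
      rw [hac, hbd, hsint] at hw
      field_simp at hw
      have : (s.num : ℚ) * (m * T.E + n) = T.modulus * w := by linarith
      exact_mod_cast this
    have h9 : (9 : ℤ) ∣ T.modulus := by
      rw [← hp2]; exact hdvdM
    obtain ⟨j, hj⟩ := h9
    rw [hj] at hwZ
    have : s.num = 3 ∨ s.num = -3 := by omega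
    rcases this with h | h <;> rw [h] at hwZ
    · exact ⟨j * w, by linarith⟩
    · exact ⟨-(j * w), by linarith⟩

/-- Every coefficient labelling a divisor, with `N ∤ j`, is equal to one occurring as an exponent
in the product. -/
theorem exists_liftExp_eq (T : TwistedTwiningGenera π lam) (hM : 0 < T.modulus) {j k : ℤ} {n : ℚ}
    {l : ℤ} (hj : ¬ (π.order : ℤ) ∣ j) (h : T.OccursInLift j k n l) :
    ∃ (m n' : ℕ) (l' : ℤ), 0 < m ∧ ¬ (π.order : ℤ) ∣ m ∧
      4 * ((m : ℚ) * n' / T.modulus) - (l' : ℚ) ^ 2 = 4 * n - (l : ℚ) ^ 2 ∧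
      T.liftExp (m, n', l') = T.chat j k n l := by
  have hMQ : (T.modulus : ℚ) ≠ 0 := by exact_mod_cast hM.ne'
  have hMZ : (0 : ℤ) < T.modulus := by exact_mod_cast hM
  have hNM : (π.order : ℤ) ∣ T.modulus := ⟨lam, by simp [modulus]⟩
  -- after a change of sign the first index is positive
  obtain ⟨m, n', l', hm, hN, hD, hc⟩ : ∃ m n' l' : ℤ, 0 < m ∧ ¬ (π.order : ℤ) ∣ m ∧
      4 * ((m : ℚ) * n' / T.modulus) - (l' : ℚ) ^ 2 = 4 * n - (l : ℚ) ^ 2 ∧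
      T.chat m n' ((m : ℚ) * n' / T.modulus) l' = T.chat j k n l := by
    obtain ⟨m, n', l', hmj, hnk, hl, hD⟩ := h
    have hNm : ¬ (π.order : ℤ) ∣ m := by
      intro hd
      exact hj (by simpa using (hNM.trans hmj.dvd).add hd)
    have hc : T.chat m n' ((m : ℚ) * n' / T.modulus) l' = T.chat j k n l := by
      rw [T.chat_congr hM hmj hnk]
      exact T.chat_eq_of_discr_eq hM _ _ hl hD
    rcases lt_trichotomy m 0 with hm | hm | hm
    · refine ⟨-m, -n', -l', by omega, by simpa using hNm, ?_, ?_⟩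
      · rw [← hD]; push_cast; ring
      · rw [T.chat_neg hM, neg_neg, ← hc]
        congr 1; push_cast; ring
    · exact absurd (hm ▸ dvd_zero _) hNm
    · exact ⟨m, n', l', hm, hNm, hD, hc⟩
  -- a large spectral flow makes the second index positive
  set a : ℤ := |l'| + |n'| with ha
  have hn'' : 0 ≤ n' + T.modulus * (a * l' + a ^ 2 * m) := by
    have h1 : |n'| ≤ a * l' + a ^ 2 * m := by
      have h2 := neg_abs_le l'
      have h3 := abs_nonneg l'
      have h4 := abs_nonneg n'
      rcases h4.eq_or_lt with h5 | h5
      · rw [← h5]; rw [← h5, add_zero] at ha; rw [ha]; nlinarith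
      · have h6 : 1 ≤ |n'| := h5
        nlinarith
    have h2 := neg_abs_le n'
    have h3 := abs_nonneg n'
    nlinarith
  obtain ⟨n'', hn⟩ := Int.eq_ofNat_of_zero_le hn''
  obtain ⟨m', rfl⟩ := Int.eq_ofNat_of_zero_le hm.le
  have hnQ : (n'' : ℚ) = n' + T.modulus * (a * l' + a ^ 2 * m') := by exact_mod_cast hn.symm
  have hval : 4 * ((m' : ℚ) * n'' / T.modulus) - ((l' + 2 * a * m' : ℤ) : ℚ) ^ 2 =
      4 * (((m' : ℤ) : ℚ) * n' / T.modulus) - (l' : ℚ) ^ 2 := by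
    rw [hnQ]; push_cast; field_simp; ring
  refine ⟨m', n'', l' + 2 * a * m', by exact_mod_cast hm, hN, hval.trans hD, ?_⟩
  rw [← hc]
  simp only [liftExp]
  rw [T.chat_congr hM (Int.ModEq.refl _) (s' := n')]
  · refine T.chat_eq_of_discr_eq hM _ _ ?_ hval
    rw [Int.modEq_iff_dvd]; exact ⟨-(a * m'), by ring⟩
  · rw [Int.modEq_iff_dvd]; exact ⟨-(a * l' + a ^ 2 * m'), by rw [← hn]; ring⟩

end TwistedTwiningGenera

/-! ### Functions with a `q`-expansion -/

/-- `g` is given by the power series `∑ b k q ^ (k / h)`, where `q = exp(2 π i τ)`. -/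
def HasQExp (h : ℕ) (g : ℍ → ℂ) (b : ℕ → ℂ) : Prop :=
  ∀ τ : ℍ, HasSum (fun k : ℕ => b k * expTwoPiI ((k : ℂ) * τ / h)) (g τ)

namespace HasQExp

variable {h : ℕ} {g g' : ℍ → ℂ} {b b' : ℕ → ℂ}

theorem add (hg : HasQExp h g b) (hg' : HasQExp h g' b') : HasQExp h (g + g') (b + b') :=
  fun τ => ((hg τ).add (hg' τ)).congr_terms fun k => by simp [add_mul]

theorem sub (hg : HasQExp h g b) (hg' : HasQExp h g' b') : HasQExp h (g - g') (b - b') :=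
  fun τ => ((hg τ).sub (hg' τ)).congr_terms fun k => by simp [sub_mul]

theorem smul (hg : HasQExp h g b) (c : ℂ) : HasQExp h (c • g) (c • b) :=
  fun τ => ((hg τ).mul_left c).congr_terms fun k => by simp [mul_assoc]

theorem sum {ι : Type*} (s : Finset ι) {g : ι → ℍ → ℂ} {b : ι → ℕ → ℂ}
    (hg : ∀ i ∈ s, HasQExp h (g i) (b i)) : HasQExp h (∑ i ∈ s, g i) (∑ i ∈ s, b i) := by
  intro τ
  simp only [Finset.sum_apply, Finset.sum_mul]
  exact hasSum_sum fun i hi => hg i hi τ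

theorem const (c : ℂ) : HasQExp h (fun _ => c) (fun k => if k = 0 then c else 0) := by
  intro τ
  convert hasSum_ite_eq (0 : ℕ) c using 2 with k
  by_cases hk : k = 0 <;> simp [hk]

/-- The coefficients are determined by the function. -/
theorem coeff_unique (hh : 0 < h) (hg : HasQExp h g b) (hg' : HasQExp h g b') : b = b' := by
  have hh' : (h : ℂ) ≠ 0 := by exact_mod_cast hh.ne'
  funext k
  have key : ∀ b : ℕ → ℂ, HasQExp h g b → b k * expTwoPiI ((k : ℂ) * Complex.I / h) =
      ∫ x in (0 : ℝ)..1, g ⟨h * x + Complex.I, by simp⟩ * expTwoPiI (-(((k : ℕ) : ℤ) * x)) := by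
    intro b hg
    have := hasSum_fourier_integral (fun j : ℕ => (j : ℤ))
      (fun j => b j * expTwoPiI ((j : ℂ) * Complex.I / h))
      (fun x : ℝ => g ⟨h * x + Complex.I, by simp⟩) (fun x => ?_) k
    · refine (hasSum_single k fun j hj => ?_).unique this |>.symm ▸ ?_
      · simp [hj]
      · simp
    · refine (hg _).congr_terms fun j => ?_
      rw [mul_assoc, ← expTwoPiI_add]
      congr 2
      push_cast
      field_simp
      ring
  exact mul_right_cancel₀ (expTwoPiI_ne_zero _) ((key b hg).trans (key b' hg').symm)

theorem summable_norm (hg : HasQExp h g b) {y : ℝ} (hy : 0 < y) :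
    Summable fun k : ℕ => ‖b k‖ * Real.exp (-(2 * Real.pi * (k * y / h))) := by
  have := (hg ⟨y * Complex.I, by simpa using hy⟩).summable.norm
  refine this.congr fun k => ?_
  have e : ((k : ℂ) * (y * Complex.I) / h).im = k * y / h := by
    have : (k : ℂ) * (y * Complex.I) / h = ((k * y / h : ℝ) : ℂ) * Complex.I := by push_cast; ring
    rw [this]; simp
  rw [norm_mul, norm_expTwoPiI, e]

theorem mdifferentiable (hg : HasQExp h g b) : MDiff g := by
  rw [UpperHalfPlane.mdifferentiable_iff]
  intro w hw
  have hw' : 0 < w.im / 2 := by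
    have : 0 < w.im := hw
    positivity
  have hsub : {z : ℂ | w.im / 2 < z.im} ⊆ {z : ℂ | 0 < z.im} := fun z hz => hw'.trans hz
  have hopen : IsOpen {z : ℂ | w.im / 2 < z.im} := isOpen_lt continuous_const Complex.continuous_im
  have hd := Complex.differentiableOn_tsum_of_summable_norm (hg.summable_norm hw')
    (F := fun (k : ℕ) (z : ℂ) => b k * expTwoPiI ((k : ℂ) * z / h)) (U := {z : ℂ | w.im / 2 < z.im})
    (fun k => by
      refine (Differentiable.const_mul ?_ _).differentiableOn
      exact differentiable_expTwoPiI.comp (by fun_prop)) hopen ?_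
  · have heq : Set.EqOn (g ∘ UpperHalfPlane.ofComplex)
        (fun z => ∑' k : ℕ, b k * expTwoPiI ((k : ℂ) * z / h)) {z : ℂ | w.im / 2 < z.im} := by
      intro z hz
      have hz' : 0 < z.im := hsub hz
      simp only [Function.comp_apply]
      rw [← (hg _).tsum_eq, UpperHalfPlane.ofComplex_apply_of_im_pos hz']
    refine ((hd.congr heq).differentiableAt (hopen.mem_nhds ?_)).differentiableWithinAt
    have : 0 < w.im := hw
    change w.im / 2 < w.im
    linarith
  · intro k z hz
    have e : ((k : ℂ) * z / h).im = k * z.im / h := by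
      have : (k : ℂ) * z / h = ((k / h : ℝ) : ℂ) * z := by push_cast; ring
      rw [this, Complex.im_ofReal_mul]; ring
    rw [norm_mul, norm_expTwoPiI, e]
    refine mul_le_mul_of_nonneg_left (Real.exp_le_exp.mpr ?_) (norm_nonneg _)
    have hz : w.im / 2 < z.im := hz
    gcongr

/-- A function whose expansion starts at `q ^ (m / h)` decays like `q ^ (m / h)`. -/
theorem isBigO (hg : HasQExp h g b) {m : ℕ} (hb : ∀ k < m, b k = 0) :
    g =O[UpperHalfPlane.atImInfty] fun τ : ℍ => Real.exp (-(2 * Real.pi * (m * τ.im / h))) := by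
  have hs := hg.summable_norm one_pos
  refine Asymptotics.IsBigO.of_bound
    ((∑' k : ℕ, ‖b k‖ * Real.exp (-(2 * Real.pi * (k * 1 / h)))) *
      Real.exp (2 * Real.pi * (m / h))) ?_
  filter_upwards [Filter.preimage_mem_comap (Filter.Ici_mem_atTop (1 : ℝ))] with τ hτ
  have hτ : 1 ≤ τ.im := hτ
  rw [← (hg τ).tsum_eq, Real.norm_of_nonneg (Real.exp_pos _).le, mul_assoc, ← tsum_mul_right]
  refine tsum_of_norm_bounded (hs.mul_right _).hasSum fun k => ?_
  rcases lt_or_ge k m with hk | hk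
  · simp [hb k hk]
  have e : ((k : ℂ) * τ / h).im = k * τ.im / h := by
    have : (k : ℂ) * τ / h = ((k / h : ℝ) : ℂ) * τ := by push_cast; ring
    rw [this, Complex.im_ofReal_mul, UpperHalfPlane.coe_im]; ring
  rw [norm_mul, norm_expTwoPiI, e, mul_assoc ‖b k‖]
  simp only [← Real.exp_add]
  refine mul_le_mul_of_nonneg_left (Real.exp_le_exp.mpr ?_) (norm_nonneg _)
  have hk' : (m : ℝ) / h ≤ k / h := by gcongr
  have := mul_nonneg (mul_nonneg Real.two_pi_pos.le (sub_nonneg.mpr hk')) (sub_nonneg.mpr hτ)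
  have e1 : (k : ℝ) * τ.im / h = k / h * τ.im := by ring
  have e2 : (m : ℝ) * τ.im / h = m / h * τ.im := by ring
  rw [e1, e2, mul_one]
  nlinarith

theorem isBoundedAtImInfty (hg : HasQExp h g b) : UpperHalfPlane.IsBoundedAtImInfty g := by
  exact (hg.isBigO (m := 0) (by simp)).congr_right fun τ => by simp

theorem tendsto (hh : 0 < h) (hg : HasQExp h g b) :
    Filter.Tendsto g UpperHalfPlane.atImInfty (𝓝 (b 0)) := by
  have h1 := (hg.sub (HasQExp.const (b 0))).isBigO (m := 1)
    (fun k hk => by simp [Nat.lt_one_iff.mp hk])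
  have h2 : Filter.Tendsto (fun τ : ℍ => Real.exp (-(2 * Real.pi * ((1 : ℕ) * τ.im / h))))
      UpperHalfPlane.atImInfty (𝓝 0) := by
    refine Real.tendsto_exp_neg_atTop_nhds_zero.comp ?_
    have e : ∀ τ : ℍ, 2 * Real.pi * ((1 : ℕ) * τ.im / h) = (2 * Real.pi / h) * τ.im := by
      intro τ; push_cast; ring
    simp only [e]
    refine Filter.Tendsto.const_mul_atTop ?_ Filter.tendsto_comap
    have : (0 : ℝ) < h := by exact_mod_cast hh
    positivity
  have h3 := h1.trans_tendsto h2
  simpa using h3.add_const (b 0)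

end HasQExp

/-! ### Vector-valued modular forms for the full modular group -/

/-- Invariance and boundedness at `i∞` make a holomorphic function a modular form of level one. -/
noncomputable def levelOneForm (k : ℤ) (f : ℍ → ℂ) (hf : MDiff f)
    (hbd : UpperHalfPlane.IsBoundedAtImInfty f) (hinv : ∀ γ : SL(2, ℤ), f ∣[k] γ = f) :
    ModularForm 𝒮ℒ k where
  toFun := f
  slash_action_eq' := by
    rintro _ ⟨γ, rfl⟩
    exact hinv γ
  holo' := hf
  bdd_at_cusps' hc := by
    rw [OnePoint.isBoundedAt_iff_forall_SL2Z hc]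
    intro γ _
    rw [hinv γ]
    exact hbd

theorem eq_zero_of_levelOne_weight_two {f : ℍ → ℂ} (hf : MDiff f)
    (hbd : UpperHalfPlane.IsBoundedAtImInfty f) (hinv : ∀ γ : SL(2, ℤ), f ∣[(2 : ℤ)] γ = f) :
    f = 0 := by
  have h := rank_zero_iff_forall_zero.mp ModularForm.levelOne_weight_two_rank_zero
    (levelOneForm 2 f hf hbd hinv)
  funext τ
  exact congrArg (fun F : ModularForm 𝒮ℒ 2 => F τ) h

theorem eq_zero_of_levelOne_weight_zero {f : ℍ → ℂ} (hf : MDiff f)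
    (hlim : Filter.Tendsto f atImInfty (𝓝 0)) (hinv : ∀ γ : SL(2, ℤ), f ∣[(0 : ℤ)] γ = f) :
    f = 0 := by
  obtain ⟨c, hc⟩ := ModularFormClass.levelOne_weight_zero_const
    (levelOneForm 0 f hf (hlim.isBigO_one ℝ) hinv)
  have hc : f = Function.const _ c := hc
  have : Filter.Tendsto f atImInfty (𝓝 c) := by rw [hc]; exact tendsto_const_nhds
  rw [hc, tendsto_nhds_unique this hlim]
  rfl

/-- A system of functions permuted by the modular group in weight `k`. -/
def IsPermuted {I : Type*} (k : ℤ) (U : I → ℍ → ℂ) : Prop :=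
  ∀ γ : SL(2, ℤ), ∃ e : Equiv.Perm I, ∀ i, U i ∣[k] γ = U (e i)

/-- There are no modular forms of level one and weight two, so the constant terms of a permuted
system of weight two add up to zero. -/
theorem IsPermuted.sum_coeff_zero {I : Type*} [Fintype I] {h : ℕ} (hh : 0 < h) {U : I → ℍ → ℂ}
    (hU : IsPermuted 2 U) {b : I → ℕ → ℂ} (hb : ∀ i, HasQExp h (U i) (b i)) :
    ∑ i, b i 0 = 0 := by
  have hs := HasQExp.sum Finset.univ fun i _ => hb i
  have h0 : ∑ i, U i = 0 := by
    refine eq_zero_of_levelOne_weight_two hs.mdifferentiable hs.isBoundedAtImInfty fun γ => ?_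
    obtain ⟨e, he⟩ := hU γ
    rw [SlashAction.sum_slash, Finset.sum_congr rfl fun i _ => he i]
    exact Equiv.sum_comp e U
  have h1 := hs.tendsto hh
  rw [h0] at h1
  have := tendsto_nhds_unique h1 (tendsto_const_nhds (x := (0 : ℂ)))
  rwa [Finset.sum_apply] at this

/-- The valence argument: if the total order of vanishing at `i∞` of a permuted system of weight
`k` exceeds `k / 12` times the number of its members, then one of them vanishes. Indeed, the 12th
power of the product, divided by a suitable power of the discriminant, has weight zero and vanishes
at `i∞`. -/
theorem IsPermuted.exists_eq_zero {I : Type*} [Fintype I] {h : ℕ} (hh : 0 < h) {k : ℕ}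
    {U : I → ℍ → ℂ} (hU : IsPermuted k U) {b : I → ℕ → ℂ} (hb : ∀ i, HasQExp h (U i) (b i))
    (m : I → ℕ) (hm : ∀ i, ∀ j < m i, b i j = 0)
    (hlt : h * (k * Fintype.card I) < 12 * ∑ i, m i) : ∃ i, U i = 0 := by
  set K := k * Fintype.card I with hK
  set P : ℍ → ℂ := ∏ i, U i with hP
  have hPd : MDiff P := by
    rw [UpperHalfPlane.mdifferentiable_iff]
    have := DifferentiableOn.finsetProd (u := Finset.univ) (f := fun i z =>
      U i (UpperHalfPlane.ofComplex z)) (𝕜 := ℂ) (s := {z : ℂ | 0 < z.im}) fun i _ =>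
        UpperHalfPlane.mdifferentiable_iff.mp (hb i).mdifferentiable
    refine this.congr fun z _ => ?_
    simp [hP]
  have hPinv : ∀ γ : SL(2, ℤ), P ∣[(K : ℤ)] γ = P := by
    intro γ
    obtain ⟨e, he⟩ := hU γ
    have h1 := ModularForm.prod_slash (k := (k : ℤ)) (g := (γ : GL (Fin 2) ℝ)) (f := U)
      (s := Finset.univ)
    have h2 : (K : ℤ) = (k : ℤ) * (Finset.univ : Finset I).card := by
      rw [hK, Finset.card_univ]; push_cast; rfl
    rw [h2, ModularForm.SL_slash, hP, h1]
    have h3 : ∀ i ∈ Finset.univ, U i ∣[(k : ℤ)] (γ : GL (Fin 2) ℝ) = U (e i) := fun i _ => he i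
    rw [Finset.prod_congr rfl h3, Equiv.prod_comp e U]
    simp
  have hΔinv : ∀ γ : SL(2, ℤ), ModularForm.discriminant ∣[(12 : ℤ)] γ = ModularForm.discriminant :=
    SlashInvariantForm.slash_action_generators_SL2Z ModularForm.discriminant_S_invariant
      ModularForm.discriminant_T_invariant
  have hΔd : MDiff ModularForm.discriminant := CuspForm.discriminant.holo'
  have hPO : P =O[atImInfty] fun τ : ℍ =>
      Real.exp (-(2 * Real.pi * ((∑ i, m i : ℕ) * τ.im / h))) := by
    have h1 : (fun τ => ∏ i, U i τ) =O[atImInfty] fun τ : ℍ =>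
        ∏ i, Real.exp (-(2 * Real.pi * (m i * τ.im / h))) :=
      Asymptotics.IsBigO.finsetProd fun i _ => (hb i).isBigO (hm i)
    have e : (fun τ : ℍ => Real.exp (-(2 * Real.pi * ((∑ i, m i : ℕ) * τ.im / h)))) =
        fun τ : ℍ => ∏ i, Real.exp (-(2 * Real.pi * (m i * τ.im / h))) := by
      funext τ
      rw [← Real.exp_sum]
      congr 1
      push_cast
      rw [Finset.sum_neg_distrib, Finset.sum_mul, Finset.sum_div, Finset.mul_sum]
    rw [e]
    convert h1 using 2 with τ
    exact Finset.prod_apply _ _ _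
  have hQ : (fun τ => P τ ^ 12 / ModularForm.discriminant τ ^ K) = (0 : ℍ → ℂ) := by
    refine eq_zero_of_levelOne_weight_zero ?_ ?_ ?_
    · rw [UpperHalfPlane.mdifferentiable_iff] at hPd hΔd ⊢
      exact (hPd.pow 12).div (hΔd.pow K) fun z _ => pow_ne_zero _ (ModularForm.discriminant_ne_zero _)
    · have h1 : (fun τ : ℍ => P τ ^ 12 / ModularForm.discriminant τ ^ K) =O[atImInfty]
          fun τ : ℍ => Real.exp (-(2 * Real.pi * ((12 * (∑ i, m i : ℕ) / h - K : ℝ) * τ.im))) := by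
        have h2 : (fun τ : ℍ => (ModularForm.discriminant τ)⁻¹) =O[atImInfty]
            fun τ : ℍ => (Real.exp (-2 * Real.pi * τ.im))⁻¹ :=
          ModularForm.exp_isBigO_discriminant.inv_rev
            (Filter.Eventually.of_forall fun τ h0 => absurd h0 (Real.exp_ne_zero _))
        have h3 := (hPO.pow 12).mul (h2.pow K)
        refine (h3.congr_left fun τ => ?_).congr_right fun τ => ?_
        · rw [div_eq_mul_inv, inv_pow]
        · rw [← Real.exp_neg, ← Real.exp_nat_mul, ← Real.exp_nat_mul, ← Real.exp_add]
          congr 1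
          push_cast
          ring
      refine h1.trans_tendsto (Real.tendsto_exp_neg_atTop_nhds_zero.comp ?_)
      refine Filter.Tendsto.const_mul_atTop Real.two_pi_pos
        (Filter.Tendsto.const_mul_atTop ?_ Filter.tendsto_comap)
      have hh' : (0 : ℝ) < h := by exact_mod_cast hh
      rw [sub_pos, lt_div_iff₀ hh']
      have : ((h * K : ℕ) : ℝ) < ((12 * ∑ i, m i : ℕ) : ℝ) := by exact_mod_cast hlt
      push_cast at this ⊢
      linarith
    · intro γ
      funext τ
      have h1 := congrFun (hPinv γ) τ
      have h2 := congrFun (hΔinv γ) τ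
      rw [ModularForm.SL_slash_apply] at h1 h2 ⊢
      have hd := UpperHalfPlane.denom_ne_zero (γ : GL (Fin 2) ℝ) τ
      set D := UpperHalfPlane.denom (γ : GL (Fin 2) ℝ) τ
      rw [← h1, ← h2]
      have hΔ := ModularForm.discriminant_ne_zero (γ • τ)
      simp only [zpow_neg, zpow_natCast, neg_zero, zpow_zero, mul_one, mul_pow]
      rw [show (12 : ℤ) = ((12 : ℕ) : ℤ) by norm_num, zpow_natCast]
      field_simp
      ring_nf
      rw [mul_assoc, ← mul_pow, mul_inv_cancel₀ hd, one_pow, mul_one]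
  have hP0 : P = 0 := by
    funext τ
    have := congrFun hQ τ
    simpa [ModularForm.discriminant_ne_zero] using this
  obtain ⟨i, -, hi⟩ := (UpperHalfPlane.prod_eq_zero_iff
    (fun i (_ : i ∈ Finset.univ) => (hb i).mdifferentiable)).mp hP0
  exact ⟨i, hi⟩

/-! ### The Eisenstein series of weight two -/

/-- The completion `E₂ - 3 / (π Im τ)` of the Eisenstein series of weight two. It is not holomorphic,
but it is invariant in weight two. -/
noncomputable def E2star (τ : ℍ) : ℂ := EisensteinSeries.E2 τ - 3 / (Real.pi * (τ.im : ℂ))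

/-- The anomalous term of `E₂` is cancelled by that of `3 / (π Im τ)`. -/
theorem E2star_slash (γ : SL(2, ℤ)) : E2star ∣[(2 : ℤ)] γ = E2star := by
  funext τ
  have h := congrFun (EisensteinSeries.E2_slash_action γ) τ
  rw [ModularForm.SL_slash_apply] at h ⊢
  simp only [Pi.sub_apply, Pi.smul_apply, EisensteinSeries.D2, smul_eq_mul] at h
  have hD := UpperHalfPlane.denom_ne_zero (γ : GL (Fin 2) ℝ) τ
  have hτ : (τ.im : ℂ) ≠ 0 := by exact_mod_cast τ.im_ne_zero
  have hpi : (Real.pi : ℂ) ≠ 0 := by exact_mod_cast Real.pi_ne_zero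
  have him : ((γ • τ).im : ℂ) = τ.im / (Complex.normSq (UpperHalfPlane.denom γ τ) : ℂ) := by
    rw [ModularGroup.im_smul_eq_div_normSq]
    push_cast
    rfl
  have hconj : (starRingEnd ℂ) (UpperHalfPlane.denom γ τ) =
      UpperHalfPlane.denom γ τ - 2 * Complex.I * (γ 1 0) * τ.im := by
    simp only [ModularGroup.denom_apply, map_add, map_mul, map_intCast]
    have : (starRingEnd ℂ) (τ : ℂ) = τ - 2 * Complex.I * τ.im := by
      apply Complex.ext <;> simp
      ring
    rw [this]; ring
  rw [Complex.normSq_eq_conj_mul_self, hconj] at him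
  simp only [E2star]
  rw [sub_mul, h, him, riemannZeta_two]
  have hcD : UpperHalfPlane.denom γ τ - 2 * Complex.I * (γ 1 0) * τ.im ≠ 0 := by
    rw [← hconj]
    exact (map_ne_zero _).mpr hD
  set D := UpperHalfPlane.denom (γ : GL (Fin 2) ℝ) τ
  rw [show ((-2 : ℤ)) = -((2 : ℕ) : ℤ) by norm_num, zpow_neg, zpow_natCast]
  field_simp
  ring

/-- The upper triangular integral matrix with positive diagonal and rows `(a, b)` and `(0, d)`. -/
noncomputable def upperGL (a : ℕ+) (b : ℤ) (d : ℕ+) : GL (Fin 2) ℝ :=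
  Matrix.GeneralLinearGroup.mkOfDetNeZero !![(a : ℝ), (b : ℝ); 0, (d : ℝ)] (by
    rw [Matrix.det_fin_two_of]
    have := a.pos
    have := d.pos
    have : (0 : ℝ) < (a : ℕ) := by exact_mod_cast a.pos
    have : (0 : ℝ) < (d : ℕ) := by exact_mod_cast d.pos
    rw [mul_zero, sub_zero]
    positivity)

theorem det_upperGL_pos (a : ℕ+) (b : ℤ) (d : ℕ+) :
    0 < (upperGL a b d).det.val ∧ (upperGL a b d).det.val = (a : ℝ) * d := by
  have h : (upperGL a b d).det.val = (a : ℝ) * d := by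
    simp [upperGL, Matrix.GeneralLinearGroup.mkOfDetNeZero, Matrix.det_fin_two_of]
  have h1 : (0 : ℝ) < (a : ℕ) := by exact_mod_cast a.pos
  have h2 : (0 : ℝ) < (d : ℕ) := by exact_mod_cast d.pos
  exact ⟨by rw [h]; positivity, h⟩

theorem denom_upperGL (a : ℕ+) (b : ℤ) (d : ℕ+) (z : ℂ) :
    UpperHalfPlane.denom (upperGL a b d) z = d := by
  simp [UpperHalfPlane.denom, upperGL, Matrix.GeneralLinearGroup.mkOfDetNeZero]

theorem coe_upperGL_smul (a : ℕ+) (b : ℤ) (d : ℕ+) (τ : ℍ) :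
    ((upperGL a b d • τ : ℍ) : ℂ) = (a * τ + b) / d := by
  rw [UpperHalfPlane.coe_smul_of_det_pos (det_upperGL_pos a b d).1, denom_upperGL]
  simp [UpperHalfPlane.num, upperGL, Matrix.GeneralLinearGroup.mkOfDetNeZero]

/-- The non-holomorphic parts of the slashes of `E2star` by integral matrices all agree. -/
theorem E2star_slash_upperGL (a : ℕ+) (b : ℤ) (d : ℕ+) (τ : ℍ) :
    (E2star ∣[(2 : ℤ)] upperGL a b d) τ =
      (a : ℂ) / d * EisensteinSeries.E2 (upperGL a b d • τ) - 3 / (Real.pi * (τ.im : ℂ)) := by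
  obtain ⟨hpos, hdet⟩ := det_upperGL_pos a b d
  have h1 : (0 : ℝ) < (a : ℕ) := by exact_mod_cast a.pos
  have h2 : (0 : ℝ) < (d : ℕ) := by exact_mod_cast d.pos
  have him : (upperGL a b d • τ).im = a * τ.im / d := by
    rw [← UpperHalfPlane.coe_im, coe_upperGL_smul]
    have : ((a : ℂ) * τ + b) / d = ((a / d : ℝ) : ℂ) * τ + ((b / d : ℝ) : ℂ) := by
      push_cast; ring
    rw [this, Complex.add_im, Complex.im_ofReal_mul, Complex.ofReal_im, UpperHalfPlane.coe_im]
    ring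
  have hσ : UpperHalfPlane.σ (upperGL a b d) = ContinuousAlgEquiv.refl ℝ ℂ := by
    rw [UpperHalfPlane.σ, if_pos hpos]
  rw [ModularForm.slash_apply, hσ, denom_upperGL, hdet, abs_of_pos (mul_pos h1 h2), E2star, him]
  have ha : ((a : ℕ) : ℂ) ≠ 0 := by exact_mod_cast a.pos.ne'
  have hd : ((d : ℕ) : ℂ) ≠ 0 := by exact_mod_cast d.pos.ne'
  have hτ : (τ.im : ℂ) ≠ 0 := by exact_mod_cast τ.im_ne_zero
  have hpi : (Real.pi : ℂ) ≠ 0 := by exact_mod_cast Real.pi_ne_zero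
  rw [show ((-2 : ℤ)) = -((2 : ℕ) : ℤ) by norm_num, zpow_neg, zpow_natCast]
  simp only [show (2 - 1 : ℤ) = 1 by norm_num, zpow_one]
  rw [ContinuousAlgEquiv.refl_apply]
  push_cast
  field_simp

/-- The coefficients `1`, `-24 σ(n)` of `E₂`. -/
noncomputable def E2coeff (n : ℕ) : ℂ := if n = 0 then 1 else -24 * ArithmeticFunction.sigma 1 n

theorem hasQExp_E2 : HasQExp 1 EisensteinSeries.E2 E2coeff := by
  intro τ
  refine (EisensteinSeries.hasSum_qExpansion_E2 (z := τ)).congr_terms fun k => ?_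
  have : expTwoPiI ((k : ℂ) * τ / (1 : ℕ)) = Complex.exp (2 * Real.pi * Complex.I * τ) ^ k := by
    rw [← expTwoPiI_def, ← expTwoPiI_nsmul]; congr 1; push_cast; ring
  rw [this, E2coeff, smul_eq_mul]

/-- The coefficients of `(a / d) E₂((a τ + b) / d)` as a series in `q ^ (1 / h)`, for `d ∣ h a`: the
`n`-th coefficient of `E₂` contributes to `q ^ (k / h)` with `d k = h a n`. -/
noncomputable def E2coeffUpper (h : ℕ) (a : ℕ+) (b : ℤ) (d : ℕ+) (k : ℕ) : ℂ :=
  if h * a ∣ d * k then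
    (a : ℂ) / d * E2coeff (d * k / (h * a)) * expTwoPiI (((d * k / (h * a) : ℕ) : ℂ) * b / d)
  else 0

theorem hasQExp_E2_upperGL {h : ℕ} (hh : 0 < h) {a d : ℕ+} (b : ℤ) (hd : (d : ℕ) ∣ h * a) :
    HasQExp h (fun τ => (a : ℂ) / d * EisensteinSeries.E2 (upperGL a b d • τ))
      (E2coeffUpper h a b d) := by
  intro τ
  obtain ⟨r, hr⟩ := hd
  have hd0 : ((d : ℕ) : ℂ) ≠ 0 := by exact_mod_cast d.pos.ne'
  have hh0 : (h : ℂ) ≠ 0 := by exact_mod_cast hh.ne'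
  have hr0 : 0 < r := by
    rcases Nat.eq_zero_or_pos r with h0 | h0
    · rw [h0, mul_zero] at hr
      exact absurd hr (mul_pos hh a.pos).ne'
    · exact h0
  have hdvd : ∀ k : ℕ, h * a ∣ d * k ↔ r ∣ k := fun k => by
    rw [hr]; exact Nat.mul_dvd_mul_iff_left d.pos
  have hquot : ∀ k : ℕ, (d : ℕ) * k / (h * a) = k / r := fun k => by
    rw [hr, Nat.mul_div_mul_left _ _ d.pos]
  have hrC : (h : ℂ) * (a : ℕ) = (d : ℕ) * r := by exact_mod_cast hr
  have hinj : Function.Injective fun n : ℕ => r * n :=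
    fun x y hxy => Nat.eq_of_mul_eq_mul_left hr0 hxy
  have h1 := (hasQExp_E2 (upperGL a b d • τ)).mul_left ((a : ℂ) / d)
  refine (hinj.hasSum_iff fun k hk => ?_).mp (h1.congr_terms fun n => ?_)
  · rw [E2coeffUpper, if_neg, zero_mul]
    rw [hdvd]
    rintro ⟨n, rfl⟩
    exact hk ⟨n, rfl⟩
  · simp only [Function.comp_apply]
    rw [E2coeffUpper, if_pos ((hdvd _).mpr ⟨n, rfl⟩), hquot, Nat.mul_div_cancel_left _ hr0,
      coe_upperGL_smul]
    have : (n : ℂ) * (((a : ℕ) * τ + b) / (d : ℕ)) / (1 : ℕ) =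
        (n : ℂ) * b / (d : ℕ) + ((r * n : ℕ) : ℂ) * τ / h := by
      push_cast
      field_simp
      linear_combination (n : ℂ) * τ * hrC
    rw [this, expTwoPiI_add]
    ring

/-- The holomorphic difference of two slashes of `E2star`. -/
noncomputable def E2diff (g : GL (Fin 2) ℝ) : ℍ → ℂ := E2star ∣[(2 : ℤ)] g - E2star

theorem E2diff_slash (g : GL (Fin 2) ℝ) (γ : SL(2, ℤ)) :
    E2diff g ∣[(2 : ℤ)] γ = E2diff (g * Matrix.SpecialLinearGroup.mapGL ℝ γ) := by
  rw [E2diff, sub_eq_add_neg, SlashAction.add_slash, SlashAction.neg_slash, E2star_slash,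
    ModularForm.SL_slash, ← sub_eq_add_neg, E2diff, SlashAction.slash_mul]
  rfl

theorem E2diff_mul_left (γ : SL(2, ℤ)) (g : GL (Fin 2) ℝ) :
    E2diff (Matrix.SpecialLinearGroup.mapGL ℝ γ * g) = E2diff g := by
  rw [E2diff, SlashAction.slash_mul]
  have : E2star ∣[(2 : ℤ)] (Matrix.SpecialLinearGroup.mapGL ℝ γ) = E2star := E2star_slash γ
  rw [this, E2diff]

theorem hasQExp_E2diff {h : ℕ} (hh : 0 < h) {a d : ℕ+} (b : ℤ) (hd : (d : ℕ) ∣ h * a) :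
    HasQExp h (E2diff (upperGL a b d)) (E2coeffUpper h a b d - E2coeffUpper h 1 0 1) := by
  have h1 := (hasQExp_E2_upperGL hh b hd).sub (hasQExp_E2_upperGL hh (a := 1) (d := 1) 0 (by simp))
  convert h1 using 1
  funext τ
  have h2 : (upperGL 1 0 1 • τ : ℍ) = τ := by
    apply UpperHalfPlane.ext
    rw [coe_upperGL_smul]; simp
  simp only [E2diff, Pi.sub_apply, E2star_slash_upperGL, h2, E2star]
  simp

/-- Every integral matrix of positive determinant is the product of a unimodular matrix and an
upper triangular one. -/
theorem exists_upper (A : Matrix (Fin 2) (Fin 2) ℤ) (hdet : 0 < A.det) :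
    ∃ (γ : SL(2, ℤ)) (a d : ℕ+) (b : ℤ), (a : ℕ) = Int.gcd (A 0 0) (A 1 0) ∧
      (a : ℤ) * d = A.det ∧ A 0 1 = γ 0 0 * b + γ 0 1 * d ∧ A 1 1 = γ 1 0 * b + γ 1 1 * d ∧
      A 0 0 = γ 0 0 * a ∧ A 1 0 = γ 1 0 * a := by
  rw [Matrix.det_fin_two] at hdet ⊢
  set g := Int.gcd (A 0 0) (A 1 0) with hg
  have hg0 : 0 < g := by
    rw [hg, Int.gcd_pos_iff]
    by_contra! h
    rw [h.1, h.2] at hdet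
    simp at hdet
  obtain ⟨p, hp⟩ : (g : ℤ) ∣ A 0 0 := Int.gcd_dvd_left ..
  obtain ⟨r, hr⟩ : (g : ℤ) ∣ A 1 0 := Int.gcd_dvd_right ..
  set x := Int.gcdA (A 0 0) (A 1 0)
  set y := Int.gcdB (A 0 0) (A 1 0)
  have hbez : (g : ℤ) = A 0 0 * x + A 1 0 * y := Int.gcd_eq_gcd_ab _ _
  have hg0' : (g : ℤ) ≠ 0 := by exact_mod_cast hg0.ne'
  have hone : p * x + r * y = 1 := by
    apply mul_left_cancel₀ hg0'
    rw [hp, hr] at hbez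
    linarith
  have hd : 0 < p * A 1 1 - r * A 0 1 := by
    have : 0 < (g : ℤ) * (p * A 1 1 - r * A 0 1) := by rw [hp, hr] at hdet; linarith
    exact pos_of_mul_pos_right this (by positivity)
  obtain ⟨d, hd'⟩ := Int.eq_ofNat_of_zero_le hd.le
  have hd0 : 0 < d := by omega
  refine ⟨⟨!![p, -y; r, x], by rw [Matrix.det_fin_two_of]; linarith⟩, ⟨g, hg0⟩, ⟨d, hd0⟩,
    x * A 0 1 + y * A 1 1, rfl, ?_, ?_, ?_, ?_, ?_⟩
  · simp only [PNat.mk_coe]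
    rw [← hd', hp, hr]; ring
  · change A 0 1 = p * (x * A 0 1 + y * A 1 1) + -y * (d : ℤ)
    rw [← hd']
    linear_combination (-(A 0 1)) * hone
  · change A 1 1 = r * (x * A 0 1 + y * A 1 1) + x * (d : ℤ)
    rw [← hd']
    linear_combination (-(A 1 1)) * hone
  · simp [hp, mul_comm]
  · simp [hr, mul_comm]

/-- An identity `A γ = γ' B` of integral matrices, with `A` and `B` upper triangular, identifies the
slash by `γ` of the form of `A` with the form of `B`. -/
theorem E2diff_upperGL_slash {p s a d : ℕ+} {q b : ℤ} {γ γ' : SL(2, ℤ)}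
    (h00 : p * γ 0 0 + q * γ 1 0 = γ' 0 0 * a)
    (h01 : p * γ 0 1 + q * γ 1 1 = γ' 0 0 * b + γ' 0 1 * d)
    (h10 : s * γ 1 0 = γ' 1 0 * a) (h11 : s * γ 1 1 = γ' 1 0 * b + γ' 1 1 * d) :
    E2diff (upperGL p q s) ∣[(2 : ℤ)] γ = E2diff (upperGL a b d) := by
  rw [E2diff_slash, ← E2diff_mul_left γ' (upperGL a b d)]
  congr 1
  have e00 := congrArg (Int.cast : ℤ → ℝ) h00
  have e01 := congrArg (Int.cast : ℤ → ℝ) h01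
  have e10 := congrArg (Int.cast : ℤ → ℝ) h10
  have e11 := congrArg (Int.cast : ℤ → ℝ) h11
  push_cast at e00 e01 e10 e11
  ext i j
  fin_cases i <;> fin_cases j <;>
    simp [upperGL, Matrix.GeneralLinearGroup.mkOfDetNeZero, Matrix.mul_apply, Fin.sum_univ_two,
      e00, e01, e10, e11]

/-- The slash of `E2diff` by a unimodular matrix is again an `E2diff` of an upper triangular
matrix. -/
theorem exists_E2diff_slash_eq (p : ℕ+) (q : ℤ) (s : ℕ+) (γ : SL(2, ℤ)) :
    ∃ (γ' : SL(2, ℤ)) (a d : ℕ+) (b : ℤ),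
      E2diff (upperGL p q s) ∣[(2 : ℤ)] γ = E2diff (upperGL a b d) ∧
      (a : ℕ) = Int.gcd (p * γ 0 0 + q * γ 1 0) (s * γ 1 0) ∧ (a : ℕ) * d = p * s ∧
      p * γ 0 1 + q * γ 1 1 = γ' 0 0 * b + γ' 0 1 * d ∧ s * γ 1 1 = γ' 1 0 * b + γ' 1 1 * d ∧
      p * γ 0 0 + q * γ 1 0 = γ' 0 0 * a ∧ s * γ 1 0 = γ' 1 0 * a := by
  have hγ : γ 0 0 * γ 1 1 - γ 0 1 * γ 1 0 = 1 := by
    have := γ.det_coe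
    rwa [Matrix.det_fin_two] at this
  have hps : (0 : ℤ) < p * s := by
    have := mul_pos p.pos s.pos
    exact_mod_cast this
  have hdet : (!![(p : ℤ) * γ 0 0 + q * γ 1 0, p * γ 0 1 + q * γ 1 1;
      s * γ 1 0, s * γ 1 1] : Matrix (Fin 2) (Fin 2) ℤ).det = p * s := by
    rw [Matrix.det_fin_two_of]
    linear_combination (p * s : ℤ) * hγ
  obtain ⟨γ', a, d, b, ha, had, h01, h11, h00, h10⟩ := exists_upper _ (hdet ▸ hps)
  simp only [Matrix.of_apply, Matrix.cons_val', Matrix.cons_val_zero, Matrix.cons_val_one,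
    Matrix.cons_val_fin_one] at ha h01 h11 h00 h10
  exact ⟨γ', a, d, b, E2diff_upperGL_slash h00 h01 h10 h11, ha,
    by rw [hdet] at had; exact_mod_cast had, h01, h11, h00, h10⟩

/-! ### Taylor coefficients in the elliptic variable -/

theorem norm_exp_add_exp_neg_sub_two_le (w : ℂ) :
    ‖Complex.exp w + Complex.exp (-w) - 2‖ ≤ ‖w‖ ^ 2 * Real.exp (3 * ‖w‖) := by
  have h1 : ‖Complex.exp w - 1‖ ≤ ‖w‖ * Real.exp ‖w‖ := by
    simpa using Complex.norm_exp_sub_sum_le_norm_mul_exp w 1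
  have h2 : Complex.exp w + Complex.exp (-w) - 2 = Complex.exp (-w) * (Complex.exp w - 1) ^ 2 := by
    have : Complex.exp (-w) * Complex.exp w = 1 := by rw [← Complex.exp_add]; simp
    linear_combination (2 - Complex.exp w) * this
  have h3 : ‖Complex.exp (-w)‖ ≤ Real.exp ‖w‖ := by
    simpa using Complex.norm_exp_le_exp_norm (-w)
  rw [h2, norm_mul, norm_pow]
  calc ‖Complex.exp (-w)‖ * ‖Complex.exp w - 1‖ ^ 2
      ≤ Real.exp ‖w‖ * (‖w‖ * Real.exp ‖w‖) ^ 2 := by gcongr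
    _ = ‖w‖ ^ 2 * Real.exp (3 * ‖w‖) := by
      rw [show 3 * ‖w‖ = ‖w‖ + ‖w‖ + ‖w‖ by ring, Real.exp_add, Real.exp_add]; ring

/-- The second difference quotient of the exponential, obtained from the first one through
`e^w + e^(-w) - 2 = e^(-w) (e^w - 1)^2`. -/
theorem tendsto_exp_second_difference (a : ℂ) :
    Filter.Tendsto (fun z : ℂ => (Complex.exp (a * z) + Complex.exp (-(a * z)) - 2) / z ^ 2)
      (𝓝[≠] 0) (𝓝 (a ^ 2)) := by
  have h1 : HasDerivAt (fun z : ℂ => Complex.exp (a * z)) a 0 := by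
    have := ((hasDerivAt_id (0 : ℂ)).const_mul a).cexp
    simpa using this
  have h2 := h1.tendsto_slope_zero
  have h3 : Filter.Tendsto (fun z : ℂ => Complex.exp (-(a * z))) (𝓝[≠] 0) (𝓝 1) := by
    have : Continuous fun z : ℂ => Complex.exp (-(a * z)) := by fun_prop
    simpa using (this.tendsto 0).mono_left (nhdsWithin_le_nhds (s := {0}ᶜ))
  have h4 := h3.mul (h2.pow 2)
  rw [one_mul] at h4
  refine h4.congr' ?_
  filter_upwards [self_mem_nhdsWithin] with z hz
  have hz : z ≠ 0 := hz
  have h5 : Complex.exp (-(a * z)) * Complex.exp (a * z) = 1 := by rw [← Complex.exp_add]; simp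
  simp only [zero_add, mul_zero, Complex.exp_zero, smul_eq_mul]
  field_simp
  linear_combination (Complex.exp (a * z) - 2) * h5

namespace TwistedTwiningGenera

variable {π : FrameShape} {lam : ℕ}

/-- The series `∑ ĉ(n, l) w(l) q ^ n` attached to a weight `w` and to the genus with indices
`i, j`; the weights `1` and `l ^ 2` give the first Taylor coefficients in the elliptic variable. -/
noncomputable def moment (T : TwistedTwiningGenera π lam) (w : ℤ → ℂ) (i j : ℤ) (τ : ℍ) : ℂ :=
  ∑ s ∈ Finset.range T.modulus, expTwoPiI ((s : ℂ) * j / T.modulus) *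
    ∑' x : ℚ × ℤ, (T.chat i s x.1 x.2 : ℂ) * w x.2 * expTwoPiI ((x.1 : ℂ) * τ)

/-- The coefficient of `q ^ (k / M)` in `moment`. -/
noncomputable def momentCoeff (T : TwistedTwiningGenera π lam) (w : ℤ → ℂ) (i j : ℤ) (k : ℕ) : ℂ :=
  ∑ s ∈ Finset.range T.modulus, expTwoPiI ((s : ℂ) * j / T.modulus) *
    ∑' l : ℤ, (T.chat i s ((k : ℚ) / T.modulus) l : ℂ) * w l

/-- Weights of at most exponential growth. -/
def ExpBounded (w : ℤ → ℂ) : Prop :=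
  ∃ C y : ℝ, ∀ l : ℤ, ‖w l‖ ≤ C * (Real.exp (2 * Real.pi * (l * y)) +
    Real.exp (-(2 * Real.pi * (l * y))))

theorem ExpBounded.summable_norm {w : ℤ → ℂ} (hw : ExpBounded w) (T : TwistedTwiningGenera π lam)
    (r s : ℤ) {v : ℝ} (hv : 0 < v) : Summable fun x : ℚ × ℤ =>
      ‖(T.chat r s x.1 x.2 : ℂ)‖ * ‖w x.2‖ * Real.exp (-(2 * Real.pi * (x.1 * v))) := by
  obtain ⟨C, y, hC⟩ := hw
  have h1 := T.hat_summable_norm r s hv y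
  have h2 := T.hat_summable_norm r s hv (-y)
  refine Summable.of_nonneg_of_le (fun x => by positivity) (fun x => ?_)
    ((h1.add h2).mul_left C)
  have h3 := hC x.2
  have e1 : Real.exp (-(2 * Real.pi * (x.1 * v + x.2 * y))) =
      Real.exp (-(2 * Real.pi * (x.1 * v))) * Real.exp (-(2 * Real.pi * (x.2 * y))) := by
    rw [← Real.exp_add]; congr 1; ring
  have e2 : Real.exp (-(2 * Real.pi * (x.1 * v + x.2 * -y))) =
      Real.exp (-(2 * Real.pi * (x.1 * v))) * Real.exp (2 * Real.pi * (x.2 * y)) := by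
    rw [← Real.exp_add]; congr 1; ring
  rw [e1, e2]
  calc ‖(T.chat r s x.1 x.2 : ℂ)‖ * ‖w x.2‖ * Real.exp (-(2 * Real.pi * (x.1 * v)))
      ≤ ‖(T.chat r s x.1 x.2 : ℂ)‖ * (C * (Real.exp (2 * Real.pi * (x.2 * y)) +
        Real.exp (-(2 * Real.pi * (x.2 * y))))) * Real.exp (-(2 * Real.pi * (x.1 * v))) := by
        gcongr
    _ = _ := by ring

theorem ExpBounded.summable {w : ℤ → ℂ} (hw : ExpBounded w) (T : TwistedTwiningGenera π lam)
    (r s : ℤ) (τ : ℍ) : Summable fun x : ℚ × ℤ =>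
      (T.chat r s x.1 x.2 : ℂ) * w x.2 * expTwoPiI ((x.1 : ℂ) * τ) := by
  refine Summable.of_norm ((hw.summable_norm T r s τ.im_pos).congr fun x => ?_)
  rw [norm_mul, norm_mul, norm_expTwoPiI]
  simp

theorem expBounded_one : ExpBounded fun _ => 1 :=
  ⟨1, 0, fun l => by simp⟩

theorem expBounded_sq : ExpBounded fun l => (l : ℂ) ^ 2 := by
  refine ⟨2, 1, fun l => ?_⟩
  rw [norm_pow, Complex.norm_intCast, sq_abs, mul_one]
  have h := Real.quadratic_le_exp_of_nonneg (abs_nonneg (2 * Real.pi * (l : ℝ)))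
  have h1 : Real.exp |2 * Real.pi * (l : ℝ)| ≤ Real.exp (2 * Real.pi * l) +
      Real.exp (-(2 * Real.pi * l)) := Real.exp_abs_le _
  have h2 : (l : ℝ) ^ 2 ≤ |2 * Real.pi * (l : ℝ)| ^ 2 := by
    rw [sq_abs, mul_pow]
    have : (1 : ℝ) ≤ (2 * Real.pi) ^ 2 := by nlinarith [Real.pi_gt_three]
    nlinarith [sq_nonneg (l : ℝ)]
  have h3 := abs_nonneg (2 * Real.pi * (l : ℝ))
  linarith

theorem hasQExp_moment (T : TwistedTwiningGenera π lam) (hM : 0 < T.modulus) {w : ℤ → ℂ}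
    (hw : ExpBounded w) (i j : ℤ) :
    HasQExp T.modulus (T.moment w i j) (T.momentCoeff w i j) := by
  intro τ
  have hMQ : (T.modulus : ℚ) ≠ 0 := by exact_mod_cast hM.ne'
  have hMC : (T.modulus : ℂ) ≠ 0 := by exact_mod_cast hM.ne'
  have key : ∀ s : ℕ, HasSum (fun k : ℕ => (∑' l : ℤ, (T.chat i s ((k : ℚ) / T.modulus) l : ℂ) *
      w l) * expTwoPiI ((k : ℂ) * τ / T.modulus))
      (∑' x : ℚ × ℤ, (T.chat i s x.1 x.2 : ℂ) * w x.2 * expTwoPiI ((x.1 : ℂ) * τ)) := by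
    intro s
    have h1 := (hw.summable T i s τ).hasSum
    have hinj : Function.Injective fun p : ℕ × ℤ => (((p.1 : ℚ) / T.modulus, p.2) : ℚ × ℤ) := by
      rintro ⟨k, l⟩ ⟨k', l'⟩ h
      simp only [Prod.mk.injEq] at h
      obtain ⟨h1, rfl⟩ := h
      field_simp at h1
      simpa using h1
    have h2 := (hinj.hasSum_iff fun x hx => ?_).mpr h1
    · have h3 := h2.prod_fiberwise fun k => (h2.summable.prod_factor k).hasSum
      refine h3.congr_terms fun k => ?_
      rw [← tsum_mul_right]
      refine tsum_congr fun l => ?_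
      simp only [Function.comp_apply]
      congr 2
      push_cast
      ring
    · rw [mul_assoc]
      have : T.chat i s x.1 x.2 = 0 := by
        by_contra hc
        apply hx
        obtain ⟨k, hk⟩ := T.exists_int_of_chat_ne_zero hM i s x.1 x.2 (by exact_mod_cast hc)
        have hn := (T.chat_support hc).1
        have hk0 : 0 ≤ k := by
          have : (0 : ℚ) ≤ k := by rw [← hk]; positivity
          exact_mod_cast this
        obtain ⟨k, rfl⟩ := Int.eq_ofNat_of_zero_le hk0
        refine ⟨(k, x.2), ?_⟩
        ext
        · simp only
          rw [div_eq_iff hMQ, hk]; simp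
        · rfl
      simp [this]
  have h := hasSum_sum (s := Finset.range T.modulus)
    fun s _ => (key s).mul_left (expTwoPiI ((s : ℂ) * j / T.modulus))
  refine h.congr_terms fun k => ?_
  rw [momentCoeff, Finset.sum_mul]
  exact Finset.sum_congr rfl fun s _ => by ring

/-- The moment with weight `1` is the specialisation at `z = 0`. -/
theorem moment_one (T : TwistedTwiningGenera π lam) (hM : 0 < T.modulus) (i j : ℤ) (τ : ℍ) :
    T.moment (fun _ => 1) i j τ = T.φ i j τ 0 := by
  rw [T.φ_eq_sum_hat hM, moment]
  refine Finset.sum_congr rfl fun s _ => ?_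
  rw [← (T.hat_hasSum i s τ 0).tsum_eq]
  simp

/-- The second Taylor coefficient is obtained from a symmetric difference quotient. -/
theorem tendsto_second_difference (T : TwistedTwiningGenera π lam) (hM : 0 < T.modulus) (i j : ℤ)
    (τ : ℍ) : Filter.Tendsto
      (fun z : ℂ => (T.φ i j τ z + T.φ i j τ (-z) - 2 * T.φ i j τ 0) / z ^ 2) (𝓝[≠] 0)
      (𝓝 ((2 * Real.pi * Complex.I) ^ 2 * T.moment (fun l => (l : ℂ) ^ 2) i j τ)) := by
  have key : ∀ s : ℕ, Filter.Tendsto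
      (fun z : ℂ => (T.hat i s τ z + T.hat i s τ (-z) - 2 * T.hat i s τ 0) / z ^ 2) (𝓝[≠] 0)
      (𝓝 ((2 * Real.pi * Complex.I) ^ 2 * ∑' x : ℚ × ℤ, (T.chat i s x.1 x.2 : ℂ) *
        (x.2 : ℂ) ^ 2 * expTwoPiI ((x.1 : ℂ) * τ))) := by
    intro s
    rw [← tsum_mul_left]
    -- The difference quotients of `exp(± 2 π i l z)` for `|z| < 1` are dominated by this weight.
    have hbd : ExpBounded fun l : ℤ => (((2 * Real.pi * l) ^ 2 *
        Real.exp (3 * |2 * Real.pi * (l : ℝ)|) : ℝ) : ℂ) := by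
      refine ⟨2, 4, fun l => ?_⟩
      rw [Complex.norm_real, Real.norm_of_nonneg (by positivity)]
      have h := Real.quadratic_le_exp_of_nonneg (abs_nonneg (2 * Real.pi * (l : ℝ)))
      have h1 := Real.exp_abs_le (4 * (2 * Real.pi * (l : ℝ)))
      have h3 := abs_nonneg (2 * Real.pi * (l : ℝ))
      have h4 : (2 * Real.pi * (l : ℝ)) ^ 2 ≤ 2 * Real.exp |2 * Real.pi * (l : ℝ)| := by
        rw [← sq_abs]; linarith
      have h5 : |4 * (2 * Real.pi * (l : ℝ))| = |2 * Real.pi * (l : ℝ)| +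
          3 * |2 * Real.pi * (l : ℝ)| := by
        rw [abs_mul, abs_of_pos (by norm_num : (0 : ℝ) < 4)]; ring
      rw [h5, Real.exp_add] at h1
      have e : 2 * Real.pi * ((l : ℝ) * 4) = 4 * (2 * Real.pi * l) := by ring
      rw [e]
      calc (2 * Real.pi * (l : ℝ)) ^ 2 * Real.exp (3 * |2 * Real.pi * (l : ℝ)|)
          ≤ 2 * Real.exp |2 * Real.pi * (l : ℝ)| * Real.exp (3 * |2 * Real.pi * (l : ℝ)|) := by
            gcongr
        _ ≤ _ := by linarith
    have hlim := tendsto_tsum_of_dominated_convergence (𝓕 := 𝓝[≠] (0 : ℂ))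
      (f := fun (z : ℂ) (x : ℚ × ℤ) => (T.chat i s x.1 x.2 : ℂ) * expTwoPiI ((x.1 : ℂ) * τ) *
        ((Complex.exp (2 * Real.pi * Complex.I * x.2 * z) +
          Complex.exp (-(2 * Real.pi * Complex.I * x.2 * z)) - 2) / z ^ 2))
      (g := fun x : ℚ × ℤ => (T.chat i s x.1 x.2 : ℂ) * expTwoPiI ((x.1 : ℂ) * τ) *
        (2 * Real.pi * Complex.I * x.2) ^ 2)
      (hbd.summable_norm T i s τ.im_pos)
      (fun x => (tendsto_exp_second_difference _).const_mul _) ?_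
    · refine (hlim.congr' ?_).trans (le_of_eq ?_)
      · filter_upwards [self_mem_nhdsWithin] with z hz
        have h1 := ((T.hat_hasSum i s τ z).add (T.hat_hasSum i s τ (-z))).sub
          ((T.hat_hasSum i s τ 0).mul_left 2)
        rw [← (h1.div_const (z ^ 2)).tsum_eq]
        refine tsum_congr fun x => ?_
        have e1 : expTwoPiI ((x.1 : ℂ) * τ + x.2 * z) = expTwoPiI ((x.1 : ℂ) * τ) *
            Complex.exp (2 * Real.pi * Complex.I * x.2 * z) := by
          rw [expTwoPiI_add, expTwoPiI_def (x.2 * z), mul_assoc (2 * Real.pi * Complex.I)]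
        have e2 : expTwoPiI ((x.1 : ℂ) * τ + x.2 * -z) = expTwoPiI ((x.1 : ℂ) * τ) *
            Complex.exp (-(2 * Real.pi * Complex.I * x.2 * z)) := by
          rw [expTwoPiI_add, expTwoPiI_def (x.2 * -z)]
          congr 2; ring
        rw [e1, e2, mul_zero, add_zero]
        ring
      · congr 1
        refine tsum_congr fun x => ?_
        ring
    · have hball : {z : ℂ | ‖z‖ < 1} ∈ 𝓝[≠] (0 : ℂ) := by
        refine nhdsWithin_le_nhds ?_
        have := Metric.ball_mem_nhds (0 : ℂ) one_pos
        simpa [Metric.ball, dist_zero_right] using this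
      filter_upwards [self_mem_nhdsWithin, hball] with z hz hz1 x
      have hz : z ≠ 0 := hz
      have hz1 : ‖z‖ < 1 := hz1
      have hw : ‖2 * Real.pi * Complex.I * x.2 * z‖ = |2 * Real.pi * (x.2 : ℝ)| * ‖z‖ := by
        rw [norm_mul]
        congr 1
        rw [abs_mul, abs_of_pos Real.two_pi_pos]
        simp [abs_of_pos Real.pi_pos]
      have h1 := norm_exp_add_exp_neg_sub_two_le (2 * Real.pi * Complex.I * x.2 * z)
      rw [hw] at h1
      have hz0 : 0 < ‖z‖ := norm_pos_iff.mpr hz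
      rw [norm_mul, norm_mul, norm_expTwoPiI, norm_div, norm_pow, Complex.norm_real,
        Real.norm_of_nonneg (by positivity)]
      have e : ((x.1 : ℂ) * τ).im = x.1 * τ.im := by simp
      rw [e, mul_right_comm]
      refine mul_le_mul_of_nonneg_right (mul_le_mul_of_nonneg_left ?_ (norm_nonneg _))
        (Real.exp_pos _).le
      rw [div_le_iff₀ (by positivity)]
      refine h1.trans ?_
      rw [mul_pow, sq_abs]
      have h2 : Real.exp (3 * (|2 * Real.pi * (x.2 : ℝ)| * ‖z‖)) ≤
          Real.exp (3 * |2 * Real.pi * (x.2 : ℝ)|) := by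
        apply Real.exp_le_exp.mpr
        have := mul_le_mul_of_nonneg_left hz1.le (abs_nonneg (2 * Real.pi * (x.2 : ℝ)))
        linarith
      have h3 : 0 ≤ (2 * Real.pi * (x.2 : ℝ)) ^ 2 * ‖z‖ ^ 2 := by positivity
      calc _ ≤ (2 * Real.pi * (x.2 : ℝ)) ^ 2 * ‖z‖ ^ 2 *
            Real.exp (3 * |2 * Real.pi * (x.2 : ℝ)|) := mul_le_mul_of_nonneg_left h2 h3
        _ = _ := by ring
  have hsum := tendsto_finsetSum (Finset.range T.modulus)
    fun s _ => (key s).const_mul (expTwoPiI ((s : ℂ) * j / T.modulus))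
  refine (hsum.congr fun z => ?_).trans (le_of_eq ?_)
  · simp only [T.φ_eq_sum_hat hM i j]
    rw [Finset.mul_sum, ← Finset.sum_add_distrib, ← Finset.sum_sub_distrib, Finset.sum_div]
    exact Finset.sum_congr rfl fun s _ => by ring
  · congr 1
    rw [moment, Finset.mul_sum]
    exact Finset.sum_congr rfl fun s _ => by ring

/-- The modular transformation of the second Taylor coefficient. -/
theorem moment_sq_modular (T : TwistedTwiningGenera π lam) (hM : 0 < T.modulus) (i j : ℤ)
    (γ : SL(2, ℤ)) (τ : ℍ) :
    T.moment (fun l => (l : ℂ) ^ 2) i j (γ • τ) =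
      (γ 1 0 * τ + γ 1 1) ^ 2 * T.moment (fun l => (l : ℂ) ^ 2) (γ 0 0 * i + γ 1 0 * j)
        (γ 0 1 * i + γ 1 1 * j) τ + γ 1 0 * (γ 1 0 * τ + γ 1 1) / (Real.pi * Complex.I) *
        T.φ (γ 0 0 * i + γ 1 0 * j) (γ 0 1 * i + γ 1 1 * j) τ 0 := by
  set D : ℂ := γ 1 0 * τ + γ 1 1 with hDdef
  have hD : D ≠ 0 := UpperHalfPlane.denom_ne_zero (γ : GL (Fin 2) ℝ) τ
  set φ' := T.φ (γ 0 0 * i + γ 1 0 * j) (γ 0 1 * i + γ 1 1 * j) τ with hφ'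
  have hmod : ∀ z : ℂ, T.φ i j (γ • τ) (z / D) =
      Complex.exp (2 * Real.pi * Complex.I * (γ 1 0 * z ^ 2 / D)) * φ' z :=
    fun z => T.modular γ i j τ z
  have hdiv : Filter.Tendsto (fun z : ℂ => z / D) (𝓝[≠] 0) (𝓝[≠] 0) := by
    rw [tendsto_nhdsWithin_iff]
    constructor
    · have : Continuous fun z : ℂ => z / D := by fun_prop
      simpa using (this.tendsto 0).mono_left (nhdsWithin_le_nhds (s := {0}ᶜ))
    · filter_upwards [self_mem_nhdsWithin] with z hz
      exact div_ne_zero hz hD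
  have h1 := (T.tendsto_second_difference hM i j (γ • τ)).comp hdiv
  have h2 := T.tendsto_second_difference hM (γ 0 0 * i + γ 1 0 * j) (γ 0 1 * i + γ 1 1 * j) τ
  rw [← hφ'] at h2
  have hexp : Filter.Tendsto (fun z : ℂ =>
      Complex.exp (2 * Real.pi * Complex.I * (γ 1 0 * z ^ 2 / D))) (𝓝[≠] 0) (𝓝 1) := by
    have : Continuous fun z : ℂ => Complex.exp (2 * Real.pi * Complex.I * (γ 1 0 * z ^ 2 / D)) := by
      fun_prop
    simpa using (this.tendsto 0).mono_left (nhdsWithin_le_nhds (s := {0}ᶜ))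
  have hexp' : Filter.Tendsto (fun z : ℂ =>
      (Complex.exp (2 * Real.pi * Complex.I * (γ 1 0 * z ^ 2 / D)) - 1) / z ^ 2) (𝓝[≠] 0)
      (𝓝 (2 * Real.pi * Complex.I * (γ 1 0 / D))) := by
    have hd : HasDerivAt (fun w : ℂ => Complex.exp (2 * Real.pi * Complex.I * (γ 1 0 / D) * w))
        (2 * Real.pi * Complex.I * (γ 1 0 / D)) 0 := by
      have := ((hasDerivAt_id (0 : ℂ)).const_mul (2 * Real.pi * Complex.I * (γ 1 0 / D))).cexp
      simpa using this
    have hsq : Filter.Tendsto (fun z : ℂ => z ^ 2) (𝓝[≠] 0) (𝓝[≠] 0) := by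
      rw [tendsto_nhdsWithin_iff]
      constructor
      · have : Continuous fun z : ℂ => z ^ 2 := by fun_prop
        simpa using (this.tendsto 0).mono_left (nhdsWithin_le_nhds (s := {0}ᶜ))
      · filter_upwards [self_mem_nhdsWithin] with z hz
        exact pow_ne_zero 2 hz
    refine (hd.tendsto_slope_zero.comp hsq).congr fun z => ?_
    simp only [Function.comp_apply, zero_add, mul_zero, Complex.exp_zero, smul_eq_mul]
    rw [show 2 * (Real.pi : ℂ) * Complex.I * (γ 1 0 * z ^ 2 / D) =
      2 * Real.pi * Complex.I * (γ 1 0 / D) * z ^ 2 by ring, div_eq_inv_mul (_ - 1)]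
  have h3 := ((hexp.mul h2).add (hexp'.const_mul (2 * φ' 0))).const_mul (D ^ 2)
  have h4 : (fun z : ℂ => D ^ 2 * (Complex.exp (2 * Real.pi * Complex.I * (γ 1 0 * z ^ 2 / D)) *
      ((φ' z + φ' (-z) - 2 * φ' 0) / z ^ 2) + 2 * φ' 0 *
      ((Complex.exp (2 * Real.pi * Complex.I * (γ 1 0 * z ^ 2 / D)) - 1) / z ^ 2))) =ᶠ[𝓝[≠] 0]
      ((fun z => (T.φ i j (γ • τ) z + T.φ i j (γ • τ) (-z) - 2 * T.φ i j (γ • τ) 0) / z ^ 2) ∘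
        fun z => z / D) := by
    filter_upwards [self_mem_nhdsWithin] with z hz
    have hz : z ≠ 0 := hz
    have e1 := hmod z
    have e2 := hmod (-z)
    have e3 := hmod 0
    rw [neg_div, neg_sq] at e2
    simp only [zero_div, ne_eq, OfNat.ofNat_ne_zero, not_false_eq_true, zero_pow, mul_zero,
      Complex.exp_zero, one_mul] at e3
    simp only [Function.comp_apply]
    rw [e1, e2, e3]
    field_simp
    ring
  have h5 := tendsto_nhds_unique h1 (h3.congr' h4)
  have hpi : (Real.pi : ℂ) ≠ 0 := by exact_mod_cast Real.pi_ne_zero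
  have hI := Complex.I_ne_zero
  have hne : (2 * Real.pi * Complex.I : ℂ) ^ 2 ≠ 0 :=
    pow_ne_zero 2 (mul_ne_zero (mul_ne_zero two_ne_zero hpi) hI)
  apply mul_left_cancel₀ hne
  rw [h5]
  field_simp

/-! ### Weight-two forms from the second Taylor coefficient -/

theorem moment_congr (T : TwistedTwiningGenera π lam) (hM : 0 < T.modulus) (w : ℤ → ℂ)
    {i j i' j' : ℤ} (hi : i ≡ i' [ZMOD T.modulus]) (hj : j ≡ j' [ZMOD T.modulus]) :
    T.moment w i j = T.moment w i' j' := by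
  have hM' : (T.modulus : ℂ) ≠ 0 := by exact_mod_cast hM.ne'
  funext τ
  simp only [moment]
  refine Finset.sum_congr rfl fun s _ => ?_
  congr 1
  · obtain ⟨b, hb⟩ := hj.dvd
    have : (j' : ℂ) = j + T.modulus * b := by
      have : j' = j + T.modulus * b := by linarith
      exact_mod_cast this
    rw [this, show (s : ℂ) * (j + T.modulus * b) / T.modulus =
      (s : ℂ) * j / T.modulus + ((s * b : ℤ) : ℂ) by push_cast; field_simp, expTwoPiI_add,
      expTwoPiI_int, mul_one]
  · exact tsum_congr fun x => by rw [T.chat_congr hM hi (Int.ModEq.refl (s : ℤ))]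

theorem φ_zero_modular (T : TwistedTwiningGenera π lam) (i j : ℤ) (γ : SL(2, ℤ)) (τ : ℍ) :
    T.φ i j (γ • τ) 0 = T.φ (γ 0 0 * i + γ 1 0 * j) (γ 0 1 * i + γ 1 1 * j) τ 0 := by
  have := T.modular γ i j τ 0
  simpa using this

/-- The combination of the second Taylor coefficient and `E₂` which transforms with weight two, for
a genus specialising to the constant `f` at `z = 0`. -/
noncomputable def weightTwo (T : TwistedTwiningGenera π lam) (f : ℂ) (i j : ℤ) : ℍ → ℂ :=
  (1 / 2 : ℂ) • T.moment (fun l => (l : ℂ) ^ 2) i j - (f / 12) • EisensteinSeries.E2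

/-- The anomaly of the second Taylor coefficient, proportional to the value at `z = 0`, is cancelled
by that of `E₂`. -/
theorem weightTwo_slash (T : TwistedTwiningGenera π lam) (hM : 0 < T.modulus) {f : ℂ} {i j : ℤ}
    (γ : SL(2, ℤ))
    (hf : ∀ τ, T.φ (γ 0 0 * i + γ 1 0 * j) (γ 0 1 * i + γ 1 1 * j) τ 0 = f) :
    T.weightTwo f i j ∣[(2 : ℤ)] γ =
      T.weightTwo f (γ 0 0 * i + γ 1 0 * j) (γ 0 1 * i + γ 1 1 * j) := by
  funext τ
  have hE := congrFun (EisensteinSeries.E2_slash_action γ) τ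
  rw [ModularForm.SL_slash_apply] at hE ⊢
  have hD := UpperHalfPlane.denom_ne_zero (γ : GL (Fin 2) ℝ) τ
  have hDeq : UpperHalfPlane.denom (γ : GL (Fin 2) ℝ) τ = γ 1 0 * τ + γ 1 1 :=
    ModularGroup.denom_apply γ τ
  simp only [Pi.sub_apply, Pi.smul_apply, EisensteinSeries.D2, smul_eq_mul, riemannZeta_two] at hE
  simp only [weightTwo, Pi.sub_apply, Pi.smul_apply, smul_eq_mul]
  rw [T.moment_sq_modular hM, hf, sub_mul, mul_assoc (f / 12), hE, ← hDeq]
  set D := UpperHalfPlane.denom (γ : GL (Fin 2) ℝ) τ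
  have hpi : (Real.pi : ℂ) ≠ 0 := by exact_mod_cast Real.pi_ne_zero
  have hI := Complex.I_ne_zero
  have hI2 := Complex.I_sq
  rw [show ((-2 : ℤ)) = -((2 : ℕ) : ℤ) by norm_num, zpow_neg, zpow_natCast]
  field_simp
  linear_combination (12 * (γ 1 0 : ℂ) * f) * hI2

theorem weightTwo_congr (T : TwistedTwiningGenera π lam) (hM : 0 < T.modulus) (f : ℂ)
    {i j i' j' : ℤ} (hi : i ≡ i' [ZMOD T.modulus]) (hj : j ≡ j' [ZMOD T.modulus]) :
    T.weightTwo f i j = T.weightTwo f i' j' := by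
  rw [weightTwo, weightTwo, T.moment_congr hM _ hi hj]

theorem hasQExp_E2_of_width {h : ℕ} (hh : 0 < h) :
    HasQExp h EisensteinSeries.E2 (E2coeffUpper h 1 0 1) := by
  have := hasQExp_E2_upperGL hh (a := 1) (d := 1) 0 (by simp)
  have h2 : ∀ τ : ℍ, (upperGL 1 0 1 • τ : ℍ) = τ := fun τ => by
    apply UpperHalfPlane.ext
    rw [coe_upperGL_smul]; simp
  simpa [h2] using this

theorem hasQExp_weightTwo (T : TwistedTwiningGenera π lam) (hM : 0 < T.modulus) (f : ℂ)
    (i j : ℤ) : HasQExp T.modulus (T.weightTwo f i j)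
      ((1 / 2 : ℂ) • T.momentCoeff (fun l => (l : ℂ) ^ 2) i j -
        (f / 12) • E2coeffUpper T.modulus 1 0 1) :=
  ((T.hasQExp_moment hM expBounded_sq i j).smul _).sub ((hasQExp_E2_of_width hM).smul _)

/-- For `k < 3 M / 4` only the powers `y`, `y⁻¹` contribute to the second moment at `q ^ (k / M)`. -/
theorem momentCoeff_sq (T : TwistedTwiningGenera π lam) (hM : 0 < T.modulus) (i j : ℤ) {k : ℕ}
    (hk : 4 * k < 3 * T.modulus) : (1 / 2 : ℂ) * T.momentCoeff (fun l => (l : ℂ) ^ 2) i j k =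
      ∑ s ∈ Finset.range T.modulus, expTwoPiI ((s : ℂ) * j / T.modulus) *
        (T.chat i s ((k : ℚ) / T.modulus) 1 : ℂ) := by
  have hMQ : (0 : ℚ) < T.modulus := by exact_mod_cast hM
  rw [momentCoeff, Finset.mul_sum]
  refine Finset.sum_congr rfl fun s _ => ?_
  have h1 : T.chat i s ((k : ℚ) / T.modulus) (-1) = T.chat i s ((k : ℚ) / T.modulus) 1 :=
    T.chat_eq_of_discr_eq hM _ _ (by decide) (by norm_num)
  rw [tsum_eq_sum (s := {-1, 1})]
  · rw [Finset.sum_pair (by decide), h1]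
    push_cast
    ring
  · intro l hl
    simp only [Finset.mem_insert, Finset.mem_singleton, not_or] at hl
    by_cases hc : T.chat i s ((k : ℚ) / T.modulus) l = 0
    · simp [hc]
    have h2 := T.neg_one_le_discr hM hc
    have h3 : (k : ℚ) / T.modulus < 3 / 4 := by
      rw [div_lt_div_iff₀ hMQ (by norm_num)]
      have : ((4 * k : ℕ) : ℚ) < ((3 * T.modulus : ℕ) : ℚ) := by exact_mod_cast hk
      push_cast at this
      linarith
    have h4 : l ^ 2 < 4 := by
      have : (l : ℚ) ^ 2 < 4 := by linarith
      exact_mod_cast this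
    have h5 : -2 < l := by nlinarith
    have h6 : l < 2 := by nlinarith
    have : l = 0 := by omega
    simp [this]

/-- The invariant states of discriminant `-1` in the untwisted sector, from the leading term
`2 y + 2 y⁻¹`. -/
theorem chat_zero_zero (T : TwistedTwiningGenera π lam) (hM : 0 < T.modulus) :
    T.chat 0 0 0 1 = 2 := by
  have hM' : (T.modulus : ℂ) ≠ 0 := by exact_mod_cast hM.ne'
  have key : ∀ z : ℂ, (T.chat 0 0 0 (-1) : ℂ) * expTwoPiI (-z) + T.chat 0 0 0 0 +
      T.chat 0 0 0 1 * expTwoPiI z = 2 * (expTwoPiI z + expTwoPiI (-z)) +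
      (1 / (T.modulus : ℂ)) * ∑ k ∈ Finset.range T.modulus, (((π.trace k : ℤ) : ℂ) - 4) := by
    intro z
    refine tendsto_nhds_unique (T.tendsto_hat_atImInfty hM 0 0 z) ?_
    have e : (fun τ : ℍ => T.hat 0 0 τ z) = fun τ : ℍ => (1 / (T.modulus : ℂ)) *
        ∑ k ∈ Finset.range T.modulus, T.φ 0 (k : ℤ) τ z := by
      funext τ; simp [T.hat_eq 0 0 τ z]
    rw [e]
    have h1 := (tendsto_finsetSum (Finset.range T.modulus)
      fun k _ => T.tendsto_φ_zero k z).const_mul (1 / (T.modulus : ℂ))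
    convert h1 using 2
    rw [Finset.sum_add_distrib, Finset.sum_const, Finset.card_range, nsmul_eq_mul]
    field_simp
  have := (eq_of_forall_laurent key).2.2
  exact_mod_cast this

/-- The specialisation at `z = 0` of the untwisted genera at the cusp. -/
theorem momentCoeff_one_zero (T : TwistedTwiningGenera π lam) (hM : 0 < T.modulus) (k : ℤ) :
    T.momentCoeff (fun _ => 1) 0 k 0 = ((π.trace k : ℤ) : ℂ) := by
  have h1 := (T.hasQExp_moment hM expBounded_one 0 k).tendsto hM
  have h2 := T.tendsto_φ_zero k 0
  have e : (fun τ : ℍ => T.φ 0 k τ 0) = T.moment (fun _ => 1) 0 k :=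
    funext fun τ => (T.moment_one hM 0 k τ).symm
  rw [e] at h2
  rw [tendsto_nhds_unique h1 h2]
  simp
  ring

end TwistedTwiningGenera

/-! ### Specialisation at `z = 0` and the trace relations -/

theorem SL2_det_eq_one (γ : SL(2, ℤ)) : γ 0 0 * γ 1 1 - γ 0 1 * γ 1 0 = 1 := by
  have := γ.det_coe
  rwa [Matrix.det_fin_two] at this

/-- The right action of the modular group on row vectors modulo `m`. -/
def rowPerm (m : ℕ) (γ : SL(2, ℤ)) : Equiv.Perm (ZMod m × ZMod m) where
  toFun v := (γ 0 0 * v.1 + γ 1 0 * v.2, γ 0 1 * v.1 + γ 1 1 * v.2)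
  invFun v := (γ 1 1 * v.1 - γ 1 0 * v.2, γ 0 0 * v.2 - γ 0 1 * v.1)
  left_inv v := by
    have h := congrArg (Int.cast : ℤ → ZMod m) (SL2_det_eq_one γ)
    push_cast at h
    ext
    · simp only []; linear_combination v.1 * h
    · simp only []; linear_combination v.2 * h
  right_inv v := by
    have h := congrArg (Int.cast : ℤ → ZMod m) (SL2_det_eq_one γ)
    push_cast at h
    ext
    · simp only []; linear_combination v.1 * h
    · simp only []; linear_combination v.2 * h

theorem sum_range_mul_dvd {t m : ℕ} (hm : 0 < m) (g : ℕ → ℂ) :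
    ∑ s ∈ Finset.range (t * m), (if m ∣ s then g s else 0) = ∑ s ∈ Finset.range t, g (m * s) := by
  rw [← Finset.sum_filter]
  symm
  refine Finset.sum_bij (fun s _ => m * s) ?_ ?_ ?_ fun _ _ => rfl
  · intro s hs
    simp only [Finset.mem_filter, Finset.mem_range] at hs ⊢
    exact ⟨by rw [mul_comm t]; exact Nat.mul_lt_mul_of_pos_left hs hm, s, rfl⟩
  · intro a _ b _ h
    exact Nat.eq_of_mul_eq_mul_left hm h
  · intro b hb
    simp only [Finset.mem_filter, Finset.mem_range] at hb ⊢
    obtain ⟨h1, a, rfl⟩ := hb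
    exact ⟨a, by rw [mul_comm t] at h1; exact Nat.lt_of_mul_lt_mul_left h1, rfl⟩

/-- Orthogonality of the characters of the cyclic group of order `m`. -/
theorem sum_range_expTwoPiI {m : ℕ} (hm : 0 < m) (s : ℕ) :
    ∑ j ∈ Finset.range m, expTwoPiI ((s : ℂ) * j / m) = if m ∣ s then (m : ℂ) else 0 := by
  have hm' : (m : ℂ) ≠ 0 := by exact_mod_cast hm.ne'
  have e : ∀ j ∈ Finset.range m, expTwoPiI ((s : ℂ) * j / m) = expTwoPiI ((s : ℂ) / m) ^ j := by
    intro j _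
    rw [← expTwoPiI_nsmul]; congr 1; ring
  rw [Finset.sum_congr rfl e]
  split_ifs with h
  · obtain ⟨w, rfl⟩ := h
    have : expTwoPiI (((m * w : ℕ) : ℂ) / m) = 1 := by
      rw [expTwoPiI_eq_one_iff]
      exact ⟨w, by push_cast; field_simp⟩
    simp only [this, one_pow, Finset.sum_const, Finset.card_range, nsmul_eq_mul, mul_one]
  · have hne : expTwoPiI ((s : ℂ) / m) ≠ 1 := by
      rw [Ne, expTwoPiI_eq_one_iff]
      rintro ⟨w, hw⟩
      apply h
      rw [div_eq_iff hm'] at hw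
      have : (s : ℤ) = w * m := by exact_mod_cast hw
      exact Int.natCast_dvd_natCast.mp ⟨w, by rw [this, mul_comm]⟩
    rw [geom_sum_eq hne, ← expTwoPiI_nsmul]
    have : (m : ℂ) * (s / m) = ((s : ℤ) : ℂ) := by
      push_cast; field_simp
    rw [this, expTwoPiI_int]
    simp

namespace TwistedTwiningGenera

variable {π : FrameShape} {lam : ℕ}

/-- At `z = 0` the genera are constant on the orbits of the modular group: the differences to the
value at `i∞` of the untwisted genus in the orbit have weight zero, and one of them vanishes at
`i∞`. -/
theorem φ_zero_eq_trace (T : TwistedTwiningGenera π lam) (hM : 0 < T.modulus) (k : ℤ)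
    (γ : SL(2, ℤ)) (τ : ℍ) : T.φ (γ 1 0 * k) (γ 1 1 * k) τ 0 = ((π.trace k : ℤ) : ℂ) := by
  have : NeZero T.modulus := ⟨hM.ne'⟩
  -- The functions `F δ` form a finite set which the modular group permutes.
  set F : SL(2, ℤ) → ℍ → ℂ := fun δ τ =>
    T.φ (δ 1 0 * k) (δ 1 1 * k) τ 0 - ((π.trace k : ℤ) : ℂ) with hF
  have hslash : ∀ δ ε : SL(2, ℤ), F δ ∣[(0 : ℤ)] ε = F (δ * ε) := by
    intro δ ε
    funext τ
    rw [ModularForm.SL_slash_apply]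
    simp only [hF, neg_zero, zpow_zero, mul_one, φ_zero_modular]
    congr 3
    · simp [Matrix.mul_apply, Fin.sum_univ_two]; ring
    · simp [Matrix.mul_apply, Fin.sum_univ_two]; ring
  have hfin : Finite (Set.range F) := by
    refine Set.Finite.subset (Set.finite_range fun v : ZMod T.modulus × ZMod T.modulus =>
      fun τ => T.φ ((v.1.cast : ℤ) * k) ((v.2.cast : ℤ) * k) τ 0 - ((π.trace k : ℤ) : ℂ)) ?_
    rintro _ ⟨δ, rfl⟩
    refine ⟨(δ 1 0, δ 1 1), ?_⟩
    funext τ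
    simp only [hF]
    rw [T.φ_congr (i' := δ 1 0 * k) (j' := δ 1 1 * k)]
    · exact Int.ModEq.mul_right _ ((ZMod.intCast_eq_intCast_iff _ _ _).mp (by simp))
    · exact Int.ModEq.mul_right _ ((ZMod.intCast_eq_intCast_iff _ _ _).mp (by simp))
  have := Fintype.ofFinite (Set.range F)
  have hperm : IsPermuted ((0 : ℕ) : ℤ) fun i : Set.range F => (i : ℍ → ℂ) := by
    intro ε
    refine ⟨⟨fun i => ⟨(i : ℍ → ℂ) ∣[(0 : ℤ)] ε, ?_⟩,
      fun i => ⟨(i : ℍ → ℂ) ∣[(0 : ℤ)] ε⁻¹, ?_⟩, ?_, ?_⟩, fun i => rfl⟩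
    · obtain ⟨_, δ, rfl⟩ := i
      exact ⟨_, (hslash δ ε).symm⟩
    · obtain ⟨_, δ, rfl⟩ := i
      exact ⟨_, (hslash δ ε⁻¹).symm⟩
    · rintro ⟨_, δ, rfl⟩
      simp [hslash]
    · rintro ⟨_, δ, rfl⟩
      simp [hslash]
  have hex : ∀ i : Set.range F, ∃ b, HasQExp T.modulus (i : ℍ → ℂ) b ∧
      ((i : ℍ → ℂ) = F 1 → b 0 = 0) := by
    rintro ⟨_, δ, rfl⟩
    by_cases hδ : F δ = F 1
    · have h1 := (T.hasQExp_moment hM expBounded_one 0 k).sub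
        (HasQExp.const (h := T.modulus) ((π.trace k : ℤ) : ℂ))
      have e : (T.moment (fun _ => 1) 0 k - fun _ => ((π.trace k : ℤ) : ℂ)) = F δ := by
        rw [hδ]
        funext τ
        simp [hF, T.moment_one hM]
      rw [e] at h1
      exact ⟨_, h1, fun _ => by simp [T.momentCoeff_one_zero hM]⟩
    · have h1 := (T.hasQExp_moment hM expBounded_one (δ 1 0 * k) (δ 1 1 * k)).sub
        (HasQExp.const (h := T.modulus) ((π.trace k : ℤ) : ℂ))
      have e : (T.moment (fun _ => 1) (δ 1 0 * k) (δ 1 1 * k) -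
          fun _ => ((π.trace k : ℤ) : ℂ)) = F δ := by
        funext τ
        simp [hF, T.moment_one hM]
      rw [e] at h1
      exact ⟨_, h1, fun h => absurd h hδ⟩
  choose b hb hb0 using hex
  classical
  obtain ⟨⟨_, δ, rfl⟩, h0⟩ := hperm.exists_eq_zero hM hb
    (fun i => if (i : ℍ → ℂ) = F 1 then 1 else 0)
    (fun i j hj => by
      by_cases hi : (i : ℍ → ℂ) = F 1
      · rw [if_pos hi] at hj
        rw [Nat.lt_one_iff.mp hj, hb0 i hi]
      · simp [hi] at hj)
    (by
      rw [zero_mul, mul_zero]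
      refine Nat.mul_pos (by norm_num) (Finset.sum_pos' (fun _ _ => Nat.zero_le _)
        ⟨⟨F 1, 1, rfl⟩, Finset.mem_univ _, by simp⟩))
  have h2 : F γ = 0 := by
    have h0 : F δ = 0 := h0
    rw [show γ = δ * (δ⁻¹ * γ) by group, ← hslash, h0, SlashAction.zero_slash]
  exact sub_eq_zero.mp (congrFun h2 τ)

/-- The genus `φ_{g ^ i, g ^ j}` specialises at `z = 0` to the trace of `g ^ gcd(i, j)`. -/
theorem φ_zero_eq_trace_gcd (T : TwistedTwiningGenera π lam) (hM : 0 < T.modulus) (i j : ℤ)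
    (τ : ℍ) : T.φ i j τ 0 = ((π.trace (Int.gcd i j) : ℤ) : ℂ) := by
  obtain ⟨a, b, hab, hi, hj⟩ : ∃ a b : ℤ, IsCoprime a b ∧ i = a * Int.gcd i j ∧
      j = b * Int.gcd i j := by
    rcases Nat.eq_zero_or_pos (Int.gcd i j) with h | h
    · obtain ⟨rfl, rfl⟩ := Int.gcd_eq_zero_iff.mp h
      exact ⟨0, 1, isCoprime_zero_left.mpr isUnit_one, by simp, by simp⟩
    · obtain ⟨a, b, hab, hi, hj⟩ := Int.exists_gcd_one h
      exact ⟨a, b, Int.isCoprime_iff_gcd_eq_one.mpr hab, hi, hj⟩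
  obtain ⟨γ, h0, h1⟩ := hab.exists_SL2_row 1
  have := T.φ_zero_eq_trace hM (Int.gcd i j) γ τ
  rwa [h0, h1, ← hi, ← hj] at this

/-- The constant terms of the weight-two forms of the genera with indices divisible by `t` add up
to zero. The sum over the second index projects to charges divisible by `m = M / t`, and the
right-hand side is the contribution of `E₂`. -/
theorem sum_chat_eq_sum_trace (T : TwistedTwiningGenera π lam) {t m : ℕ} (hm : 0 < m)
    (hM : 0 < T.modulus) (htm : T.modulus = t * m) :
    12 * m * ∑ i ∈ Finset.range m, ∑ s ∈ Finset.range t, T.chat (t * i) (m * s) 0 1 =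
      ∑ i ∈ Finset.range m, ∑ j ∈ Finset.range m,
        π.trace (Int.gcd ((t * i : ℕ) : ℤ) ((t * j : ℕ) : ℤ)) := by
  have : NeZero m := ⟨hm.ne'⟩
  have hMC : (T.modulus : ℂ) = t * m := by exact_mod_cast htm
  have hmC : (m : ℂ) ≠ 0 := by exact_mod_cast hm.ne'
  have htC : (t : ℂ) ≠ 0 := by
    intro h
    have : t = 0 := by exact_mod_cast h
    rw [htm, this] at hM
    simp at hM
  set idx : ZMod m → ℤ := fun x => ((t * x.val : ℕ) : ℤ) with hidx
  set f : ZMod m × ZMod m → ℂ := fun v =>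
    ((π.trace (Int.gcd (idx v.1) (idx v.2)) : ℤ) : ℂ) with hf
  -- The lift `idx` of the indices is compatible with the action on row vectors.
  have hmod : ∀ (x : ZMod m) (a b : ℤ) (y z : ZMod m), x = a * y + b * z →
      a * idx y + b * idx z ≡ idx x [ZMOD T.modulus] := by
    intro x a b y z hx
    have h1 : a * (y.val : ℤ) + b * (z.val : ℤ) ≡ (x.val : ℤ) [ZMOD m] := by
      refine (ZMod.intCast_eq_intCast_iff _ _ _).mp ?_
      push_cast
      simp [hx]
    have h2 := h1.mul_left' (c := (t : ℤ))
    rw [htm]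
    push_cast
    simp only [hidx]
    push_cast
    convert h2 using 1
    ring
  have hU : IsPermuted 2 fun v => T.weightTwo (f v) (idx v.1) (idx v.2) := by
    intro γ
    refine ⟨rowPerm m γ, fun v => ?_⟩
    have h1 := hmod (rowPerm m γ v).1 (γ 0 0) (γ 1 0) v.1 v.2 rfl
    have h2 := hmod (rowPerm m γ v).2 (γ 0 1) (γ 1 1) v.1 v.2 rfl
    have h3 : ∀ τ : ℍ, T.φ (γ 0 0 * idx v.1 + γ 1 0 * idx v.2)
        (γ 0 1 * idx v.1 + γ 1 1 * idx v.2) τ 0 = f v := fun τ => by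
      rw [← φ_zero_modular, T.φ_zero_eq_trace_gcd hM]
    have h4 : f v = f (rowPerm m γ v) := by
      rw [← h3 UpperHalfPlane.I, T.φ_congr h1 h2, T.φ_zero_eq_trace_gcd hM]
    simp only
    rw [T.weightTwo_slash hM γ h3, T.weightTwo_congr hM _ h1 h2, h4]
  have h0 := hU.sum_coeff_zero hM fun v => T.hasQExp_weightTwo hM (f v) (idx v.1) (idx v.2)
  have hcoef : ∀ v : ZMod m × ZMod m, ((1 / 2 : ℂ) •
      T.momentCoeff (fun l => (l : ℂ) ^ 2) (idx v.1) (idx v.2) -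
        (f v / 12) • E2coeffUpper T.modulus 1 0 1) 0 =
      ∑ s ∈ Finset.range T.modulus, expTwoPiI ((s : ℂ) * v.2.val / m) *
        (T.chat (idx v.1) s 0 1 : ℂ) - f v / 12 := by
    intro v
    have h1 := T.momentCoeff_sq hM (idx v.1) (idx v.2) (k := 0) (by omega)
    simp only [Pi.sub_apply, Pi.smul_apply, smul_eq_mul, h1]
    congr 1
    · refine Finset.sum_congr rfl fun s _ => ?_
      congr 2
      · simp only [hidx, hMC]
        push_cast
        field_simp
      · simp
    · simp [E2coeffUpper, E2coeff]
  rw [Finset.sum_congr rfl fun v _ => hcoef v, Finset.sum_sub_distrib, sub_eq_zero,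
    Fintype.sum_prod_type, Fintype.sum_prod_type] at h0
  have hzmod : ∀ g : ℕ → ℂ, ∑ x : ZMod m, g x.val = ∑ i ∈ Finset.range m, g i := by
    obtain ⟨m', rfl⟩ : ∃ m', m = m' + 1 := ⟨m - 1, by omega⟩
    exact fun g => (Finset.sum_range g).symm
  have hL : ∀ x : ZMod m, ∑ y : ZMod m, ∑ s ∈ Finset.range T.modulus,
      expTwoPiI ((s : ℂ) * y.val / m) * (T.chat (idx x) s 0 1 : ℂ) =
      m * ∑ s ∈ Finset.range t, (T.chat (idx x) (m * s : ℕ) 0 1 : ℂ) := by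
    intro x
    rw [Finset.sum_comm, ← sum_range_mul_dvd hm fun s => (T.chat (idx x) (s : ℕ) 0 1 : ℂ),
      Finset.mul_sum, htm]
    refine Finset.sum_congr rfl fun s _ => ?_
    rw [← Finset.sum_mul, hzmod fun j => expTwoPiI ((s : ℂ) * j / m), sum_range_expTwoPiI hm]
    split_ifs <;> simp
  simp only [hL] at h0
  rw [← Finset.mul_sum, hzmod fun i => ∑ s ∈ Finset.range t,
    (T.chat ((t * i : ℕ) : ℤ) (m * s : ℕ) 0 1 : ℂ)] at h0
  have hR : ∑ x : ZMod m, ∑ y : ZMod m, f (x, y) / 12 = ∑ i ∈ Finset.range m,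
      ∑ j ∈ Finset.range m,
        ((π.trace (Int.gcd ((t * i : ℕ) : ℤ) ((t * j : ℕ) : ℤ)) : ℤ) : ℂ) / 12 := by
    rw [← hzmod]
    refine Finset.sum_congr rfl fun x _ => ?_
    rw [← hzmod]
  rw [hR] at h0
  simp only [← Finset.sum_div] at h0
  have : (12 * m * ∑ i ∈ Finset.range m, ∑ s ∈ Finset.range t,
      (T.chat (t * i) (m * s) 0 1 : ℂ)) = ∑ i ∈ Finset.range m, ∑ j ∈ Finset.range m,
        ((π.trace (Int.gcd ((t * i : ℕ) : ℤ) ((t * j : ℕ) : ℤ)) : ℤ) : ℂ) := by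
    push_cast at h0 ⊢
    linear_combination 12 * h0
  exact_mod_cast this

end TwistedTwiningGenera

/-! ### Eisenstein series of weight two and level nine -/

/-- A combination of the Eisenstein series `E₂(3 τ)`, `E₂(τ)`, `E₂(τ + 1 / 3)` and `E₂(τ + 2 / 3)`,
modular of weight two for `Γ₁(9)`. -/
noncomputable def levelNineForm (u v : ℂ) : ℍ → ℂ :=
  (7 / 8 : ℂ) • E2diff (upperGL 3 0 1) + u • E2diff (upperGL 3 1 3) + v • E2diff (upperGL 3 2 3)

theorem E2diff_three_slash_of_modEq {γ : SL(2, ℤ)} (h10 : (9 : ℤ) ∣ γ 1 0) :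
    E2diff (upperGL 3 0 1) ∣[(2 : ℤ)] γ = E2diff (upperGL 3 0 1) := by
  obtain ⟨e, he⟩ := h10
  have hdet := SL2_det_eq_one γ
  refine E2diff_upperGL_slash
    (γ' := ⟨!![γ 0 0, 3 * γ 0 1; 3 * e, γ 1 1], ?_⟩) ?_ ?_ ?_ ?_
  · rw [Matrix.det_fin_two_of]; rw [he] at hdet; linarith
  all_goals simp [he]
  all_goals ring

theorem E2diff_translate_slash_of_modEq (q : ℤ) {γ : SL(2, ℤ)} (h10 : (9 : ℤ) ∣ γ 1 0)
    (h11 : (9 : ℤ) ∣ γ 1 1 - 1) :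
    E2diff (upperGL 3 q 3) ∣[(2 : ℤ)] γ = E2diff (upperGL 3 q 3) := by
  obtain ⟨e, he⟩ := h10
  obtain ⟨g, hg⟩ := h11
  have hdet := SL2_det_eq_one γ
  have hg' : γ 1 1 = 1 + 9 * g := by linarith
  rw [he, hg'] at hdet
  obtain ⟨f, hf⟩ : ∃ f, γ 0 0 = 1 + 9 * f := ⟨γ 0 1 * e - γ 0 0 * g, by linarith⟩
  rw [hf] at hdet
  refine E2diff_upperGL_slash (γ' := ⟨!![1 + 9 * f + 3 * q * e,
    γ 0 1 + 3 * q * (g - f) - q ^ 2 * e; 9 * e, 1 + 9 * g - 3 * q * e], ?_⟩) ?_ ?_ ?_ ?_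
  · rw [Matrix.det_fin_two_of]; linear_combination hdet
  all_goals simp [he, hf, hg']
  all_goals ring

theorem levelNineForm_slash_of_modEq (u v : ℂ) {γ : SL(2, ℤ)} (h10 : (9 : ℤ) ∣ γ 1 0)
    (h11 : (9 : ℤ) ∣ γ 1 1 - 1) : levelNineForm u v ∣[(2 : ℤ)] γ = levelNineForm u v := by
  simp only [levelNineForm, SlashAction.add_slash, ModularForm.SL_smul_slash]
  rw [E2diff_three_slash_of_modEq h10, E2diff_translate_slash_of_modEq 1 h10 h11,
    E2diff_translate_slash_of_modEq 2 h10 h11]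

theorem levelNineForm_slash_eq (u v : ℂ) (γ : SL(2, ℤ)) :
    levelNineForm u v ∣[(2 : ℤ)] γ = (7 / 8 : ℂ) • (E2diff (upperGL 3 0 1) ∣[(2 : ℤ)] γ) +
      u • (E2diff (upperGL 3 1 3) ∣[(2 : ℤ)] γ) + v • (E2diff (upperGL 3 2 3) ∣[(2 : ℤ)] γ) := by
  simp only [levelNineForm, SlashAction.add_slash, ModularForm.SL_smul_slash]

theorem E2coeffUpper_one_eq_zero {k : ℕ} (hk : 0 < k) (hk9 : k < 9) :
    E2coeffUpper 9 1 0 1 k = 0 := by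
  rw [E2coeffUpper, if_neg]
  simp only [PNat.val_ofNat]
  omega

/-- The expansion of the slash of `E₂(3 τ)`, at cusps with denominator divisible by three. -/
theorem hasQExp_E2diff_three_of_dvd {γ : SL(2, ℤ)} (h : (3 : ℤ) ∣ γ 1 0) :
    ∃ b, HasQExp 9 (E2diff (upperGL 3 0 1) ∣[(2 : ℤ)] γ) b ∧ b 0 = 2 ∧
      ∀ k, 0 < k → k < 9 → b k = 0 := by
  obtain ⟨γ', a, d, b, hK, ha, had, -, -, -, -⟩ := exists_E2diff_slash_eq 3 0 1 γ
  have ha3 : (a : ℕ) = 3 := by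
    have h1 : (3 : ℤ) ∣ (a : ℕ) := by
      rw [ha]; exact Int.dvd_coe_gcd (by simp) (by simpa using h)
    have h2 : (a : ℕ) ∣ 3 := ⟨d, by simpa using had.symm⟩
    exact Nat.dvd_antisymm h2 (by exact_mod_cast h1)
  have hd1 : (d : ℕ) = 1 := by rw [ha3] at had; simpa using had
  obtain rfl : a = 3 := PNat.eq ha3
  obtain rfl : d = 1 := PNat.eq hd1
  rw [hK]
  refine ⟨_, hasQExp_E2diff (by norm_num) b (by simp), ?_, fun k hk hk9 => ?_⟩
  · norm_num [E2coeffUpper, E2coeff]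
  · rw [Pi.sub_apply, E2coeffUpper_one_eq_zero hk hk9, E2coeffUpper, if_neg, sub_zero]
    simp only [PNat.val_ofNat]
    omega

/-- The expansion of the slash of `E₂(3 τ)`, at cusps with denominator prime to three. -/
theorem hasQExp_E2diff_three_of_not_dvd {γ : SL(2, ℤ)} (h : ¬ (3 : ℤ) ∣ γ 1 0) :
    ∃ b, HasQExp 9 (E2diff (upperGL 3 0 1) ∣[(2 : ℤ)] γ) b ∧ b 0 = -2 / 3 ∧ b 2 = 0 := by
  obtain ⟨γ', a, d, b, hK, ha, had, -, -, -, h10⟩ := exists_E2diff_slash_eq 3 0 1 γ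
  have ha1 : (a : ℕ) = 1 := by
    have h2 : (a : ℕ) ∣ 3 := ⟨d, by simpa using had.symm⟩
    rcases (Nat.dvd_prime Nat.prime_three).mp h2 with h3 | h3
    · exact h3
    · exact absurd ⟨γ' 1 0, by rw [h3] at h10; simpa [mul_comm] using h10⟩ h
  have hd3 : (d : ℕ) = 3 := by rw [ha1] at had; simpa using had
  obtain rfl : a = 1 := PNat.eq ha1
  obtain rfl : d = 3 := PNat.eq hd3
  rw [hK]
  refine ⟨_, hasQExp_E2diff (by norm_num) b (by simp), ?_, ?_⟩
  · norm_num [E2coeffUpper, E2coeff]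
  · norm_num [E2coeffUpper, E2coeff]

/-- The expansion of the slash of `E₂(τ + q / 3)`, at cusps with denominator divisible by three. -/
theorem hasQExp_E2diff_translate_of_dvd (q : ℤ) {γ : SL(2, ℤ)} {c : ℤ} (hc : γ 1 0 = 3 * c) :
    ∃ b, HasQExp 9 (E2diff (upperGL 3 q 3) ∣[(2 : ℤ)] γ) b ∧
      b 0 = (if (3 : ℤ) ∣ γ 0 0 + q * c then 8 else 0) ∧
      (¬ (3 : ℤ) ∣ γ 0 0 + q * c → ∀ k, 0 < k → k < 9 → b k = 0) := by
  obtain ⟨γ', a, d, b, hK, ha, had, -, -, h00, h10⟩ := exists_E2diff_slash_eq 3 q 3 γ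
  have had9 : (a : ℕ) * d = 9 := by simpa using had
  have h3a : (3 : ℤ) ∣ (a : ℕ) := by
    rw [ha]
    exact Int.dvd_coe_gcd ⟨γ 0 0 + q * c, by rw [hc]; simp; ring⟩ (by simp)
  have h00' : 3 * (γ 0 0 + q * c) = γ' 0 0 * (a : ℕ) := by
    rw [hc] at h00; simp at h00; linarith
  have hcases : (a : ℕ) = 3 ∨ (a : ℕ) = 9 := by
    have h2 : (a : ℕ) ≤ 9 := Nat.le_of_dvd (by norm_num) ⟨d, had9.symm⟩
    have h3 : 3 ∣ (a : ℕ) := by exact_mod_cast h3a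
    generalize (a : ℕ) = x at *
    generalize (d : ℕ) = y at *
    interval_cases x <;> omega
  have hiff : (a : ℕ) = 9 ↔ (3 : ℤ) ∣ γ 0 0 + q * c := by
    constructor
    · intro h
      rw [h] at h00'
      exact ⟨γ' 0 0, by push_cast at h00'; linarith⟩
    · rintro ⟨x, hx⟩
      have : (9 : ℤ) ∣ (a : ℕ) := by
        rw [ha]
        refine Int.dvd_coe_gcd ⟨x, ?_⟩ ⟨c, ?_⟩
        · rw [hc]; simp; linarith
        · rw [hc]; simp; ring
      rcases hcases with h | h
      · rw [h] at this; norm_num at this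
      · exact h
  rw [hK]
  refine ⟨_, hasQExp_E2diff (by norm_num) b ⟨a * a, by rw [← had9]; ring⟩, ?_, fun hn k hk hk9 => ?_⟩
  · simp only [← hiff]
    rcases hcases with h | h
    · have hd : (d : ℕ) = 3 := by rw [h] at had9; omega
      obtain rfl : a = 3 := PNat.eq h
      obtain rfl : d = 3 := PNat.eq hd
      norm_num [E2coeffUpper, E2coeff]
    · have hd : (d : ℕ) = 1 := by rw [h] at had9; omega
      obtain rfl : a = 9 := PNat.eq h
      obtain rfl : d = 1 := PNat.eq hd
      norm_num [E2coeffUpper, E2coeff]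
  · have h := hcases.resolve_right fun h => hn (hiff.mp h)
    have hd : (d : ℕ) = 3 := by rw [h] at had9; omega
    obtain rfl : a = 3 := PNat.eq h
    obtain rfl : d = 3 := PNat.eq hd
    rw [Pi.sub_apply, E2coeffUpper_one_eq_zero hk hk9, E2coeffUpper, if_neg, sub_zero]
    simp only [PNat.val_ofNat]
    omega

/-- The expansion of the slash of `E₂(τ + q / 3)`, at cusps with denominator prime to three. The
slash is a multiple of `E₂((τ + b) / 9)`, where `b = 3 t` if nine divides the corner of `γ`. -/
theorem hasQExp_E2diff_translate_of_not_dvd {q : ℤ} (hq : ¬ (3 : ℤ) ∣ q) {γ : SL(2, ℤ)}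
    (h : ¬ (3 : ℤ) ∣ γ 1 0) :
    ∃ b, HasQExp 9 (E2diff (upperGL 3 q 3) ∣[(2 : ℤ)] γ) b ∧ b 0 = -8 / 9 ∧
      ((9 : ℤ) ∣ γ 1 1 → ∃ t : ℤ, (3 : ℤ) ∣ t * q + 1 ∧ b 2 = -8 * expTwoPiI (2 * t / 3)) := by
  obtain ⟨γ', a, d, b, hK, ha, had, h01, h11, h00, h10⟩ := exists_E2diff_slash_eq 3 q 3 γ
  have had9 : (a : ℕ) * d = 9 := by simpa using had
  have ha1 : (a : ℕ) = 1 := by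
    have h2 : (a : ℕ) ∣ 3 ^ 2 := ⟨d, had9.symm⟩
    obtain ⟨i, hi, hai⟩ := (Nat.dvd_prime_pow Nat.prime_three).mp h2
    interval_cases i
    · simpa using hai
    · exfalso
      rw [hai] at h00
      simp at h00
      rcases Int.prime_three.dvd_or_dvd (a := q) (b := γ 1 0) ⟨γ' 0 0 - γ 0 0, by linarith⟩ with h3 | h3
      · exact hq h3
      · exact h h3
    · exfalso
      rw [hai] at h10
      simp at h10
      exact h ⟨γ' 1 0, by linarith⟩
  have hd : (d : ℕ) = 9 := by rw [ha1] at had9; omega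
  obtain rfl : a = 1 := PNat.eq ha1
  obtain rfl : d = 9 := PNat.eq hd
  rw [hK]
  refine ⟨_, hasQExp_E2diff (by norm_num) b (by simp), ?_, fun h9 => ?_⟩
  · norm_num [E2coeffUpper, E2coeff]
  · obtain ⟨g, hg⟩ := h9
    have hdet := SL2_det_eq_one γ
    simp at h00 h01
    rw [hg] at hdet h01
    have h3 : ¬ (3 : ℤ) ∣ γ' 0 0 := by
      rw [← h00]
      rintro ⟨x, hx⟩
      rcases Int.prime_three.dvd_or_dvd (a := q) (b := γ 1 0) ⟨x - γ 0 0, by linarith⟩ with h3 | h3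
      · exact hq h3
      · exact h h3
    obtain ⟨t, rfl⟩ : (3 : ℤ) ∣ b :=
      (Int.prime_three.dvd_or_dvd (a := γ' 0 0) (b := b)
        ⟨γ 0 1 + 3 * q * g - 3 * γ' 0 1, by linarith⟩).resolve_left h3
    refine ⟨t, ?_, ?_⟩
    · rw [← h00] at h01
      obtain ⟨w, hw⟩ : ∃ w, γ 1 0 ^ 2 = 1 + 3 * w := by
        have : γ 1 0 % 3 = 1 ∨ γ 1 0 % 3 = 2 := by omega
        rcases this with h4 | h4
        · exact ⟨3 * (γ 1 0 / 3) ^ 2 + 2 * (γ 1 0 / 3), by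
            have := Int.emod_add_mul_ediv (γ 1 0) 3
            rw [h4] at this; nth_rewrite 1 [← this]; ring⟩
        · exact ⟨3 * (γ 1 0 / 3) ^ 2 + 4 * (γ 1 0 / 3) + 1, by
            have := Int.emod_add_mul_ediv (γ 1 0) 3
            rw [h4] at this; nth_rewrite 1 [← this]; ring⟩
      refine ⟨3 * γ 0 0 * g + q * g * γ 1 0 - γ 0 0 * t * γ 1 0 - γ' 0 1 * γ 1 0 - q * t * w, ?_⟩
      have h01' : γ 0 1 + 3 * q * g = (3 * γ 0 0 + q * γ 1 0) * t + 3 * γ' 0 1 := by linarith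
      linear_combination (-(γ 1 0 : ℤ)) * h01' - hdet - q * t * hw
    · have hσ : ArithmeticFunction.sigma 1 2 = 3 := by decide
      rw [Pi.sub_apply, E2coeffUpper_one_eq_zero (by norm_num) (by norm_num), sub_zero,
        E2coeffUpper, if_pos (by simp)]
      norm_num [E2coeff, hσ]
      congr 1
      ring

/-- Cube roots of unity as powers of `exp(2 π i / 3)` with exponent reduced modulo three. -/
theorem expTwoPiI_third_eq {x : ℂ} {r : ℤ} {w : ℤ} (h : x = (r : ℂ) / 3 + w) :
    expTwoPiI x = expTwoPiI (1 / 3) ^ (r % 3).toNat := by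
  have h1 : ((r % 3).toNat : ℤ) = r % 3 := Int.toNat_of_nonneg (Int.emod_nonneg _ (by norm_num))
  have h2 : r = r % 3 + 3 * (r / 3) := (Int.emod_add_mul_ediv r 3).symm
  have h3 : (r : ℂ) = ((r % 3).toNat : ℂ) + 3 * ((r / 3 : ℤ) : ℂ) := by
    have : (r : ℂ) = ((r % 3 : ℤ) : ℂ) + 3 * ((r / 3 : ℤ) : ℂ) := by exact_mod_cast h2
    rw [this, ← h1]
    push_cast
    rfl
  rw [← expTwoPiI_nsmul, h, h3, show (((r % 3).toNat : ℂ) + 3 * ((r / 3 : ℤ) : ℂ)) / 3 + w =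
    (r % 3).toNat * (1 / 3) + ((r / 3 + w : ℤ) : ℂ) by push_cast; ring, expTwoPiI_add,
    expTwoPiI_int, mul_one]

theorem one_add_expTwoPiI_third :
    1 + expTwoPiI (1 / 3) + expTwoPiI (1 / 3) ^ 2 = 0 := by
  have := sum_range_expTwoPiI (m := 3) (by norm_num) 1
  rw [if_neg (by norm_num)] at this
  rw [← this, Finset.sum_range_succ, Finset.sum_range_succ, Finset.sum_range_succ,
    Finset.sum_range_zero, ← expTwoPiI_nsmul]
  norm_num

theorem hasQExp_levelNineForm_of_nine_dvd (u v : ℂ) {γ : SL(2, ℤ)} (h : (9 : ℤ) ∣ γ 1 0) :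
    ∃ b, HasQExp 9 (levelNineForm u v ∣[(2 : ℤ)] γ) b ∧ b 0 = 7 / 4 ∧
      ∀ k, 0 < k → k < 9 → b k = 0 := by
  obtain ⟨c, hc⟩ := h
  have hdet := SL2_det_eq_one γ
  have h3 : ∀ q : ℤ, ¬ (3 : ℤ) ∣ γ 0 0 + q * (3 * c) := by
    rintro q ⟨x, hx⟩
    have h4 : (3 : ℤ) ∣ 1 := by
      rw [← hdet, hc]
      exact ⟨(x - q * c) * γ 1 1 - 3 * γ 0 1 * c, by linear_combination γ 1 1 * hx⟩
    norm_num at h4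
  obtain ⟨b₀, hb₀, h₀, h₀'⟩ := hasQExp_E2diff_three_of_dvd (γ := γ) ⟨3 * c, by rw [hc]; ring⟩
  obtain ⟨b₁, hb₁, h₁, h₁'⟩ := hasQExp_E2diff_translate_of_dvd 1 (γ := γ) (c := 3 * c)
    (by rw [hc]; ring)
  obtain ⟨b₂, hb₂, h₂, h₂'⟩ := hasQExp_E2diff_translate_of_dvd 2 (γ := γ) (c := 3 * c)
    (by rw [hc]; ring)
  rw [levelNineForm_slash_eq]
  refine ⟨_, ((hb₀.smul _).add (hb₁.smul u)).add (hb₂.smul v), ?_, fun k hk hk9 => ?_⟩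
  · simp only [Pi.add_apply, Pi.smul_apply, smul_eq_mul, h₀, h₁, h₂, if_neg (h3 _)]
    norm_num
  · simp [h₀' k hk hk9, h₁' (h3 1) k hk hk9, h₂' (h3 2) k hk hk9]

theorem hasQExp_levelNineForm_of_three_dvd (u v : ℂ) {γ : SL(2, ℤ)} {c : ℤ}
    (hc : γ 1 0 = 3 * c) : ∃ b, HasQExp 9 (levelNineForm u v ∣[(2 : ℤ)] γ) b ∧
      b 0 = 7 / 4 + (if (3 : ℤ) ∣ γ 0 0 + 1 * c then 8 * u else 0) +
        (if (3 : ℤ) ∣ γ 0 0 + 2 * c then 8 * v else 0) := by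
  obtain ⟨b₀, hb₀, h₀, -⟩ := hasQExp_E2diff_three_of_dvd (γ := γ) ⟨c, hc⟩
  obtain ⟨b₁, hb₁, h₁, -⟩ := hasQExp_E2diff_translate_of_dvd 1 hc
  obtain ⟨b₂, hb₂, h₂, -⟩ := hasQExp_E2diff_translate_of_dvd 2 hc
  rw [levelNineForm_slash_eq]
  refine ⟨_, ((hb₀.smul _).add (hb₁.smul u)).add (hb₂.smul v), ?_⟩
  simp only [Pi.add_apply, Pi.smul_apply, smul_eq_mul, h₀, h₁, h₂]
  split_ifs <;> ring

theorem hasQExp_levelNineForm_of_not_dvd (u v : ℂ) {γ : SL(2, ℤ)} (h : ¬ (3 : ℤ) ∣ γ 1 0) :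
    ∃ b, HasQExp 9 (levelNineForm u v ∣[(2 : ℤ)] γ) b ∧ b 0 = -7 / 12 - 8 / 9 * (u + v) ∧
      ((9 : ℤ) ∣ γ 1 1 →
        b 2 = -8 * (u * expTwoPiI (1 / 3) + v * expTwoPiI (1 / 3) ^ 2)) := by
  obtain ⟨b₀, hb₀, h₀, h₀'⟩ := hasQExp_E2diff_three_of_not_dvd h
  obtain ⟨b₁, hb₁, h₁, h₁'⟩ := hasQExp_E2diff_translate_of_not_dvd (q := 1) (by norm_num) h
  obtain ⟨b₂, hb₂, h₂, h₂'⟩ := hasQExp_E2diff_translate_of_not_dvd (q := 2) (by norm_num) h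
  rw [levelNineForm_slash_eq]
  refine ⟨_, ((hb₀.smul _).add (hb₁.smul u)).add (hb₂.smul v), ?_, fun h9 => ?_⟩
  · simp only [Pi.add_apply, Pi.smul_apply, smul_eq_mul, h₀, h₁, h₂]
    ring
  · obtain ⟨t₁, ht₁, e₁⟩ := h₁' h9
    obtain ⟨t₂, ht₂, e₂⟩ := h₂' h9
    have m₁ : (2 * t₁) % 3 = 1 := by omega
    have m₂ : (2 * t₂) % 3 = 2 := by omega
    rw [expTwoPiI_third_eq (r := 2 * t₁) (w := 0) (by push_cast; ring), m₁] at e₁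
    rw [expTwoPiI_third_eq (r := 2 * t₂) (w := 0) (by push_cast; ring), m₂] at e₂
    simp only [Pi.add_apply, Pi.smul_apply, smul_eq_mul, h₀', e₁, e₂]
    simp
    ring

/-- The slash by `γ` of a `Γ₁(9)`-invariant function depends on the bottom row of `γ` modulo nine
only. -/
theorem slash_eq_of_bottom_row {G : ℍ → ℂ} (hG : ∀ ε : SL(2, ℤ), (9 : ℤ) ∣ ε 1 0 →
    (9 : ℤ) ∣ ε 1 1 - 1 → G ∣[(2 : ℤ)] ε = G) {γ δ : SL(2, ℤ)}
    (h0 : (γ 1 0 : ZMod 9) = δ 1 0) (h1 : (γ 1 1 : ZMod 9) = δ 1 1) :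
    G ∣[(2 : ℤ)] γ = G ∣[(2 : ℤ)] δ := by
  have hd := congrArg (Int.cast : ℤ → ZMod 9) (SL2_det_eq_one δ)
  push_cast at hd
  have h2 := hG (γ * δ⁻¹) ?_ ?_
  · rw [show γ = γ * δ⁻¹ * δ by group, SlashAction.slash_mul, h2]
  · refine (ZMod.intCast_zmod_eq_zero_iff_dvd _ 9).mp ?_
    simp [Matrix.mul_apply, Fin.sum_univ_two, Matrix.SpecialLinearGroup.coe_inv,
      Matrix.adjugate_fin_two, h0, h1]
    ring
  · refine (ZMod.intCast_zmod_eq_zero_iff_dvd _ 9).mp ?_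
    simp [Matrix.mul_apply, Fin.sum_univ_two, Matrix.SpecialLinearGroup.coe_inv,
      Matrix.adjugate_fin_two, h0, h1]
    linear_combination hd

/-! ### The Frame shape of order nine -/

/-- The Frame shape `1^3 3^-2 9^3`. -/
abbrev frameShapeNine : FrameShape := [(1, 3), (3, -2), (9, 3)]

theorem eq_frameShapeNine {π : FrameShape} {lam : ℕ} (hπ : (π, lam) ∈ k3FrameShapes)
    (h : π.order = 9) : π = frameShapeNine ∧ lam = 1 := by
  have : ∀ p ∈ k3FrameShapes, p.1.order = 9 → p.1 = frameShapeNine ∧ p.2 = 1 := by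
    decide +kernel
  exact this _ hπ h

/-- A primitive row vector modulo nine is the bottom row of a unimodular matrix. -/
theorem exists_SL2_bottom_row_nine (v : ZMod 9 × ZMod 9) (hv : ¬ (3 * v.1 = 0 ∧ 3 * v.2 = 0)) :
    ∃ γ : SL(2, ℤ), (γ 1 0 : ZMod 9) = v.1 ∧ (γ 1 1 : ZMod 9) = v.2 := by
  have key : ∀ v : ZMod 9 × ZMod 9, ¬ (3 * v.1 = 0 ∧ 3 * v.2 = 0) → ∃ a ∈ Finset.range 10,
      ∃ b ∈ Finset.range 19, (a : ZMod 9) = v.1 ∧ (b : ZMod 9) = v.2 ∧ Nat.Coprime a b := by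
    decide +kernel
  obtain ⟨a, -, b, -, ha, hb, hab⟩ := key v hv
  obtain ⟨γ, h0, h1⟩ := (Nat.isCoprime_iff_coprime.mpr hab).exists_SL2_row 1
  exact ⟨γ, by rw [h0, ← ha]; simp, by rw [h1, ← hb]; simp⟩

namespace TwistedTwiningGenera

/-- The exponents of the sector `(r, s)` lie in `r s / M + ℤ`. -/
theorem modEq_of_chat_ne_zero {π : FrameShape} {lam : ℕ} (T : TwistedTwiningGenera π lam)
    (hM : 0 < T.modulus) {r s k l : ℤ} (h : T.chat r s ((k : ℚ) / T.modulus) l ≠ 0) :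
    r * s ≡ k [ZMOD T.modulus] := by
  obtain ⟨-, w, hw⟩ := T.chat_support h
  have hMQ : (T.modulus : ℚ) ≠ 0 := by exact_mod_cast hM.ne'
  rw [Int.modEq_iff_dvd]
  refine ⟨w, ?_⟩
  field_simp at hw
  have : (k : ℚ) = r * s + T.modulus * w := by linarith
  have : k = r * s + T.modulus * w := by exact_mod_cast this
  linarith

variable (T : TwistedTwiningGenera frameShapeNine 1)

theorem modulus_eq_nine : T.modulus = 9 :=
  show frameShapeNine.order * 1 = 9 by decide +kernel

theorem chat_nine_congr {r s r' s' : ℤ} (hr : r ≡ r' [ZMOD 9]) (hs : s ≡ s' [ZMOD 9]) (n : ℚ)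
    (l : ℤ) : T.chat r s n l = T.chat r' s' n l :=
  T.chat_congr (by simp [modulus_eq_nine]) (by simpa [modulus_eq_nine] using hr)
    (by simpa [modulus_eq_nine] using hs) n l

theorem chat_nine_neg {r s r' s' : ℤ} (hr : -r ≡ r' [ZMOD 9]) (hs : -s ≡ s' [ZMOD 9]) :
    T.chat r' s' 0 1 = T.chat r s 0 1 := by
  have hM : 0 < T.modulus := by simp [modulus_eq_nine]
  rw [← T.chat_nine_congr hr hs, T.chat_neg hM]
  exact T.chat_eq_of_discr_eq hM _ _ (by decide) (by norm_num)

theorem chat_nine_zero_eq_zero {r s : ℤ} (h : ¬ (9 : ℤ) ∣ r * s) : T.chat r s 0 1 = 0 := by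
  by_contra h0
  have := T.modEq_of_chat_ne_zero (k := 0) (by simp [modulus_eq_nine]) (by simpa using h0)
  rw [modulus_eq_nine, Int.modEq_zero_iff_dvd] at this
  exact h this

/-- The multiplicities of the states of discriminant `-1` in the twisted sectors: the relations
between constant terms and the signs imposed by the contour determine all but one of them. -/
theorem chat_nine_values (hπ : (frameShapeNine, 1) ∈ k3FrameShapes)
    (hC : T.StandardContourAssumption) :
    T.chat 3 0 0 1 = 0 ∧ T.chat 3 3 0 1 + T.chat 3 6 0 1 = -1 ∧ T.chat 3 6 0 1 ≤ 0 ∧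
      ∀ c : ℤ, ¬ (3 : ℤ) ∣ c → T.chat c 0 0 1 = 0 := by
  have h9 := T.modulus_eq_nine
  have hM : 0 < T.modulus := by rw [h9]; norm_num
  have hord : frameShapeNine.order = 9 := by decide +kernel
  have e0 := T.chat_zero_zero hM
  have hz : ∀ s : ℤ, ¬ (9 : ℤ) ∣ s → T.chat 0 s 0 1 = 0 := fun s hs =>
    T.chat_zero_eq_zero hM (by rw [h9]; exact_mod_cast hs)
  have r3 := T.sum_chat_eq_sum_trace (t := 3) (m := 3) (by norm_num) hM (by rw [h9])
  have r9 := T.sum_chat_eq_sum_trace (t := 1) (m := 9) (by norm_num) hM (by rw [h9])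
  rw [show ∑ i ∈ Finset.range 3, ∑ j ∈ Finset.range 3, frameShapeNine.trace
    (Int.gcd ((3 * i : ℕ) : ℤ) ((3 * j : ℕ) : ℤ)) = 0 by decide +kernel] at r3
  rw [show ∑ i ∈ Finset.range 9, ∑ j ∈ Finset.range 9, frameShapeNine.trace
    (Int.gcd ((1 * i : ℕ) : ℤ) ((1 * j : ℕ) : ℤ)) = 216 by decide +kernel] at r9
  simp [Finset.sum_range_succ] at r3 r9
  have hq : ∀ c : ℕ, 0 < c → c < 9 → T.chat c 0 0 1 ≤ 0 := by
    intro c hc hc9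
    have := liftExp_nonpos hπ T hC (m := c) (n := 0) (l := 1) hc
      (by rw [hord]; omega) (by norm_num) (by norm_num)
    simpa [liftExp] using this
  have h36 : T.chat 3 6 0 1 ≤ 0 := by
    have := liftExp_nonpos hπ T hC (m := 3) (n := 6) (l := 3) (by norm_num)
      (by rw [hord]; norm_num) (by rw [h9]; norm_num) (by rw [h9]; norm_num)
    rw [T.chat_eq_of_discr_eq hM 3 6 (n' := 2) (l' := 3) (by decide) (by norm_num)]
    simp [liftExp, h9] at this
    norm_num at this
    exact this
  have q1 := hq 1 (by norm_num) (by norm_num)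
  have q2 := hq 2 (by norm_num) (by norm_num)
  have q3 := hq 3 (by norm_num) (by norm_num)
  have q4 := hq 4 (by norm_num) (by norm_num)
  have q5 := hq 5 (by norm_num) (by norm_num)
  have q6 := hq 6 (by norm_num) (by norm_num)
  have q7 := hq 7 (by norm_num) (by norm_num)
  have q8 := hq 8 (by norm_num) (by norm_num)
  have z3 := hz 3 (by norm_num)
  have z6 := hz 6 (by norm_num)
  have n0 := T.chat_nine_neg (r := 3) (s := 0) (r' := 6) (s' := 0) (by decide) (by decide)
  have n3 := T.chat_nine_neg (r := 3) (s := 6) (r' := 6) (s' := 3) (by decide) (by decide)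
  have n6 := T.chat_nine_neg (r := 3) (s := 3) (r' := 6) (s' := 6) (by decide) (by decide)
  simp at q1 q2 q3 q4 q5 q6 q7 q8
  refine ⟨by linarith, by linarith, h36, fun c hc => ?_⟩
  rw [T.chat_nine_congr (r' := c % 9) (s' := 0) (Int.mod_modEq c 9).symm (by decide)]
  have : c % 9 = 1 ∨ c % 9 = 2 ∨ c % 9 = 4 ∨ c % 9 = 5 ∨ c % 9 = 7 ∨ c % 9 = 8 := by omega
  rcases this with h | h | h | h | h | h <;> rw [h] <;> linarith

theorem hasQExp_weightTwo_nine (f : ℂ) (i j : ℤ) : ∃ b, HasQExp 9 (T.weightTwo f i j) b ∧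
    (∀ k : ℕ, k < 6 → b k = ∑ s ∈ Finset.range 9, expTwoPiI ((s : ℂ) * j / 9) *
      (T.chat i s ((k : ℚ) / 9) 1 : ℂ) - f / 12 * E2coeffUpper 9 1 0 1 k) ∧
    ((9 : ℤ) ∣ i → ∀ k, 0 < k → k < 9 → b k = 0) := by
  have h9 := T.modulus_eq_nine
  have hM : 0 < T.modulus := by rw [h9]; norm_num
  have h1 := T.hasQExp_weightTwo hM f i j
  rw [h9] at h1
  refine ⟨_, h1, fun k hk => ?_, fun hi k hk hk9 => ?_⟩
  · simp only [Pi.sub_apply, Pi.smul_apply, smul_eq_mul]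
    rw [T.momentCoeff_sq hM i j (by rw [h9]; omega), h9]
    rfl
  · simp only [Pi.sub_apply, Pi.smul_apply, smul_eq_mul, E2coeffUpper_one_eq_zero hk hk9, momentCoeff]
    rw [mul_zero, sub_zero, Finset.sum_eq_zero, mul_zero]
    intro s _
    have : ∀ l : ℤ, T.chat i s ((k : ℚ) / T.modulus) l = 0 := by
      intro l
      by_contra h0
      have h2 := T.modEq_of_chat_ne_zero (k := (k : ℤ)) hM (by simpa using h0)
      rw [h9] at h2
      have h3 : (9 : ℤ) ∣ k := by simpa using h2.dvd.add (hi.mul_right (s : ℤ))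
      omega
    simp [this]

/-- The constant terms of the weight-two forms of the genera `φ_{g ^ c, g ^ d}` agree with those of
the Eisenstein series, whose parameters `u`, `v` are chosen for this purpose, and in the untwisted
sectors the difference vanishes to first order. -/
theorem hasQExp_weightTwo_sub_levelNineForm (hπ : (frameShapeNine, 1) ∈ k3FrameShapes)
    (hC : T.StandardContourAssumption) {x u v : ℂ} (hx : x = T.chat 3 6 0 1)
    (hu : 8 * u = (-1 - x) * expTwoPiI (1 / 3) ^ 2 + x * expTwoPiI (1 / 3) - 2)
    (hv : 8 * v = (-1 - x) * expTwoPiI (1 / 3) + x * expTwoPiI (1 / 3) ^ 2 - 2) (γ : SL(2, ℤ)) :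
    ∃ b, HasQExp 9 (T.weightTwo 3 (γ 1 0) (γ 1 1) - levelNineForm u v ∣[(2 : ℤ)] γ) b ∧ b 0 = 0 ∧
      ((9 : ℤ) ∣ γ 1 0 → ∀ k, k < 9 → b k = 0) := by
  have h9 := T.modulus_eq_nine
  have hM : 0 < T.modulus := by rw [h9]; norm_num
  obtain ⟨hx0, hx12, -, hQ⟩ := T.chat_nine_values hπ hC
  have hx1 : (T.chat 3 3 0 1 : ℂ) = -1 - x := by
    have : (T.chat 3 3 0 1 : ℂ) + T.chat 3 6 0 1 = -1 := by exact_mod_cast hx12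
    rw [hx]; linear_combination this
  have hω := one_add_expTwoPiI_third
  have hdet := SL2_det_eq_one γ
  obtain ⟨b, hb, hb0, hb'⟩ := T.hasQExp_weightTwo_nine 3 (γ 1 0) (γ 1 1)
  have hE : E2coeffUpper 9 1 0 1 0 = 1 := by simp [E2coeffUpper, E2coeff]
  have hb0 := hb0 0 (by norm_num)
  rw [hE, Nat.cast_zero, zero_div] at hb0
  by_cases hc9 : (9 : ℤ) ∣ γ 1 0
  · obtain ⟨e, he, he0, he'⟩ := hasQExp_levelNineForm_of_nine_dvd u v hc9
    have h0 : b 0 = 7 / 4 := by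
      have h1 : ∀ s : ℕ, T.chat (γ 1 0) s 0 1 = T.chat 0 s 0 1 := fun s =>
        T.chat_nine_congr (Int.modEq_zero_iff_dvd.mpr hc9) (Int.ModEq.refl _) _ _
      rw [hb0, Finset.sum_eq_single 0]
      · rw [h1, Nat.cast_zero, Nat.cast_zero, T.chat_zero_zero hM]
        norm_num [expTwoPiI_zero]
      · intro s hs hs0
        rw [h1, T.chat_zero_eq_zero hM (by rw [h9]; simp at hs; omega)]
        simp
      · simp
    refine ⟨_, hb.sub he, by simp [h0, he0], fun _ k hk => ?_⟩
    rcases Nat.eq_zero_or_pos k with rfl | hk0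
    · simp [h0, he0]
    · simp [hb' hc9 k hk0 hk, he' k hk0 hk]
  by_cases hc3 : (3 : ℤ) ∣ γ 1 0
  · obtain ⟨c, hc⟩ := hc3
    obtain ⟨e, he, he0⟩ := hasQExp_levelNineForm_of_three_dvd u v hc
    refine ⟨_, hb.sub he, ?_, fun h => absurd h hc9⟩
    rw [Pi.sub_apply, hb0, he0]
    have hmul : (γ 0 0 * γ 1 1) % 3 = 1 := by
      have : γ 0 0 * γ 1 1 = 1 + 3 * (γ 0 1 * c) := by rw [hc] at hdet; linarith
      omega
    have hs0 : ∀ s : ℤ, ¬ (3 : ℤ) ∣ s → T.chat (γ 1 0) s 0 1 = 0 := fun s hs => by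
      refine T.chat_nine_zero_eq_zero ?_
      rw [hc]
      rintro ⟨w, hw⟩
      rcases Int.prime_three.dvd_or_dvd (a := c) (b := s) ⟨w, by linarith⟩ with ⟨w', rfl⟩ | h
      · exact hc9 ⟨w', by rw [hc]; ring⟩
      · exact hs h
    have hsum : ∑ s ∈ Finset.range 9, expTwoPiI ((s : ℂ) * γ 1 1 / 9) *
        (T.chat (γ 1 0) s 0 1 : ℂ) = T.chat (γ 1 0) 0 0 1 +
          expTwoPiI (1 / 3) ^ (γ 1 1 % 3).toNat * T.chat (γ 1 0) 3 0 1 +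
          expTwoPiI (1 / 3) ^ (2 * γ 1 1 % 3).toNat * T.chat (γ 1 0) 6 0 1 := by
      simp only [Finset.sum_range_succ, Finset.sum_range_zero]
      push_cast
      rw [hs0 1 (by norm_num), hs0 2 (by norm_num), hs0 4 (by norm_num), hs0 5 (by norm_num),
        hs0 7 (by norm_num), hs0 8 (by norm_num),
        expTwoPiI_third_eq (x := 3 * (γ 1 1 : ℂ) / 9) (r := γ 1 1) (w := 0) (by push_cast; ring),
        expTwoPiI_third_eq (x := 6 * (γ 1 1 : ℂ) / 9) (r := 2 * γ 1 1) (w := 0)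
          (by push_cast; ring)]
      simp [expTwoPiI_zero]
    have hcase : (γ 0 0 % 3 = 1 ∧ γ 1 1 % 3 = 1) ∨ (γ 0 0 % 3 = 2 ∧ γ 1 1 % 3 = 2) := by
      rw [Int.mul_emod] at hmul
      have ha : γ 0 0 % 3 = 0 ∨ γ 0 0 % 3 = 1 ∨ γ 0 0 % 3 = 2 := by omega
      have hd : γ 1 1 % 3 = 0 ∨ γ 1 1 % 3 = 1 ∨ γ 1 1 % 3 = 2 := by omega
      rcases ha with ha | ha | ha <;> rcases hd with hd | hd | hd <;> simp [ha, hd] at hmul ⊢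
    generalize expTwoPiI (1 / 3) = ω at hu hv hsum
    have hcc : c % 3 = 1 ∨ c % 3 = 2 := by omega
    rw [hsum]
    rcases hcc with hcc | hcc
    · have h3 : γ 1 0 ≡ 3 [ZMOD 9] := by rw [Int.ModEq]; omega
      rw [T.chat_nine_congr h3 (Int.ModEq.refl 0), T.chat_nine_congr h3 (Int.ModEq.refl 3),
        T.chat_nine_congr h3 (Int.ModEq.refl 6), hx0, hx1, ← hx]
      rcases hcase with ⟨ha, hd⟩ | ⟨ha, hd⟩
      · rw [if_neg (by omega), if_pos (by omega), hd, show 2 * γ 1 1 % 3 = 2 by omega]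
        simp
        linear_combination -hv
      · rw [if_pos (by omega), if_neg (by omega), hd, show 2 * γ 1 1 % 3 = 1 by omega]
        simp
        linear_combination -hu
    · have h3 : γ 1 0 ≡ 6 [ZMOD 9] := by rw [Int.ModEq]; omega
      rw [T.chat_nine_congr h3 (Int.ModEq.refl 0), T.chat_nine_congr h3 (Int.ModEq.refl 3),
        T.chat_nine_congr h3 (Int.ModEq.refl 6),
        T.chat_nine_neg (r := 3) (s := 0) (r' := 6) (s' := 0) (by decide) (by decide),
        T.chat_nine_neg (r := 3) (s := 6) (r' := 6) (s' := 3) (by decide) (by decide),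
        T.chat_nine_neg (r := 3) (s := 3) (r' := 6) (s' := 6) (by decide) (by decide), hx0, hx1, ← hx]
      rcases hcase with ⟨ha, hd⟩ | ⟨ha, hd⟩
      · rw [if_pos (by omega), if_neg (by omega), hd, show 2 * γ 1 1 % 3 = 2 by omega]
        simp
        linear_combination -hu
      · rw [if_neg (by omega), if_pos (by omega), hd, show 2 * γ 1 1 % 3 = 1 by omega]
        simp
        linear_combination -hv
  · obtain ⟨e, he, he0, -⟩ := hasQExp_levelNineForm_of_not_dvd u v hc3
    refine ⟨_, hb.sub he, ?_, fun h => absurd h hc9⟩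
    rw [Pi.sub_apply, hb0, he0, Finset.sum_eq_zero]
    · linear_combination (1 / 9 : ℂ) * hu + (1 / 9 : ℂ) * hv - (1 / 9 : ℂ) * hω
    · intro s hs
      rcases Nat.eq_zero_or_pos s with rfl | hs0
      · simp [hQ _ hc3]
      · rw [T.chat_nine_zero_eq_zero]
        · simp
        · intro h
          have h1 : IsCoprime (9 : ℤ) (γ 1 0) := by
            have : IsCoprime ((3 : ℤ) ^ 2) (γ 1 0) :=
              ((Int.prime_three.coprime_iff_not_dvd).mpr hc3).pow_left
            simpa using this
          have h2 := h1.dvd_of_dvd_mul_left h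
          simp at hs
          omega

/-- The weight-two form of the sector `(0, 1)` is the Eisenstein series: there are 72 cosets, and
the difference vanishes to order `1` at the six cosets with bottom row `(0, d)` and to order `1 / 9`
at the others. The total `6 + 66 / 9` exceeds the bound `72 / 6` of weight two. -/
theorem weightTwo_eq_levelNineForm_slash (hπ : (frameShapeNine, 1) ∈ k3FrameShapes)
    (hC : T.StandardContourAssumption) {x u v : ℂ} (hx : x = T.chat 3 6 0 1)
    (hu : 8 * u = (-1 - x) * expTwoPiI (1 / 3) ^ 2 + x * expTwoPiI (1 / 3) - 2)
    (hv : 8 * v = (-1 - x) * expTwoPiI (1 / 3) + x * expTwoPiI (1 / 3) ^ 2 - 2) (γ : SL(2, ℤ)) :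
    T.weightTwo 3 (γ 1 0) (γ 1 1) = levelNineForm u v ∣[(2 : ℤ)] γ := by
  have h9 := T.modulus_eq_nine
  have hM : 0 < T.modulus := by rw [h9]; norm_num
  have hW : ∀ δ : SL(2, ℤ), T.weightTwo 3 0 1 ∣[(2 : ℤ)] δ = T.weightTwo 3 (δ 1 0) (δ 1 1) := by
    intro δ
    have h1 := T.weightTwo_slash hM (f := 3) (i := 0) (j := 1) δ fun τ => by
      have := T.φ_zero_eq_trace hM 1 δ τ
      rw [show frameShapeNine.trace 1 = 3 by decide +kernel] at this
      simpa using this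
    simpa using h1
  set G : ℍ → ℂ := T.weightTwo 3 0 1 - levelNineForm u v with hGdef
  have hGs : ∀ δ : SL(2, ℤ), G ∣[(2 : ℤ)] δ =
      T.weightTwo 3 (δ 1 0) (δ 1 1) - levelNineForm u v ∣[(2 : ℤ)] δ := by
    intro δ
    rw [hGdef, sub_eq_add_neg, SlashAction.add_slash, SlashAction.neg_slash, hW, ← sub_eq_add_neg]
  have hG : ∀ ε : SL(2, ℤ), (9 : ℤ) ∣ ε 1 0 → (9 : ℤ) ∣ ε 1 1 - 1 → G ∣[(2 : ℤ)] ε = G := by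
    intro ε h0 h1
    rw [hGs, levelNineForm_slash_of_modEq u v h0 h1, T.weightTwo_congr hM 3 (i' := 0) (j' := 1)]
    · rw [h9]; exact Int.modEq_zero_iff_dvd.mpr h0
    · rw [h9]; exact (Int.modEq_iff_dvd.mpr h1).symm
  choose row hrow0 hrow1 using
    fun w : {w : ZMod 9 × ZMod 9 // ¬ (3 * w.1 = 0 ∧ 3 * w.2 = 0)} =>
      exists_SL2_bottom_row_nine w.1 w.2
  choose b hb hb0 hb9 using fun w =>
    T.hasQExp_weightTwo_sub_levelNineForm hπ hC hx hu hv (row w)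
  have hperm : IsPermuted ((2 : ℕ) : ℤ) fun w => G ∣[(2 : ℤ)] row w := by
    intro ε
    have hd := congrArg (Int.cast : ℤ → ZMod 9) (SL2_det_eq_one ε)
    push_cast at hd
    refine ⟨(rowPerm 9 ε).subtypePerm fun w => not_congr ?_, fun w => ?_⟩
    · simp only [rowPerm, Equiv.coe_fn_mk]
      constructor
      · rintro ⟨h1, h2⟩
        constructor
        · linear_combination (ε 1 1 : ZMod 9) * h1 - (ε 1 0 : ZMod 9) * h2 - 3 * w.1 * hd
        · linear_combination (ε 0 0 : ZMod 9) * h2 - (ε 0 1 : ZMod 9) * h1 - 3 * w.2 * hd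
      · rintro ⟨h1, h2⟩
        constructor
        · linear_combination (ε 0 0 : ZMod 9) * h1 + (ε 1 0 : ZMod 9) * h2
        · linear_combination (ε 0 1 : ZMod 9) * h1 + (ε 1 1 : ZMod 9) * h2
    · change (G ∣[(2 : ℤ)] row w) ∣[(2 : ℤ)] ε = _
      rw [← SlashAction.slash_mul]
      refine slash_eq_of_bottom_row hG ?_ ?_
      · rw [hrow0]
        simp [Matrix.mul_apply, Fin.sum_univ_two, hrow0, hrow1, rowPerm]
        ring
      · rw [hrow1]
        simp [Matrix.mul_apply, Fin.sum_univ_two, hrow0, hrow1, rowPerm]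
        ring
  obtain ⟨w, hw⟩ := hperm.exists_eq_zero (h := 9) (by norm_num) (b := b)
    (fun w => by simp only [hGs]; exact hb w) (fun w => if w.1.1 = 0 then 9 else 1)
    (fun w k hk => by
      by_cases h : w.1.1 = 0
      · rw [if_pos h] at hk
        refine hb9 w ((ZMod.intCast_zmod_eq_zero_iff_dvd _ 9).mp ?_) k hk
        rw [hrow0, h]
      · rw [if_neg h] at hk
        rw [Nat.lt_one_iff.mp hk, hb0])
    (by decide +kernel)
  have hG0 : G = 0 := by
    have hw : G ∣[(2 : ℤ)] row w = 0 := hw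
    have := congrArg (fun F => F ∣[(2 : ℤ)] (row w)⁻¹) hw
    simpa [← SlashAction.slash_mul] using this
  rw [← sub_eq_zero, ← hGs, hG0, SlashAction.zero_slash]

/-- In order nine the coefficients of discriminant `-1 / 9` of the twisted sectors are three times
the coefficient `chat 3 6 0 1` of discriminant `-1`. -/
theorem chat_nine_eq_three_mul (hπ : (frameShapeNine, 1) ∈ k3FrameShapes)
    (hC : T.StandardContourAssumption) {c s : ℤ} (hcs : c * s ≡ 2 [ZMOD 9]) :
    T.chat c s (2 / 9) 1 = 3 * T.chat 3 6 0 1 := by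
  have h9 := T.modulus_eq_nine
  have hM : 0 < T.modulus := by rw [h9]; norm_num
  have hc3 : ¬ (3 : ℤ) ∣ c := by
    rintro ⟨w, rfl⟩
    obtain ⟨y, hy⟩ := hcs.dvd
    rw [mul_assoc] at hy
    omega
  have hc9 : IsCoprime (9 : ℤ) c := by
    have : IsCoprime ((3 : ℤ) ^ 2) c := ((Int.prime_three.coprime_iff_not_dvd).mpr hc3).pow_left
    simpa using this
  -- The coefficients of `q ^ (2 / 9)` are compared in the sector `(c, 9)`, where all phases are `1`.
  obtain ⟨γ, hγ0, hγ1⟩ := hc9.symm.exists_SL2_row 1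
  set ω := expTwoPiI (1 / 3) with hωdef
  have hω : 1 + ω + ω ^ 2 = 0 := one_add_expTwoPiI_third
  set x : ℂ := ((T.chat 3 6 0 1 : ℤ) : ℂ) with hx
  set u : ℂ := ((-1 - x) * ω ^ 2 + x * ω - 2) / 8 with hu
  set v : ℂ := ((-1 - x) * ω + x * ω ^ 2 - 2) / 8 with hv
  have key := T.weightTwo_eq_levelNineForm_slash hπ hC hx (u := u) (v := v)
    (by rw [hu]; ring) (by rw [hv]; ring) γ
  obtain ⟨b, hb, hb2, -⟩ := T.hasQExp_weightTwo_nine 3 (γ 1 0) (γ 1 1)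
  obtain ⟨e, he, -, he2⟩ := hasQExp_levelNineForm_of_not_dvd u v (γ := γ) (by rwa [hγ0])
  rw [← key] at he
  have hbe := congrFun (hb.coeff_unique (by norm_num) he) 2
  rw [hb2 2 (by norm_num), he2 (by rw [hγ1]), E2coeffUpper_one_eq_zero (by norm_num) (by norm_num),
    mul_zero, sub_zero, hγ0, hγ1, ← hωdef] at hbe
  have hmem : (s % 9).toNat ∈ Finset.range 9 := by simp; omega
  have hs : ((s % 9).toNat : ℤ) = s % 9 := Int.toNat_of_nonneg (Int.emod_nonneg _ (by norm_num))
  rw [Finset.sum_eq_single_of_mem _ hmem] at hbe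
  · rw [hs, T.chat_nine_congr (Int.ModEq.refl c) (Int.mod_modEq s 9)] at hbe
    have h1 : expTwoPiI (((s % 9).toNat : ℂ) * ((9 : ℤ) : ℂ) / 9) = 1 := by
      rw [expTwoPiI_eq_one_iff]
      exact ⟨(s % 9).toNat, by push_cast; ring⟩
    rw [h1, one_mul, Nat.cast_ofNat] at hbe
    have : (T.chat c s (2 / 9) 1 : ℂ) = 3 * ((T.chat 3 6 0 1 : ℤ) : ℂ) := by
      rw [hbe, hu, hv]
      linear_combination (2 - x + 2 * (1 + x) * (ω - 1) - x * ω * (ω - 1)) * hω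
    exact_mod_cast this
  · intro s' hs' hne
    have : T.chat c s' (((2 : ℕ) : ℚ) / 9) 1 = 0 := by
      by_contra h0
      have h2 := T.modEq_of_chat_ne_zero (k := 2) hM (by rw [h9]; simpa using h0)
      rw [h9] at h2
      have h3 : (9 : ℤ) ∣ c * (s' - s) := by
        have := (hcs.trans h2.symm).dvd
        rwa [← mul_sub] at this
      have h4 := hc9.dvd_of_dvd_mul_left h3
      simp at hs'
      omega
    rw [this]
    simp

end TwistedTwiningGenera

/-! ### The sign of the polar coefficients -/

namespace TwistedTwiningGenera

variable {π : FrameShape} {lam : ℕ}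

/-- The coefficients labelling divisors in the twisted sectors are non-positive. For `N = 9` and
discriminant `-1/9` this comes from `chat_nine_eq_three_mul`, otherwise from the walls. -/
theorem chat_nonpos (hπ : (π, lam) ∈ k3FrameShapes) (T : TwistedTwiningGenera π lam)
    (hC : T.StandardContourAssumption) {j k : ℤ} {n : ℚ} {l : ℤ} (hj : ¬ (π.order : ℤ) ∣ j)
    (hD : 4 * n - (l : ℚ) ^ 2 < 0) (h : T.OccursInLift j k n l) : T.chat j k n l ≤ 0 := by
  have hM : 0 < T.modulus := (modulus_facts hπ).1
  obtain ⟨m, n', l', hm, hN, hD', hc⟩ := T.exists_liftExp_eq hM hj h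
  rw [← hc]
  rw [← hD'] at hD
  by_cases hgen : π.order = 9 ∧ 4 * ((m : ℚ) * n' / T.modulus) - (l' : ℚ) ^ 2 = -1 / 9
  · obtain ⟨hord, hD9⟩ := hgen
    obtain ⟨rfl, rfl⟩ := eq_frameShapeNine hπ hord
    by_cases h0 : T.liftExp (m, n', l') = 0
    · exact h0.le
    have h9 := T.modulus_eq_nine
    have hodd : l' ≡ 1 [ZMOD 2] := Int.odd_iff.mp (T.odd_of_discr_neg hM h0 hD)
    have e : T.liftExp (m, n', l') = T.chat m n' (2 / 9) 1 :=
      T.chat_eq_of_discr_eq hM _ _ hodd (by rw [hD9]; norm_num)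
    rw [e] at h0 ⊢
    have hmn := T.modEq_of_chat_ne_zero (k := 2) hM (by rw [h9]; simpa using h0)
    rw [h9] at hmn
    have := T.chat_nine_eq_three_mul hπ hC hmn
    have := (T.chat_nine_values hπ hC).2.2.1
    omega
  · exact liftExp_nonpos hπ T hC hm hN hD hgen

/-- The coefficients of the twisted genera `φ_{g ^ i, e}` are sums over the charges. -/
theorem hasFourierExpansion_φ (T : TwistedTwiningGenera π lam) (hM : 0 < T.modulus) (i : ℤ) :
    HasFourierExpansion (T.φ i 0)
      (fun n l => ((∑ s ∈ Finset.range T.modulus, T.chat i s n l : ℤ) : ℂ)) := by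
  intro τ z
  have h1 := hasSum_sum fun (s : ℕ) (_ : s ∈ Finset.range T.modulus) => T.hat_expansion i s τ z
  rw [T.φ_eq_sum_hat hM]
  simp only [Int.cast_zero, mul_zero, zero_div, expTwoPiI_zero, one_mul]
  refine h1.congr_terms fun x => ?_
  push_cast
  rw [Finset.sum_mul]

/-- In the sector twisted by `g` every coefficient of `q ^ n y ^ (± 1)` labels a divisor. -/
theorem chat_one_nonpos (hπ : (π, lam) ∈ k3FrameShapes) (T : TwistedTwiningGenera π lam)
    (hC : T.StandardContourAssumption) (hN : 1 < π.order) (s : ℤ) {n : ℚ} {l : ℤ}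
    (hn : n < 1 / 4) (hl : l = 1 ∨ l = -1) : T.chat 1 s n l ≤ 0 := by
  have hM : 0 < T.modulus := (modulus_facts hπ).1
  have hMQ : (T.modulus : ℚ) ≠ 0 := by exact_mod_cast hM.ne'
  have hl2 : (l : ℚ) ^ 2 = 1 := by rcases hl with rfl | rfl <;> norm_num
  by_cases h0 : T.chat 1 s n l = 0
  · exact h0.le
  obtain ⟨-, w, hw⟩ := T.chat_support h0
  refine chat_nonpos hπ T hC (fun h => ?_) (by rw [hl2]; linarith)
    ⟨1, s + T.modulus * w, l, Int.ModEq.refl _, ?_, Int.ModEq.refl _, ?_⟩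
  · have := Int.le_of_dvd one_pos h
    omega
  · simp [Int.modEq_iff_dvd]
  · rw [hw]
    push_cast
    field_simp

end TwistedTwiningGenera

theorem claim1 (π : FrameShape) (lam : ℕ) (hπ : (π, lam) ∈ k3FrameShapes)
    (T : TwistedTwiningGenera π lam) (hC : T.StandardContourAssumption) :
    (∀ (j k : ℤ) (n : ℚ) (l : ℤ), ¬ (π.order : ℤ) ∣ j → 4 * n - (l : ℚ) ^ 2 < 0 →
      T.OccursInLift j k n l → T.chat j k n l ≤ 0) ∧
    (1 < π.order → ∃ c : ℚ → ℤ → ℤ,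
      HasFourierExpansion (T.φ 1 0) (fun n l => (c n l : ℂ)) ∧
      ∀ n : ℚ, n < 1 / 4 → c n 1 ≤ 0 ∧ c n (-1) ≤ 0) := by
  refine ⟨fun j k n l hj hD h => T.chat_nonpos hπ hC hj hD h, fun hN =>
    ⟨_, T.hasFourierExpansion_φ (modulus_facts hπ).1 1, fun n hn => ⟨?_, ?_⟩⟩⟩
  · exact Finset.sum_nonpos fun s _ => T.chat_one_nonpos hπ hC hN s hn (Or.inl rfl)
  · exact Finset.sum_nonpos fun s _ => T.chat_one_nonpos hπ hC hN s hn (Or.inr rfl)
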